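/- Let $M$ be a connected smooth manifold of dimension $n\ge 2$, let $\alpha=\sqrt{a_{ij}(x)y^iy^j}$ be a smooth Riemannian metric on $M$ and $\beta=b_i(x)y^i$ a smooth $1$-form on $M$ with $\|\beta\|_\alpha<1$ at every point, and suppose that the Randers metric $F=\alpha+\beta$ is non-Riemannian, i.e. $F$ is not the norm function of a smooth Riemannian metric on $M$ (equivalently, $\beta\not\equiv0$). Notation (in local coordinates, at nonzero tangent vectors). Put $g_{ij}=\tfrac12[F^2]_{y^iy^j}$, $G^i=\tfrac14g^{il}\{[F^2]_{x^my^l}y^m-[F^2]_{x^l}\}$, and let $\mathrm{Ric}=R^i_{\ i}$, where $$R^i_{\ k}=2\frac{\partial G^i}{\partial x^k}-y^j\frac{\partial^2G^i}{\partial x^j\partial y^k}+2G^j\frac{\partial^2G^i}{\partial y^j\partial y^k}-\frac{\partial G^i}{\partial y^j}\frac{\partial G^j}{\partial y^k}.$$ Let $dm_{BH}=\sigma_{BH}\,dx$ with $\sigma_{BH}(x)=\mathrm{Vol}(\mathbb B^n_1)/\mathrm{Vol}\{y\in\mathbb R^n: F(x,y)<1\}$ be the Busemann-Hausdorff measure,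 let $\tau=\log\big(\sqrt{\det(g_{ij})}/\sigma_{BH}\big)$ be its distortion, and let $S_{BH}(x,y)=\frac{d}{dt}\big|_{t=0}\tau(\eta(t),\dot\eta(t))$, where $\eta$ is the geodesic ($\ddot\eta^i+2G^i(\eta,\dot\eta)=0$) with $\eta(0)=x$, $\dot\eta(0)=y$, be the S-curvature. $F$ has isotropic $S_{BH}$-curvature if $S_{BH}=(n+1)\sigma F$ for some function $\sigma=\sigma(x)$ on $M$, and constant $S_{BH}$-curvature if moreover $\sigma$ can be taken constant. For a vector field $V$ on $M$, let $\hat V=V^i\frac{\partial}{\partial x^i}+y^j\frac{\partial V^i}{\partial x^j}\frac{\partial}{\partial y^i}$ be its complete lift to $TM$, and write $\mathcal L_{\hat V}\Xi=\hat V(\Xi)$ for a function $\Xi$ on $TM$. $V$ is a conformal vector field of $\alpha$ with conformal factor $c=c(x)$ if $\mathcal L_{\hat V}\alpha=2c\alpha$, and a homothetic vector field of $F$ if $\mathcal L_{\hat V}F=2c_0F$ for some constant $c_0$. $(M,F,V)$ is an almost Ricci soliton if $V$ is $C^2$ and there is a function $\kappa=\kappa(x)$ on $M$ with $$2\,\mathrm{Ric}+\mathcal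 L_{\hat V}(F^2)=2\kappa F^2 .$$ Claim. Let $V$ be a vector field on $M$ such that $(M,F,V)$ is an almost Ricci soliton. Then $F$ has isotropic $S_{BH}$-curvature, and $V$ is a conformal vector field of $\alpha$ with some conformal factor $c=c(x)$. If moreover $\mathcal L_{\hat V}\beta=2c\beta$ for this conformal factor $c$, then $F$ has constant $S_{BH}$-curvature and $V$ is a homothetic vector field of $F$. -/

import Mathlib

open scoped Manifold ContDiff

noncomputable section

namespace Randers

/-- The coordinate space `ℝⁿ` with its Euclidean structure. -/
abbrev Coord (n : ℕ) : Type := EuclideanSpace ℝ (Fin n)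

/-! ### Calculus in coordinates `(u, y)` on `U × ℝⁿ`, the tangent bundle of a coordinate domain.

A function on the tangent bundle is, in coordinates, a function `f u y` of the position
`u = (x¹, …, xⁿ)` and of the fibre variable `y = (y¹, …, yⁿ)`. -/

section Coordinates

variable {n : ℕ}

/-- The partial derivative `∂f/∂xⁱ`. -/
def dx (i : Fin n) (f : Coord n → Coord n → ℝ) (u y : Coord n) : ℝ :=
  fderiv ℝ (fun v => f v y) u (EuclideanSpace.single i 1)

/-- The partial derivative `∂f/∂yⁱ`. -/
def dy (i : Fin n) (f : Coord n → Coord n → ℝ) (u y : Coord n) : ℝ :=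
  fderiv ℝ (fun z => f u z) y (EuclideanSpace.single i 1)

/-- The function `F²`. -/
def sqFun (F : Coord n → Coord n → ℝ) : Coord n → Coord n → ℝ := fun u y => F u y ^ 2

/-- The fundamental tensor `g_ij = ½ [F²]_{yⁱ yʲ}`. -/
def fundTensor (F : Coord n → Coord n → ℝ) (u y : Coord n) : Matrix (Fin n) (Fin n) ℝ :=
  Matrix.of fun i j => (1 / 2) * dy j (dy i (sqFun F)) u y

/-- The geodesic coefficients `Gⁱ = ¼ g^{il} ([F²]_{xᵐ yˡ} yᵐ - [F²]_{xˡ})`. -/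
def geodCoeff (F : Coord n → Coord n → ℝ) (i : Fin n) (u y : Coord n) : ℝ :=
  (1 / 4) * ∑ l, (fundTensor F u y)⁻¹ i l *
    ((∑ m, dy l (dx m (sqFun F)) u y * y m) - dx l (sqFun F) u y)

/-- The Riemann curvature
`Rⁱ_k = 2 ∂Gⁱ/∂xᵏ - yʲ ∂²Gⁱ/∂xʲ∂yᵏ + 2 Gʲ ∂²Gⁱ/∂yʲ∂yᵏ - ∂Gⁱ/∂yʲ ∂Gʲ/∂yᵏ`. -/
def riemannCurv (F : Coord n → Coord n → ℝ) (i k : Fin n) (u y : Coord n) : ℝ :=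
  2 * dx k (geodCoeff F i) u y
    - (∑ j, y j * dx j (dy k (geodCoeff F i)) u y)
    + 2 * (∑ j, geodCoeff F j u y * dy j (dy k (geodCoeff F i)) u y)
    - ∑ j, dy j (geodCoeff F i) u y * dy k (geodCoeff F j) u y

/-- The Ricci curvature `Ric = Rⁱ_i`, a function of `(u, y)`. -/
def ricci (F : Coord n → Coord n → ℝ) (u y : Coord n) : ℝ :=
  ∑ i, riemannCurv F i i u y

/-- The density of the Busemann-Hausdorff measure with respect to Lebesgue measure `dx`:
`σ_BH(u) = Vol(unit ball of ℝⁿ) / Vol {y | F(u, y) < 1}`. -/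
def densityBH (F : Coord n → Coord n → ℝ) (u : Coord n) : ℝ :=
  (MeasureTheory.volume (Metric.ball (0 : Coord n) 1)).toReal /
    (MeasureTheory.volume {y : Coord n | F u y < 1}).toReal

/-- The distortion `τ = log (√det(g_ij) / σ_BH)` for the Busemann-Hausdorff measure. -/
def distortionBH (F : Coord n → Coord n → ℝ) (u y : Coord n) : ℝ :=
  Real.log (Real.sqrt (fundTensor F u y).det / densityBH F u)

/-- The S-curvature for the Busemann-Hausdorff measure: the rate of change
`d/dt τ(η(t), η'(t))` at `t = 0` of the distortion along the geodesic `η` (so `η'' = -2 G(η, η')`)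
with `η(0) = u` and `η'(0) = y`, i.e. `S = yⁱ ∂τ/∂xⁱ - 2 Gⁱ ∂τ/∂yⁱ`. -/
def sCurvBH (F : Coord n → Coord n → ℝ) (u y : Coord n) : ℝ :=
  (∑ i, y i * dx i (distortionBH F) u y)
    - 2 * ∑ i, geodCoeff F i u y * dy i (distortionBH F) u y

/-- The Lie derivative `ℒ_V̂ f = V̂(f)` of a function `f` on the tangent bundle along the complete
lift `V̂ = Vⁱ ∂/∂xⁱ + yʲ (∂Vⁱ/∂xʲ) ∂/∂yⁱ` of the vector field `V`. -/
def lieLift (V : Coord n → Coord n) (f : Coord n → Coord n → ℝ) (u y : Coord n) : ℝ :=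
  (∑ i, V u i * dx i f u y)
    + ∑ i, (∑ j, y j * fderiv ℝ (fun v => V v i) u (EuclideanSpace.single j 1)) * dy i f u y

end Coordinates

/-! ### Objects on a manifold

`M` is an `n`-dimensional smooth manifold. Local coordinates are the charts of its maximal smooth
atlas. Every condition below is asked for in all local coordinates; the quantities involved do not
depend on the coordinates, so it is the same to ask for it in one chart around each point. -/

section Manifold

variable {n : ℕ} {M : Type*} [TopologicalSpace M] [ChartedSpace (Coord n) M]

/-- The coordinate expression `f u y`, for `u` in the target of the chart `e`, of a function on the
tangent bundle: the value of the function at the tangent vector `yⁱ ∂/∂xⁱ` at the point with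
coordinates `u`. -/
def localFun (f : ∀ x : M, TangentSpace 𝓘(ℝ, Coord n) x → ℝ)
    (e : OpenPartialHomeomorph M (Coord n)) (u y : Coord n) : ℝ :=
  f (e.symm u) (mfderiv 𝓘(ℝ, Coord n) 𝓘(ℝ, Coord n) e.symm u y)

/-- The components `(V¹(u), …, Vⁿ(u))` of a vector field in the chart `e`. -/
def localField (V : ∀ x : M, TangentSpace 𝓘(ℝ, Coord n) x)
    (e : OpenPartialHomeomorph M (Coord n)) (u : Coord n) : Coord n :=
  mfderiv 𝓘(ℝ, Coord n) 𝓘(ℝ, Coord n) e (e.symm u) (V (e.symm u))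

/-- `(M, F, V)` is an almost Ricci soliton: `V` is a `C²` vector field and there is a scalar
function `κ` on `M` with `2 Ric + ℒ_V̂ (F²) = 2 κ F²` at all nonzero tangent vectors. -/
def IsAlmostRicciSoliton [IsManifold 𝓘(ℝ, Coord n) ∞ M]
    (F : ∀ x : M, TangentSpace 𝓘(ℝ, Coord n) x → ℝ)
    (V : ∀ x : M, TangentSpace 𝓘(ℝ, Coord n) x) : Prop :=
  ContMDiff 𝓘(ℝ, Coord n) 𝓘(ℝ, Coord n).tangent 2
      (fun x => (⟨x, V x⟩ : TangentBundle 𝓘(ℝ, Coord n) M)) ∧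
    ∃ κ : M → ℝ, ∀ e ∈ IsManifold.maximalAtlas 𝓘(ℝ, Coord n) ∞ M,
      ∀ u ∈ e.target, ∀ y : Coord n, y ≠ 0 →
        2 * ricci (localFun F e) u y + lieLift (localField V e) (sqFun (localFun F e)) u y
          = 2 * κ (e.symm u) * localFun F e u y ^ 2

/-- `F` has isotropic S-curvature `σ` with respect to the Busemann-Hausdorff measure:
`S_BH = (n + 1) σ F`. -/
def HasIsotropicSBH (F : ∀ x : M, TangentSpace 𝓘(ℝ, Coord n) x → ℝ) (σ : M → ℝ) : Prop :=
  ∀ e ∈ IsManifold.maximalAtlas 𝓘(ℝ, Coord n) ∞ M,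
    ∀ u ∈ e.target, ∀ y : Coord n, y ≠ 0 →
      sCurvBH (localFun F e) u y = ((n : ℝ) + 1) * σ (e.symm u) * localFun F e u y

/-- `ℒ_V̂ f = 2 c f` on the nonzero tangent vectors. -/
def LieEq (f : ∀ x : M, TangentSpace 𝓘(ℝ, Coord n) x → ℝ)
    (V : ∀ x : M, TangentSpace 𝓘(ℝ, Coord n) x) (c : M → ℝ) : Prop :=
  ∀ e ∈ IsManifold.maximalAtlas 𝓘(ℝ, Coord n) ∞ M,
    ∀ u ∈ e.target, ∀ y : Coord n, y ≠ 0 →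
      lieLift (localField V e) (localFun f e) u y = 2 * c (e.symm u) * localFun f e u y

/-- `V` is a conformal vector field of the (Finsler or Riemannian) metric `F` with conformal
factor `c`: `ℒ_V̂ F = 2 c F`. -/
def IsConformalField (F : ∀ x : M, TangentSpace 𝓘(ℝ, Coord n) x → ℝ)
    (V : ∀ x : M, TangentSpace 𝓘(ℝ, Coord n) x) (c : M → ℝ) : Prop :=
  LieEq F V c

/-- `V` is a homothetic vector field of `F` with dilation the constant `c`. -/
def IsHomotheticField (F : ∀ x : M, TangentSpace 𝓘(ℝ, Coord n) x → ℝ)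
    (V : ∀ x : M, TangentSpace 𝓘(ℝ, Coord n) x) (c : ℝ) : Prop :=
  IsConformalField F V (fun _ => c)

/-- The norm function `y ↦ √(g_ij yⁱ yʲ)` on the tangent bundle of a smooth Riemannian metric. -/
def metricNorm [IsManifold 𝓘(ℝ, Coord n) ∞ M]
    (g : Bundle.ContMDiffRiemannianMetric 𝓘(ℝ, Coord n) ∞ (Coord n)
      (fun x : M => TangentSpace 𝓘(ℝ, Coord n) x))
    (x : M) (y : TangentSpace 𝓘(ℝ, Coord n) x) : ℝ :=
  Real.sqrt (g.inner x y y)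

/-- `F` is Riemannian: it is the norm function of a smooth Riemannian metric. -/
def IsRiemannian [IsManifold 𝓘(ℝ, Coord n) ∞ M]
    (F : ∀ x : M, TangentSpace 𝓘(ℝ, Coord n) x → ℝ) : Prop :=
  ∃ g : Bundle.ContMDiffRiemannianMetric 𝓘(ℝ, Coord n) ∞ (Coord n)
      (fun x : M => TangentSpace 𝓘(ℝ, Coord n) x),
    ∀ (x : M) (y : TangentSpace 𝓘(ℝ, Coord n) x), F x y = metricNorm g x y

end Manifold

/-- The data of a Randers metric on `M`: a smooth Riemannian metric `α² = a_ij yⁱ yʲ` and a smooth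
`1`-form `β = b_i yⁱ` with `‖β‖_α < 1` at each point. -/
structure RandersMetric (n : ℕ) (M : Type*) [TopologicalSpace M] [ChartedSpace (Coord n) M]
    [IsManifold 𝓘(ℝ, Coord n) ∞ M] where
  /-- the Riemannian metric `a_ij` -/
  a : Bundle.ContMDiffRiemannianMetric 𝓘(ℝ, Coord n) ∞ (Coord n)
    (fun x : M => TangentSpace 𝓘(ℝ, Coord n) x)
  /-- the `1`-form `b_i` -/
  b : ∀ x : M, TangentSpace 𝓘(ℝ, Coord n) x →L[ℝ] ℝ
  smooth_b : ContMDiff 𝓘(ℝ, Coord n) (𝓘(ℝ, Coord n).prod 𝓘(ℝ, Coord n →L[ℝ] ℝ)) ∞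
    (fun x => Bundle.TotalSpace.mk' (Coord n →L[ℝ] ℝ)
      (E := fun x : M => TangentSpace 𝓘(ℝ, Coord n) x →L[ℝ] Bundle.Trivial M ℝ x) x (b x))
  norm_b_lt : ∀ x : M, ∃ r < (1 : ℝ), ∀ y : TangentSpace 𝓘(ℝ, Coord n) x,
    |b x y| ≤ r * metricNorm a x y

namespace RandersMetric

variable {n : ℕ} {M : Type*} [TopologicalSpace M] [ChartedSpace (Coord n) M]
  [IsManifold 𝓘(ℝ, Coord n) ∞ M]

/-- `α`, as a function on the tangent bundle. -/
def alpha (R : RandersMetric n M) (x : M) (y : TangentSpace 𝓘(ℝ, Coord n) x) : ℝ :=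
  metricNorm R.a x y

/-- `β`, as a function on the tangent bundle. -/
def beta (R : RandersMetric n M) (x : M) (y : TangentSpace 𝓘(ℝ, Coord n) x) : ℝ :=
  R.b x y

/-- The Randers metric `F = α + β`. -/
def F (R : RandersMetric n M) (x : M) (y : TangentSpace 𝓘(ℝ, Coord n) x) : ℝ :=
  R.alpha x y + R.beta x y

end RandersMetric

end Randers

end

/-!
A Randers metric `F = α + β` in local coordinates is given by the coefficients of `α²` and `β`
(`LocalRanders`). With `r` and `s` the symmetrised covariant derivative of `β` and the one-form
`s_j = bⁱ s_ij`, its geodesic coefficients are `Gⁱ = ½ Γⁱ_00 + P yⁱ + α sⁱ_0`, where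
`P = (r_00 - 2 α s_0) / (2 F)` (`geodCoeff_eq`). This gives the Ricci curvature at the origin of
normal coordinates (`ricci_normal`), and, since the indicatrix is a translated ellipsoid, also the
S-curvature (`sCurvBH_eq`). In particular `S_BH = (n + 1) σ F` as soon as
`e_00 = r_00 + 2 β s_0` equals `2 σ (α² - β²)` (`IsoAt`).

*Isotropic S-curvature.* The soliton equation at `y` and `-y` splits into an even and an odd part,
and it follows that `α² - β²` divides `(n - 1) β e_00²`, or `(n - 1) e_00²` where `β = 0`. Since
`α² - β²` is definite, evaluating at its complex zeros shows that `e_00` is a multiple of it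
(`SolitonAt.exists_isoAt`).

*The field is conformal.* With this relation the soliton equation becomes a polynomial equation
(`SolitonAt.even_odd`). Its odd part is `α² ℓ + β ℒ_V α² = 0` for a linear form `ℓ`, so `ℒ_V α²` is
a multiple of `α²` where `β ≠ 0` (`SolitonAt.conformal_of_ne`); on a surface the even part gives the
same where `β = 0` (`SolitonAt.conformal_two`). For `n ≥ 3` the relation for `e_00` is an
overdetermined system of conformal Killing type for `β` with unknown factor `σ`. Its prolongation is
of finite type, so that `β` would vanish identically if it vanished on an open set
(`eventually_b_eq_zero`, `IsIso.interior_zeroSet`); then `F` would be Riemannian. Hence `β ≠ 0` on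
a dense set, and `V` is conformal by continuity.

*Rigidity.* If `V` scales `β` by the conformal factor of `α`, the soliton equation says that `F` is
an Einstein metric. Comparing the divergence of `s_ij` computed from its odd part with the one
computed from the contracted Ricci identity, one finds `dσ = 0` (`SolitonAt.fderiv_sigma_eq_zero`).
This also yields the density of `{β ≠ 0}` on surfaces, where a constant `σ` vanishes if `β` does on
an open set. Finally, the Lie derivatives along `V` of the relation for `e_00` and of its
consequence `½ d‖β‖² = (1 - ‖β‖²) (2 σ β + s)` force the differential of the conformal factor to
vanish where `β ≠ 0` (`fderiv_factor_eq_zero`), hence everywhere (`IsIso.homothetic`).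

The curvature formulas are used in coordinates in which the first derivatives of the metric vanish
at the point considered (`exists_normal_chart`); the relation for `e_00` and the Lie derivatives of
`α²` are transferred to other charts by `LocalRanders.Related`.
-/

set_option maxSynthPendingDepth 3
set_option linter.unusedSectionVars false

noncomputable section

namespace Randers

open Filter Topology

/-! ### Randers metrics in local coordinates -/

/-- A Randers metric in local coordinates on an open set `U`: the metric `A u y z = a_ij yⁱ zʲ` and
the one-form `b u y = b_i yⁱ`, as smooth functions of the position `u ∈ U`. The condition
`‖β‖_α < 1` is stated as `β² < α²` off the zero section. -/
structure LocalRanders (E : Type*) [NormedAddCommGroup E] [NormedSpace ℝ E] where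
  /-- the coordinate domain -/
  U : Set E
  /-- the metric -/
  A : E → E →L[ℝ] E →L[ℝ] ℝ
  /-- the one-form -/
  b : E → E →L[ℝ] ℝ
  isOpen : IsOpen U
  smooth_A : ContDiffOn ℝ ∞ A U
  smooth_b : ContDiffOn ℝ ∞ b U
  symm : ∀ u ∈ U, ∀ y z, A u y z = A u z y
  pos : ∀ u ∈ U, ∀ y, y ≠ 0 → 0 < A u y y
  sq_lt : ∀ u ∈ U, ∀ y, y ≠ 0 → b u y ^ 2 < A u y y

/-- Exchanging the two arguments of a bilinear map, as a continuous linear map. -/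
def flipL (F₂ F₃ F₄ : Type*) [NormedAddCommGroup F₂] [NormedSpace ℝ F₂] [NormedAddCommGroup F₃]
    [NormedSpace ℝ F₃] [NormedAddCommGroup F₄] [NormedSpace ℝ F₄] :
    (F₂ →L[ℝ] F₃ →L[ℝ] F₄) →L[ℝ] (F₃ →L[ℝ] F₂ →L[ℝ] F₄) :=
  (ContinuousLinearMap.flipₗᵢ ℝ F₂ F₃ F₄).toLinearIsometry.toContinuousLinearMap

@[simp] lemma flipL_apply {F₂ F₃ F₄ : Type*} [NormedAddCommGroup F₂] [NormedSpace ℝ F₂]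
    [NormedAddCommGroup F₃] [NormedSpace ℝ F₃] [NormedAddCommGroup F₄] [NormedSpace ℝ F₄]
    (f : F₂ →L[ℝ] F₃ →L[ℝ] F₄) : flipL F₂ F₃ F₄ f = f.flip := rfl

lemma contDiffAt_flip {F₁ F₂ F₃ F₄ : Type*} [NormedAddCommGroup F₁] [NormedSpace ℝ F₁]
    [NormedAddCommGroup F₂] [NormedSpace ℝ F₂] [NormedAddCommGroup F₃] [NormedSpace ℝ F₃]
    [NormedAddCommGroup F₄] [NormedSpace ℝ F₄] {m : WithTop ℕ∞}
    {f : F₁ → F₂ →L[ℝ] F₃ →L[ℝ] F₄} {v : F₁} (hf : ContDiffAt ℝ m f v) :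
    ContDiffAt ℝ m (fun v => (f v).flip) v :=
  (flipL F₂ F₃ F₄).contDiff.contDiffAt.comp v hf

namespace LocalRanders

variable {E : Type*} [NormedAddCommGroup E] [NormedSpace ℝ E] (D : LocalRanders E)

/-- The trilinear form `(y, z, x) ↦ Γ_{x y z}`, the Christoffel symbols of the first kind. -/
def chrisForm (u : E) : E →L[ℝ] E →L[ℝ] E →L[ℝ] ℝ :=
  (1 / 2 : ℝ) • (fderiv ℝ D.A u + (fderiv ℝ D.A u).flip
    - (flipL E E ℝ) ∘L (fderiv ℝ D.A u).flip)

/-- The operator raising indices with the metric. -/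
def sharp (u : E) : (E →L[ℝ] ℝ) →L[ℝ] E := (D.A u).inverse

/-- The Christoffel symbols `Γ u y z = Γⁱ_jk yʲ zᵏ`. -/
def Γ (u : E) : E →L[ℝ] E →L[ℝ] E :=
  ((ContinuousLinearMap.compL ℝ E (E →L[ℝ] ℝ) E) (D.sharp u)) ∘L D.chrisForm u

/-- The vector field `bⁱ = a^{ij} b_j`. -/
def X (u : E) : E := D.sharp u (D.b u)

/-- The operator `y ↦ sⁱ_j yʲ`, where `s_ij = ½ (∂_j b_i - ∂_i b_j)`. -/
def S (u : E) : E →L[ℝ] E :=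
  D.sharp u ∘L ((1 / 2 : ℝ) • (fderiv ℝ D.b u - (fderiv ℝ D.b u).flip))

/-- The symmetrised covariant derivative `r_ij = ½ (b_{i|j} + b_{j|i})`. -/
def r (u : E) : E →L[ℝ] E →L[ℝ] ℝ :=
  (1 / 2 : ℝ) • (fderiv ℝ D.b u + (fderiv ℝ D.b u).flip)
    - (ContinuousLinearMap.compL ℝ E E ℝ (D.b u)) ∘L D.Γ u

/-- The one-form `s_j = bⁱ s_ij`. -/
def s (u : E) : E →L[ℝ] ℝ := D.b u ∘L D.S u

/-- The form `e_ij = r_ij + b_i s_j + b_j s_i` on the diagonal, `e_00 = r_00 + 2 β s_0`. -/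
def e (u y : E) : ℝ := D.r u y y + 2 * D.b u y * D.s u y

/-- The norm `α`. -/
def α (u y : E) : ℝ := Real.sqrt (D.A u y y)

/-- The Randers metric `α + β`. -/
def F (u y : E) : ℝ := D.α u y + D.b u y

/-- The numerator `r_00 - 2 α s_0` of twice the projective factor. -/
def N (u y : E) : ℝ := D.r u y y - 2 * D.α u y * D.s u y

/-- The projective factor `P = (r_00 - 2 α s_0) / (2 F)` of the geodesic coefficients. -/
def P (u y : E) : ℝ := D.N u y / (2 * D.F u y)

/-- The geodesic coefficients `Gⁱ = ½ Γⁱ_00 + P yⁱ + α sⁱ_0` as a vector. -/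
def G (u y : E) : E :=
  (1 / 2 : ℝ) • D.Γ u y y + D.P u y • y + D.α u y • D.S u y

variable [FiniteDimensional ℝ E]

/-! ### Characterisations and smoothness -/

variable {D} {u y z x : E}

lemma A_bijective (hu : u ∈ D.U) : Function.Bijective (D.A u) := by
  have hinj : Function.Injective (D.A u).toLinearMap := by
    rw [← LinearMap.ker_eq_bot, LinearMap.ker_eq_bot']
    intro y hy
    by_contra h
    have h1 := D.pos u hu y h
    have h2 : D.A u y = 0 := hy
    simp [h2] at h1
  refine ⟨hinj, ?_⟩
  have hd : Module.finrank ℝ E = Module.finrank ℝ (E →L[ℝ] ℝ) := by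
    rw [← (LinearMap.toContinuousLinearMap (𝕜 := ℝ) (E := E) (F' := ℝ)).finrank_eq]
    exact (Subspace.dual_finrank_eq (K := ℝ) (V := E)).symm
  exact (LinearMap.injective_iff_surjective_of_finrank_eq_finrank hd).1 hinj

/-- The metric at a point of the domain, as an isomorphism onto the dual space. -/
def AEquiv (hu : u ∈ D.U) : E ≃L[ℝ] (E →L[ℝ] ℝ) :=
  (LinearEquiv.ofBijective (D.A u).toLinearMap (A_bijective hu)).toContinuousLinearEquiv

lemma coe_AEquiv (hu : u ∈ D.U) : (AEquiv hu : E →L[ℝ] (E →L[ℝ] ℝ)) = D.A u := by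
  ext y z; rfl

lemma A_sharp (hu : u ∈ D.U) (φ : E →L[ℝ] ℝ) : D.A u (D.sharp u φ) = φ := by
  have h : D.sharp u = (AEquiv hu).symm := by
    rw [sharp, ← coe_AEquiv hu, ContinuousLinearMap.inverse_equiv]
  rw [h, ← coe_AEquiv hu]
  exact (AEquiv hu).apply_symm_apply φ

lemma contDiffAt_A (hu : u ∈ D.U) : ContDiffAt ℝ ∞ D.A u :=
  D.smooth_A.contDiffAt (D.isOpen.mem_nhds hu)

lemma contDiffAt_b (hu : u ∈ D.U) : ContDiffAt ℝ ∞ D.b u :=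
  D.smooth_b.contDiffAt (D.isOpen.mem_nhds hu)

lemma contDiffAt_fderiv_A (hu : u ∈ D.U) : ContDiffAt ℝ ∞ (fderiv ℝ D.A) u :=
  (contDiffAt_A hu).fderiv_right (by simp)

lemma contDiffAt_fderiv_b (hu : u ∈ D.U) : ContDiffAt ℝ ∞ (fderiv ℝ D.b) u :=
  (contDiffAt_b hu).fderiv_right (by simp)

lemma contDiffAt_sharp (hu : u ∈ D.U) : ContDiffAt ℝ ∞ D.sharp u := by
  have h : ContDiffAt ℝ ∞ (ContinuousLinearMap.inverse :
      (E →L[ℝ] (E →L[ℝ] ℝ)) → _) (D.A u) := by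
    rw [← coe_AEquiv hu]; exact contDiffAt_map_inverse _
  exact h.comp u (contDiffAt_A hu)

lemma contDiffAt_chrisForm (hu : u ∈ D.U) : ContDiffAt ℝ ∞ D.chrisForm u := by
  have h := contDiffAt_fderiv_A hu
  have h' := contDiffAt_flip h
  exact ((h.add h').sub (contDiffAt_const.clm_comp h')).const_smul _

lemma contDiffAt_Γ (hu : u ∈ D.U) : ContDiffAt ℝ ∞ D.Γ u :=
  ((ContinuousLinearMap.contDiff _).contDiffAt.comp u (contDiffAt_sharp hu)).clm_comp
    (contDiffAt_chrisForm hu)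

lemma contDiffAt_X (hu : u ∈ D.U) : ContDiffAt ℝ ∞ D.X u :=
  (contDiffAt_sharp hu).clm_apply (contDiffAt_b hu)

lemma contDiffAt_S (hu : u ∈ D.U) : ContDiffAt ℝ ∞ D.S u :=
  (contDiffAt_sharp hu).clm_comp
    (((contDiffAt_fderiv_b hu).sub (contDiffAt_flip (contDiffAt_fderiv_b hu))).const_smul _)

lemma contDiffAt_r (hu : u ∈ D.U) : ContDiffAt ℝ ∞ D.r u :=
  (((contDiffAt_fderiv_b hu).add (contDiffAt_flip (contDiffAt_fderiv_b hu))).const_smul _).sub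
    (((ContinuousLinearMap.contDiff _).contDiffAt.comp u (contDiffAt_b hu)).clm_comp
      (contDiffAt_Γ hu))

lemma contDiffAt_s (hu : u ∈ D.U) : ContDiffAt ℝ ∞ D.s u :=
  (contDiffAt_b hu).clm_comp (contDiffAt_S hu)

lemma A_X (hu : u ∈ D.U) (z : E) : D.A u (D.X u) z = D.b u z := by
  rw [X, A_sharp hu]

lemma A_S (hu : u ∈ D.U) (y z : E) :
    D.A u (D.S u y) z = 1 / 2 * (fderiv ℝ D.b u y z - fderiv ℝ D.b u z y) := by
  simp [S, A_sharp hu]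

lemma A_Γ (hu : u ∈ D.U) (y z x : E) :
    D.A u (D.Γ u y z) x =
      1 / 2 * (fderiv ℝ D.A u y z x + fderiv ℝ D.A u z y x - fderiv ℝ D.A u x y z) := by
  simp [Γ, A_sharp hu, chrisForm]

lemma r_apply (y z : E) : D.r u y z =
    1 / 2 * (fderiv ℝ D.b u y z + fderiv ℝ D.b u z y) - D.b u (D.Γ u y z) := by
  simp [r]; ring

lemma s_apply (y : E) : D.s u y = D.b u (D.S u y) := rfl

lemma A_skew (hu : u ∈ D.U) (y z : E) : D.A u (D.S u y) z = - D.A u (D.S u z) y := by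
  rw [A_S hu, A_S hu]; ring

lemma A_S_self (hu : u ∈ D.U) (y : E) : D.A u (D.S u y) y = 0 := by
  rw [A_S hu]; ring

lemma s_eq (hu : u ∈ D.U) (y : E) :
    D.s u y = 1 / 2 * (fderiv ℝ D.b u y (D.X u) - fderiv ℝ D.b u (D.X u) y) := by
  rw [s_apply, ← A_X hu, D.symm u hu, A_S hu]

lemma s_X (hu : u ∈ D.U) : D.s u (D.X u) = 0 := by rw [s_eq hu]; ring

lemma fderiv_A_symm (hu : u ∈ D.U) (w y z : E) :
    fderiv ℝ D.A u w y z = fderiv ℝ D.A u w z y := by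
  have hd := (contDiffAt_A hu).differentiableAt (by simp)
  have h : (fun v => D.A v y z) =ᶠ[𝓝 u] fun v => D.A v z y := by
    filter_upwards [D.isOpen.mem_nhds hu] with v hv using D.symm v hv y z
  have e1 : ∀ y z, fderiv ℝ (fun v => D.A v y z) u w = fderiv ℝ D.A u w y z := by
    intro y z
    have h1 := ((hd.hasFDerivAt.clm_apply (hasFDerivAt_const y u)).clm_apply
      (hasFDerivAt_const z u))
    rw [h1.fderiv]; simp
  rw [← e1, ← e1, h.fderiv_eq]

lemma A_injective (hu : u ∈ D.U) (h : ∀ z, D.A u x z = D.A u y z) : x = y :=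
  (A_bijective hu).1 (ContinuousLinearMap.ext h)

lemma Γ_symm (hu : u ∈ D.U) (y z : E) : D.Γ u y z = D.Γ u z y := by
  refine A_injective hu fun x => ?_
  rw [A_Γ hu, A_Γ hu, fderiv_A_symm hu x y z]; ring

lemma r_symm (hu : u ∈ D.U) (y z : E) : D.r u y z = D.r u z y := by
  rw [r_apply, r_apply, Γ_symm hu]; ring

/-! ### Derivatives of the norm along the fibres and along the base -/

lemma α_pos (hu : u ∈ D.U) (hy : y ≠ 0) : 0 < D.α u y := Real.sqrt_pos.2 (D.pos u hu y hy)

lemma α_sq (hu : u ∈ D.U) (y : E) : D.α u y ^ 2 = D.A u y y := by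
  rw [α, Real.sq_sqrt]
  by_cases hy : y = 0
  · simp [hy]
  · exact (D.pos u hu y hy).le

lemma abs_b_lt (hu : u ∈ D.U) (hy : y ≠ 0) : |D.b u y| < D.α u y :=
  abs_lt_of_sq_lt_sq (by rw [α_sq hu]; exact D.sq_lt u hu y hy) (α_pos hu hy).le

lemma F_pos (hu : u ∈ D.U) (hy : y ≠ 0) : 0 < D.F u y := by
  have := (abs_lt.1 (abs_b_lt hu hy)).1
  unfold F; linarith

lemma α_neg (u y : E) : D.α u (-y) = D.α u y := by simp [α]

lemma contDiffAt_α (hu : u ∈ D.U) (hy : y ≠ 0) :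
    ContDiffAt ℝ ∞ (fun p : E × E => D.α p.1 p.2) (u, y) := by
  have h1 : ContDiffAt ℝ ∞ (fun p : E × E => D.A p.1) (u, y) :=
    (contDiffAt_A hu).comp (u, y) contDiffAt_fst
  exact ((h1.clm_apply contDiffAt_snd).clm_apply contDiffAt_snd).sqrt (D.pos u hu y hy).ne'

lemma contDiffAt_F (hu : u ∈ D.U) (hy : y ≠ 0) :
    ContDiffAt ℝ ∞ (fun p : E × E => D.F p.1 p.2) (u, y) := by
  have h1 : ContDiffAt ℝ ∞ (fun p : E × E => D.b p.1) (u, y) :=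
    (contDiffAt_b hu).comp (u, y) contDiffAt_fst
  exact (contDiffAt_α hu hy).add (h1.clm_apply contDiffAt_snd)

lemma contDiffAt_N (hu : u ∈ D.U) (hy : y ≠ 0) :
    ContDiffAt ℝ ∞ (fun p : E × E => D.N p.1 p.2) (u, y) := by
  have h1 : ContDiffAt ℝ ∞ (fun p : E × E => D.r p.1) (u, y) :=
    (contDiffAt_r hu).comp (u, y) contDiffAt_fst
  have h2 : ContDiffAt ℝ ∞ (fun p : E × E => D.s p.1) (u, y) :=
    (contDiffAt_s hu).comp (u, y) contDiffAt_fst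
  exact ((h1.clm_apply contDiffAt_snd).clm_apply contDiffAt_snd).sub
    ((contDiffAt_const.mul (contDiffAt_α hu hy)).mul (h2.clm_apply contDiffAt_snd))

lemma contDiffAt_P (hu : u ∈ D.U) (hy : y ≠ 0) :
    ContDiffAt ℝ ∞ (fun p : E × E => D.P p.1 p.2) (u, y) :=
  (contDiffAt_N hu hy).div (contDiffAt_const.mul (contDiffAt_F hu hy))
    (mul_ne_zero two_ne_zero (F_pos hu hy).ne')

lemma contDiffAt_G (hu : u ∈ D.U) (hy : y ≠ 0) :
    ContDiffAt ℝ ∞ (fun p : E × E => D.G p.1 p.2) (u, y) := by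
  have h1 : ContDiffAt ℝ ∞ (fun p : E × E => D.Γ p.1) (u, y) :=
    (contDiffAt_Γ hu).comp (u, y) contDiffAt_fst
  have h2 : ContDiffAt ℝ ∞ (fun p : E × E => D.S p.1) (u, y) :=
    (contDiffAt_S hu).comp (u, y) contDiffAt_fst
  exact ((((h1.clm_apply contDiffAt_snd).clm_apply contDiffAt_snd).const_smul _).add
    ((contDiffAt_P hu hy).smul contDiffAt_snd)).add
    ((contDiffAt_α hu hy).smul (h2.clm_apply contDiffAt_snd))

lemma hasFDerivAt_α_fibre (hu : u ∈ D.U) (hy : y ≠ 0) :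
    HasFDerivAt (fun z => D.α u z) ((D.α u y)⁻¹ • D.A u y) y := by
  have h1 : HasFDerivAt (fun z => D.A u z z) (D.A u y + (D.A u).flip y) y := by
    exact ((D.A u).hasFDerivAt (x := y)).clm_apply (hasFDerivAt_id y)
  have h2 := h1.sqrt (D.pos u hu y hy).ne'
  refine h2.congr_fderiv ?_
  ext z
  have h := (α_pos hu hy).ne'
  simp only [α] at h ⊢
  simp only [smul_apply, add_apply, ContinuousLinearMap.flip_apply, smul_eq_mul, D.symm u hu z y]
  field_simp
  ring

lemma hasFDerivAt_F_fibre (hu : u ∈ D.U) (hy : y ≠ 0) :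
    HasFDerivAt (fun z => D.F u z) ((D.α u y)⁻¹ • D.A u y + D.b u) y :=
  (hasFDerivAt_α_fibre hu hy).add (D.b u).hasFDerivAt

lemma hasFDerivAt_A_base (hu : u ∈ D.U) (y z : E) :
    HasFDerivAt (fun v => D.A v y z) (((fderiv ℝ D.A u).flip y).flip z) u := by
  have hd := (contDiffAt_A hu).differentiableAt (by simp)
  have h1 := ((hd.hasFDerivAt.clm_apply (hasFDerivAt_const y u)).clm_apply
      (hasFDerivAt_const z u))
  exact h1.congr_fderiv (by ext w; simp)

lemma hasFDerivAt_b_base (hu : u ∈ D.U) (y : E) :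
    HasFDerivAt (fun v => D.b v y) ((fderiv ℝ D.b u).flip y) u := by
  have hd := (contDiffAt_b hu).differentiableAt (by simp)
  have h1 := (hd.hasFDerivAt.clm_apply (hasFDerivAt_const y u))
  exact h1.congr_fderiv (by ext w; simp)

lemma hasFDerivAt_α_base (hu : u ∈ D.U) (hy : y ≠ 0) :
    HasFDerivAt (fun v => D.α v y) ((2 * D.α u y)⁻¹ • ((fderiv ℝ D.A u).flip y).flip y) u := by
  have h2 := (hasFDerivAt_A_base hu y y).sqrt (D.pos u hu y hy).ne'
  exact h2.congr_fderiv (by simp [α])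

lemma hasFDerivAt_F_base (hu : u ∈ D.U) (hy : y ≠ 0) :
    HasFDerivAt (fun v => D.F v y)
      ((2 * D.α u y)⁻¹ • ((fderiv ℝ D.A u).flip y).flip y + (fderiv ℝ D.b u).flip y) u :=
  (hasFDerivAt_α_base hu hy).add (hasFDerivAt_b_base hu y)

end LocalRanders

/-! ### The fundamental tensor and the geodesic coefficients -/

lemma hasFDerivAt_div {E : Type*} [NormedAddCommGroup E] [NormedSpace ℝ E] {f g : E → ℝ}
    {f' g' : E →L[ℝ] ℝ} {x : E} (hf : HasFDerivAt f f' x) (hg : HasFDerivAt g g' x)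
    (h : g x ≠ 0) :
    HasFDerivAt (fun z => f z / g z) ((g x)⁻¹ • f' - (f x / g x ^ 2) • g') x := by
  have h1 := hf.mul ((hasDerivAt_inv h).comp_hasFDerivAt x hg)
  simp only [div_eq_mul_inv]
  refine h1.congr_fderiv ?_
  ext z
  simp
  field_simp
  ring

namespace LocalRanders

variable {E : Type*} [NormedAddCommGroup E] [NormedSpace ℝ E] [FiniteDimensional ℝ E]
  {D : LocalRanders E} {u y : E}

lemma eventually_ne_zero {y : E} (hy : y ≠ 0) : ∀ᶠ z in 𝓝 y, z ≠ 0 :=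
  isOpen_ne.mem_nhds hy

variable (D) in
/-- The fibre derivative `F_y` of the Randers metric. -/
def ell (u y : E) : E →L[ℝ] ℝ := (D.α u y)⁻¹ • D.A u y + D.b u

lemma ell_apply (u y v : E) : D.ell u y v = D.A u y v / D.α u y + D.b u v := by
  simp [ell]; ring

lemma ell_self (hu : u ∈ D.U) (hy : y ≠ 0) : D.ell u y y = D.F u y := by
  have := (α_pos hu hy).ne'
  rw [ell_apply, ← α_sq hu, F]; field_simp

lemma hasFDerivAt_ell (hu : u ∈ D.U) (hy : y ≠ 0) (v : E) :
    HasFDerivAt (fun z => D.ell u z v)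
      ((D.α u y)⁻¹ • (D.A u v - (D.A u y v / D.α u y ^ 2) • D.A u y)) y := by
  have hα := (α_pos hu hy).ne'
  have h1 : HasFDerivAt (fun z => D.A u z v) (D.A u v) y :=
    ((D.A u v).hasFDerivAt).congr_of_eventuallyEq
      (Eventually.of_forall fun z => D.symm u hu z v)
  have h2 := (hasFDerivAt_div h1 (hasFDerivAt_α_fibre hu hy) hα).add_const (D.b u v)
  refine HasFDerivAt.congr_of_eventuallyEq (h2.congr_fderiv ?_)
    (Eventually.of_forall fun z => ell_apply u z v)
  ext w
  simp only [smul_apply, sub_apply, smul_eq_mul]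
  field_simp

lemma hasFDerivAt_sq_fibre (hu : u ∈ D.U) (hy : y ≠ 0) :
    HasFDerivAt (fun z => D.F u z ^ 2) ((2 * D.F u y) • D.ell u y) y := by
  have := (hasFDerivAt_F_fibre hu hy).pow 2
  refine this.congr_fderiv ?_
  ext w; simp [ell]

lemma hasFDerivAt_sq_base (hu : u ∈ D.U) (hy : y ≠ 0) :
    HasFDerivAt (fun v => D.F v y ^ 2) ((2 * D.F u y) •
      ((2 * D.α u y)⁻¹ • ((fderiv ℝ D.A u).flip y).flip y + (fderiv ℝ D.b u).flip y)) u := by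
  have := (hasFDerivAt_F_base hu hy).pow 2
  refine this.congr_fderiv ?_
  ext w; simp

/-- The second fibre derivative of `½ F²`. -/
lemma hasFDerivAt_F_ell (hu : u ∈ D.U) (hy : y ≠ 0) (v : E) :
    HasFDerivAt (fun z => 2 * D.F u z * D.ell u z v)
      ((2 * D.F u y) • ((D.α u y)⁻¹ • (D.A u v - (D.A u y v / D.α u y ^ 2) • D.A u y))
        + (2 * D.ell u y v) • D.ell u y) y := by
  have := ((hasFDerivAt_F_fibre hu hy).const_mul 2).mul (hasFDerivAt_ell hu hy v)
  refine this.congr_fderiv ?_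
  ext w; simp [ell]; ring

/-- The fibre derivative of the derivative of `F²` in the direction `w` of the base. -/
lemma hasFDerivAt_mixed (hu : u ∈ D.U) (hy : y ≠ 0) (w : E) :
    HasFDerivAt (fun z => 2 * D.F u z *
        (fderiv ℝ D.A u w z z / (2 * D.α u z) + fderiv ℝ D.b u w z))
      ((2 * D.F u y) • ((D.α u y)⁻¹ • fderiv ℝ D.A u w y
          - (fderiv ℝ D.A u w y y / (2 * D.α u y ^ 3)) • D.A u y + fderiv ℝ D.b u w)
        + (2 * (fderiv ℝ D.A u w y y / (2 * D.α u y) + fderiv ℝ D.b u w y)) • D.ell u y) y := by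
  have hα := (α_pos hu hy).ne'
  have h1 : HasFDerivAt (fun z => fderiv ℝ D.A u w z z) ((2 : ℝ) • fderiv ℝ D.A u w y) y := by
    refine (((fderiv ℝ D.A u w).hasFDerivAt (x := y)).clm_apply
      (hasFDerivAt_id y)).congr_fderiv ?_
    ext z; simp [fderiv_A_symm hu w z y]; ring
  have h2 := hasFDerivAt_div h1 ((hasFDerivAt_α_fibre hu hy).const_mul 2)
    (mul_ne_zero two_ne_zero hα)
  have h3 := ((hasFDerivAt_F_fibre hu hy).const_mul 2).mul
    (h2.add (fderiv ℝ D.b u w).hasFDerivAt)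
  refine h3.congr_fderiv ?_
  ext z
  simp [ell]
  field_simp

variable (D) in
/-- The fundamental tensor as a bilinear expression. -/
def fund (u y v w : E) : ℝ :=
  D.F u y / D.α u y * (D.A u v w - D.A u y v * D.A u y w / D.α u y ^ 2)
    + D.ell u y v * D.ell u y w

/-- The Euler-Lagrange equation of `½ F²`: the vector `G` solves
`g(z, G) = ¼ ([F²]_{xᵐ yˡ} yᵐ - [F²]_{xˡ}) zˡ`. -/
lemma fund_G (hu : u ∈ D.U) (hy : y ≠ 0) (z : E) :
    D.fund u y z (D.G u y) = 1 / 4 * (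
      ((2 * D.F u y) * ((D.α u y)⁻¹ * fderiv ℝ D.A u y y z
          - (fderiv ℝ D.A u y y y / (2 * D.α u y ^ 3)) * D.A u y z + fderiv ℝ D.b u y z)
        + (2 * (fderiv ℝ D.A u y y y / (2 * D.α u y) + fderiv ℝ D.b u y y)) * D.ell u y z)
      - 2 * D.F u y * (fderiv ℝ D.A u z y y / (2 * D.α u y) + fderiv ℝ D.b u z y)) := by
  have hα := (α_pos hu hy).ne'
  have hF := (F_pos hu hy).ne'
  have e1 : ∀ z, D.A u z (D.Γ u y y) = fderiv ℝ D.A u y y z - 1 / 2 * fderiv ℝ D.A u z y y := by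
    intro z; rw [D.symm u hu, A_Γ hu]; ring
  have e2 : ∀ z, D.A u z (D.S u y) = 1 / 2 * (fderiv ℝ D.b u y z - fderiv ℝ D.b u z y) := by
    intro z; rw [D.symm u hu, A_S hu]
  have e3 : D.b u (D.Γ u y y) = fderiv ℝ D.b u y y - D.r u y y := by rw [r_apply]; ring
  have e4 : D.b u (D.S u y) = D.s u y := rfl
  have e5 : D.F u y = D.α u y + D.b u y := rfl
  simp only [fund, ell_apply, G, map_add, map_smul, smul_eq_mul, e1, e2, e3, e4, P, N,
    D.symm u hu z y, ← α_sq hu y]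
  rw [e5] at hF ⊢
  field_simp
  ring

end LocalRanders

section Coordinates

open LocalRanders

variable {n : ℕ} {D : LocalRanders (Coord n)} {u y : Coord n}

lemma eq_sum_single (y : Coord n) : y = ∑ i, y i • EuclideanSpace.single i (1 : ℝ) := by
  ext j; simp [Pi.single_apply]

lemma sum_clm_single (φ : Coord n →L[ℝ] ℝ) (y : Coord n) :
    ∑ i, φ (EuclideanSpace.single i 1) * y i = φ y := by
  conv_rhs => rw [eq_sum_single y]
  simp [map_sum, mul_comm]

lemma dy_sqFun (hu : u ∈ D.U) (hy : y ≠ 0) (i : Fin n) :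
    dy i (sqFun D.F) u y = 2 * D.F u y * D.ell u y (EuclideanSpace.single i 1) := by
  simp only [dy, sqFun]
  rw [(hasFDerivAt_sq_fibre hu hy).fderiv]; simp

lemma dx_sqFun (hu : u ∈ D.U) (hy : y ≠ 0) (i : Fin n) :
    dx i (sqFun D.F) u y = 2 * D.F u y *
      (fderiv ℝ D.A u (EuclideanSpace.single i 1) y y / (2 * D.α u y)
        + fderiv ℝ D.b u (EuclideanSpace.single i 1) y) := by
  simp only [dx, sqFun]
  rw [(hasFDerivAt_sq_base hu hy).fderiv]
  simp only [smul_apply, add_apply, smul_eq_mul, ContinuousLinearMap.flip_apply, div_eq_mul_inv]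
  ring

lemma fundTensor_apply (hu : u ∈ D.U) (hy : y ≠ 0) (i j : Fin n) :
    fundTensor D.F u y i j =
      D.fund u y (EuclideanSpace.single i 1) (EuclideanSpace.single j 1) := by
  have h : (fun z => dy i (sqFun D.F) u z) =ᶠ[𝓝 y]
      fun z => 2 * D.F u z * D.ell u z (EuclideanSpace.single i 1) := by
    filter_upwards [eventually_ne_zero hy] with z hz using dy_sqFun hu hz i
  have hα := (α_pos hu hy).ne'
  rw [fundTensor, Matrix.of_apply, dy, h.fderiv_eq, (hasFDerivAt_F_ell hu hy _).fderiv]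
  simp [fund]
  field_simp

lemma dy_dx_sqFun (hu : u ∈ D.U) (hy : y ≠ 0) (l m : Fin n) :
    dy l (dx m (sqFun D.F)) u y =
      ((2 * D.F u y) • ((D.α u y)⁻¹ • fderiv ℝ D.A u (EuclideanSpace.single m 1) y
          - (fderiv ℝ D.A u (EuclideanSpace.single m 1) y y / (2 * D.α u y ^ 3)) • D.A u y
          + fderiv ℝ D.b u (EuclideanSpace.single m 1))
        + (2 * (fderiv ℝ D.A u (EuclideanSpace.single m 1) y y / (2 * D.α u y)
          + fderiv ℝ D.b u (EuclideanSpace.single m 1) y)) • D.ell u y)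
        (EuclideanSpace.single l 1) := by
  have h : (fun z => dx m (sqFun D.F) u z) =ᶠ[𝓝 y] fun z => 2 * D.F u z *
      (fderiv ℝ D.A u (EuclideanSpace.single m 1) z z / (2 * D.α u z)
        + fderiv ℝ D.b u (EuclideanSpace.single m 1) z) := by
    filter_upwards [eventually_ne_zero hy] with z hz using dx_sqFun hu hz m
  rw [dy, h.fderiv_eq, (hasFDerivAt_mixed hu hy _).fderiv]

/-- The matrix of the Riemannian metric in the coordinates. -/
def aMat (D : LocalRanders (Coord n)) (u : Coord n) : Matrix (Fin n) (Fin n) ℝ :=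
  Matrix.of fun i j => D.A u (EuclideanSpace.single i 1) (EuclideanSpace.single j 1)

/-- `det g = (F / α)ⁿ⁺¹ det a`: the fundamental tensor is a perturbation of rank two of a multiple
of the Riemannian metric. -/
lemma det_fundTensor (hu : u ∈ D.U) (hy : y ≠ 0) :
    (fundTensor D.F u y).det = (D.F u y / D.α u y) ^ (n + 1) * (aMat D u).det := by
  have hα := (α_pos hu hy).ne'
  have hF := (F_pos hu hy).ne'
  set w : Coord n := D.X u + (D.α u y)⁻¹ • y with hw
  let B : Matrix (Fin n) (Fin 2) ℝ := Matrix.of fun i k => ![y i, w i] k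
  let C : Matrix (Fin 2) (Fin n) ℝ := Matrix.of fun k j =>
    ![- D.A u y (EuclideanSpace.single j 1) / D.α u y ^ 2,
      D.α u y / D.F u y * D.ell u y (EuclideanSpace.single j 1)] k
  have hAw : ∀ v, D.A u v w = D.ell u y v := by
    intro v
    rw [hw, D.symm u hu, ell_apply]
    simp [A_X hu]; ring
  have h1 : fundTensor D.F u y = (D.F u y / D.α u y) • (aMat D u * (1 + B * C)) := by
    ext i j
    rw [fundTensor_apply hu hy, Matrix.mul_add, Matrix.mul_one, ← Matrix.mul_assoc]
    have h2 : ∀ k, (aMat D u * B) i k = ![D.A u (EuclideanSpace.single i 1) y,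
        D.A u (EuclideanSpace.single i 1) w] k := by
      intro k
      simp only [Matrix.mul_apply, aMat, Matrix.of_apply, B]
      fin_cases k
      · exact sum_clm_single _ y
      · exact sum_clm_single _ w
    rw [Matrix.smul_apply, Matrix.add_apply, Matrix.mul_apply (M := aMat D u * B),
      Fin.sum_univ_two, h2, h2]
    simp only [C, Matrix.of_apply, Matrix.cons_val_zero, Matrix.cons_val_one, aMat, hAw,
      smul_eq_mul, fund, D.symm u hu _ y]
    field_simp
    ring
  have h3 : (1 + C * B).det = D.F u y / D.α u y := by
    have e00 : (C * B) 0 0 = -1 := by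
      simp only [Matrix.mul_apply, C, B, Matrix.of_apply, Matrix.cons_val_zero]
      simp only [neg_div, neg_mul, Finset.sum_neg_distrib, div_mul_eq_mul_div, ← Finset.sum_div]
      rw [sum_clm_single, ← α_sq hu]; field_simp
    have e01 : (C * B) 0 1 = - D.F u y / D.α u y ^ 2 := by
      simp only [Matrix.mul_apply, C, B, Matrix.of_apply, Matrix.cons_val_zero,
        Matrix.cons_val_one]
      simp only [neg_div, neg_mul, Finset.sum_neg_distrib, div_mul_eq_mul_div, ← Finset.sum_div]
      rw [sum_clm_single, hAw, ell_self hu hy]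
    have e10 : (C * B) 1 0 = D.α u y := by
      simp only [Matrix.mul_apply, C, B, Matrix.of_apply, Matrix.cons_val_zero,
        Matrix.cons_val_one, mul_assoc, ← Finset.mul_sum]
      rw [sum_clm_single, ell_self hu hy]; field_simp
    rw [Matrix.det_fin_two]
    simp only [Matrix.add_apply, e00, e01, e10]
    simp
    field_simp
  rw [h1, Matrix.det_smul, Matrix.det_mul, Matrix.det_one_add_mul_comm, h3, Fintype.card_fin]
  ring

lemma aMat_posDef (hu : u ∈ D.U) : (aMat D u).PosDef := by
  refine Matrix.PosDef.of_dotProduct_mulVec_pos ?_ ?_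
  · ext i j; simp [aMat, D.symm u hu (EuclideanSpace.single j 1)]
  · intro x hx
    set y : Coord n := WithLp.toLp 2 x with hy
    have h1 : ∀ i, ((aMat D u).mulVec x) i = D.A u (EuclideanSpace.single i 1) y := by
      intro i
      simp only [Matrix.mulVec, dotProduct, aMat, Matrix.of_apply]
      exact sum_clm_single _ y
    have h2 : (star x ⬝ᵥ (aMat D u).mulVec x) = D.A u y y := by
      simp only [dotProduct, h1]
      rw [← sum_clm_single (D.A u y) y]
      refine Finset.sum_congr rfl fun i _ => ?_
      rw [D.symm u hu, mul_comm]; simp [hy]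
    rw [h2]
    exact D.pos u hu y (by simpa [hy] using hx)

lemma det_fundTensor_ne_zero (hu : u ∈ D.U) (hy : y ≠ 0) : (fundTensor D.F u y).det ≠ 0 := by
  rw [det_fundTensor hu hy]
  exact mul_ne_zero (pow_ne_zero _ (div_ne_zero (F_pos hu hy).ne' (α_pos hu hy).ne'))
    (aMat_posDef hu).det_pos.ne'

/-- The geodesic coefficients of a Randers metric are the components of `G`: the fundamental tensor
is invertible, and `G` solves the equation defining them. -/
lemma geodCoeff_eq (hu : u ∈ D.U) (hy : y ≠ 0) (i : Fin n) :
    geodCoeff D.F i u y = D.G u y i := by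
  have h1 : ∀ l, (1 / 4 : ℝ) * ((∑ m, dy l (dx m (sqFun D.F)) u y * y m) - dx l (sqFun D.F) u y)
      = ((fundTensor D.F u y).mulVec (D.G u y)) l := by
    intro l
    have h2 : ((fundTensor D.F u y).mulVec (D.G u y)) l
        = D.fund u y (EuclideanSpace.single l 1) (D.G u y) := by
      simp only [Matrix.mulVec, dotProduct, fundTensor_apply hu hy]
      have h3 := sum_clm_single ((D.F u y / D.α u y) • (D.A u (EuclideanSpace.single l 1)
        - (D.A u y (EuclideanSpace.single l 1) / D.α u y ^ 2) • D.A u y)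
        + D.ell u y (EuclideanSpace.single l 1) • D.ell u y) (D.G u y)
      simp only [smul_apply, add_apply, sub_apply, smul_eq_mul] at h3
      rw [fund]
      convert h3 using 1
      · refine Finset.sum_congr rfl fun j _ => ?_
        rw [fund]; ring
      · ring
    rw [h2, fund_G hu hy, dx_sqFun hu hy]
    congr 2
    set z : Coord n := EuclideanSpace.single l 1
    have h4 := sum_clm_single ((2 * D.F u y) • ((D.α u y)⁻¹ • ((fderiv ℝ D.A u).flip y).flip z
          - (D.A u y z / (2 * D.α u y ^ 3)) • ((fderiv ℝ D.A u).flip y).flip y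
          + (fderiv ℝ D.b u).flip z)
        + (2 * D.ell u y z) • ((2 * D.α u y)⁻¹ • ((fderiv ℝ D.A u).flip y).flip y
          + (fderiv ℝ D.b u).flip y)) y
    simp only [smul_apply, add_apply, sub_apply, smul_eq_mul,
      ContinuousLinearMap.flip_apply] at h4
    convert h4 using 1
    · refine Finset.sum_congr rfl fun j _ => ?_
      rw [dy_dx_sqFun hu hy]
      simp only [smul_apply, add_apply, sub_apply, smul_eq_mul]
      ring
    · ring
  have hdet : IsUnit (fundTensor D.F u y).det := (det_fundTensor_ne_zero hu hy).isUnit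
  have h5 : geodCoeff D.F i u y
      = ((fundTensor D.F u y)⁻¹.mulVec ((fundTensor D.F u y).mulVec (D.G u y))) i := by
    rw [geodCoeff, Finset.mul_sum, Matrix.mulVec, dotProduct]
    refine Finset.sum_congr rfl fun l _ => ?_
    rw [← h1 l]; ring
  rw [h5, Matrix.mulVec_mulVec, Matrix.nonsing_inv_mul _ hdet, Matrix.one_mulVec]

end Coordinates

/-! ### The Ricci curvature at a point where the metric is constant to first order -/

section Trace

variable {E : Type*} [NormedAddCommGroup E] [NormedSpace ℝ E] [FiniteDimensional ℝ E]

variable (E) in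
/-- The trace of endomorphisms of a finite-dimensional space, as a continuous linear form. -/
def tr : (E →L[ℝ] E) →L[ℝ] ℝ :=
  LinearMap.toContinuousLinearMap (LinearMap.trace ℝ E ∘ₗ ContinuousLinearMap.coeLM ℝ)

lemma tr_apply (L : E →L[ℝ] E) : tr E L = LinearMap.trace ℝ E L := rfl

lemma tr_id : tr E (ContinuousLinearMap.id ℝ E) = Module.finrank ℝ E := by
  simp [tr_apply]

lemma tr_smulRight (φ : E →L[ℝ] ℝ) (v : E) : tr E (φ.smulRight v) = φ v := by
  rw [tr_apply]
  exact LinearMap.trace_smulRight (φ : E →ₗ[ℝ] ℝ) v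

lemma smulRight_comp' (φ : E →L[ℝ] ℝ) (v : E) (L : E →L[ℝ] E) :
    φ.smulRight v ∘L L = (φ ∘L L).smulRight v := by
  ext z; simp

lemma tr_eq_sum {n : ℕ} (L : Coord n →L[ℝ] Coord n) :
    tr (Coord n) L = ∑ i, L (EuclideanSpace.single i 1) i := by
  rw [tr_apply, LinearMap.trace_eq_matrix_trace ℝ (EuclideanSpace.basisFun (Fin n) ℝ).toBasis]
  simp [Matrix.trace, LinearMap.toMatrix_apply]

end Trace

namespace LocalRanders

section Abstract

variable {E : Type*} [NormedAddCommGroup E] [NormedSpace ℝ E] [FiniteDimensional ℝ E]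
  {D : LocalRanders E} {u y : E}

/-- An operator that is skew for a scalar product has trace zero. -/
lemma tr_S (hu : u ∈ D.U) : tr E (D.S u) = 0 := by
  let e : E ≃ₗ[ℝ] Module.Dual ℝ E :=
    (AEquiv hu).toLinearEquiv.trans (LinearMap.toContinuousLinearMap (𝕜 := ℝ)).symm
  have he : ∀ y z, e y z = D.A u y z := fun y z => rfl
  have h1 : e.conj (D.S u : E →ₗ[ℝ] E) = - Module.Dual.transpose (D.S u : E →ₗ[ℝ] E) := by
    ext φ z
    obtain ⟨y, rfl⟩ := e.surjective φ
    rw [LinearEquiv.conj_apply]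
    simp only [LinearMap.comp_apply, LinearEquiv.coe_coe, LinearEquiv.symm_apply_apply,
      LinearMap.neg_apply, Module.Dual.transpose_apply, he, ContinuousLinearMap.coe_coe]
    rw [A_skew hu, D.symm u hu]
  have h2 := LinearMap.trace_conj' (D.S u : E →ₗ[ℝ] E) e
  have h3 := LinearMap.trace_transpose' (R := ℝ) (M := E) (D.S u : E →ₗ[ℝ] E)
  rw [h1, map_neg, h3] at h2
  rw [tr_apply]; linarith

variable (D) in
/-- The fibre derivative of `r_00 - 2 α s_0`. -/
def Nfib (u y : E) : E →L[ℝ] ℝ :=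
  (2 : ℝ) • D.r u y - (2 : ℝ) • ((D.s u y * (D.α u y)⁻¹) • D.A u y + D.α u y • D.s u)

variable (D) in
/-- The fibre derivative of the projective factor. -/
def Pfib (u y : E) : E →L[ℝ] ℝ :=
  (2 * D.F u y)⁻¹ • D.Nfib u y - (D.N u y / (2 * D.F u y) ^ 2) • ((2 : ℝ) • D.ell u y)

lemma hasFDerivAt_N_fibre (hu : u ∈ D.U) (hy : y ≠ 0) :
    HasFDerivAt (D.N u) (D.Nfib u y) y := by
  have h1 : HasFDerivAt (fun z => D.r u z z) ((2 : ℝ) • D.r u y) y := by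
    refine (((D.r u).hasFDerivAt (x := y)).clm_apply (hasFDerivAt_id y)).congr_fderiv ?_
    ext z; simp [r_symm hu z y]; ring
  have h2 := h1.sub (((hasFDerivAt_α_fibre hu hy).const_mul 2).mul (D.s u).hasFDerivAt)
  refine h2.congr_fderiv ?_
  ext z; simp [Nfib]; ring

lemma hasFDerivAt_P_fibre (hu : u ∈ D.U) (hy : y ≠ 0) :
    HasFDerivAt (D.P u) (D.Pfib u y) y :=
  hasFDerivAt_div (hasFDerivAt_N_fibre hu hy) ((hasFDerivAt_F_fibre hu hy).const_mul 2)
    (mul_ne_zero two_ne_zero (F_pos hu hy).ne')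

lemma Nfib_self (hu : u ∈ D.U) (hy : y ≠ 0) : D.Nfib u y y = 2 * D.N u y := by
  have := (α_pos hu hy).ne'
  simp [Nfib, N, ← α_sq hu]
  field_simp
  ring

lemma Pfib_self (hu : u ∈ D.U) (hy : y ≠ 0) : D.Pfib u y y = D.P u y := by
  have hF := (F_pos hu hy).ne'
  simp only [Pfib, sub_apply, smul_apply, Nfib_self hu hy, ell_self hu hy, smul_eq_mul, P]
  field_simp
  ring

variable (D) in
/-- The fibre derivative of the geodesic coefficients. -/
def Gfib (u y : E) : E →L[ℝ] E :=
  D.Γ u y + (D.Pfib u y).smulRight y + D.P u y • ContinuousLinearMap.id ℝ E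
    + ((D.α u y)⁻¹ • D.A u y).smulRight (D.S u y) + D.α u y • D.S u

lemma hasFDerivAt_G_fibre (hu : u ∈ D.U) (hy : y ≠ 0) :
    HasFDerivAt (D.G u) (D.Gfib u y) y := by
  have h1 : HasFDerivAt (fun z => D.Γ u z z) ((2 : ℝ) • D.Γ u y) y := by
    refine (((D.Γ u).hasFDerivAt (x := y)).clm_apply (hasFDerivAt_id y)).congr_fderiv ?_
    ext z; simp [Γ_symm hu z y, two_smul]
  have h2 := ((h1.const_smul (1 / 2 : ℝ)).add
    ((hasFDerivAt_P_fibre hu hy).smul (hasFDerivAt_id y))).add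
    ((hasFDerivAt_α_fibre hu hy).smul (D.S u).hasFDerivAt)
  refine h2.congr_fderiv ?_
  ext z
  simp [Gfib]
  module

lemma tr_Gfib (hu : u ∈ D.U) (hy : y ≠ 0) :
    tr E (D.Gfib u y) = tr E (D.Γ u y) + (Module.finrank ℝ E + 1) * D.P u y := by
  simp only [Gfib, map_add, map_smul, tr_smulRight, tr_id, tr_S hu, Pfib_self hu hy, smul_apply,
    D.symm u hu y, A_S_self hu, smul_eq_mul]
  ring

lemma contDiffAt_Gfib_base (hu : u ∈ D.U) (hy : y ≠ 0) :
    ContDiffAt ℝ ∞ (fun v => D.Gfib v y) u := by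
  have h : ContDiffAt ℝ ∞ (fun v => fderiv ℝ (D.G v) y) u :=
    ContDiffAt.fderiv (m := ∞) (n := ∞) (contDiffAt_G hu hy) contDiffAt_const (by simp)
  refine h.congr_of_eventuallyEq ?_
  filter_upwards [D.isOpen.mem_nhds hu] with v hv using (hasFDerivAt_G_fibre hv hy).fderiv.symm

lemma contDiffAt_Gfib_fibre (hu : u ∈ D.U) (hy : y ≠ 0) :
    ContDiffAt ℝ ∞ (fun z => D.Gfib u z) y := by
  have h0 : ContDiffAt ℝ ∞ (D.G u) y :=
    (contDiffAt_G hu hy).comp y (contDiffAt_const.prodMk contDiffAt_id)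
  refine (h0.fderiv_right (m := ∞) (by simp)).congr_of_eventuallyEq ?_
  filter_upwards [eventually_ne_zero hy] with z hz using (hasFDerivAt_G_fibre hu hz).fderiv.symm

lemma differentiableAt_G_base (hu : u ∈ D.U) (hy : y ≠ 0) :
    DifferentiableAt ℝ (fun v => D.G v y) u :=
  ((contDiffAt_G hu hy).comp u (contDiffAt_id.prodMk contDiffAt_const)).differentiableAt (by simp)

variable (D) in
/-- The Ricci curvature of the Riemannian metric in terms of the derivative of the Christoffel
symbols, at a point where these vanish. -/
def ricA (u y : E) : ℝ :=
  tr E (((fderiv ℝ D.Γ u).flip y).flip y) - tr E (fderiv ℝ D.Γ u y y)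

variable (D) in
/-- The divergence `sⁱ_{0|i}`, at a point where the Christoffel symbols vanish. -/
def divS (u y : E) : ℝ := tr E ((fderiv ℝ D.S u).flip y)

variable (D) in
/-- The derivative of `r_00 - 2 α s_0` along the spray of `½ Γ_00 + α s_0`, at a point where the
Christoffel symbols vanish. -/
def Ndot (u y : E) : ℝ :=
  fderiv ℝ D.r u y y y - 4 * D.α u y * D.r u y (D.S u y)
    - 2 * D.α u y * (fderiv ℝ D.s u y y - 2 * D.α u y * D.s u (D.S u y))

lemma Γ_eq_zero (hu : u ∈ D.U) (hN : fderiv ℝ D.A u = 0) : D.Γ u = 0 := by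
  ext1 y; ext1 z
  refine A_injective hu fun x => ?_
  rw [A_Γ hu]; simp [hN]

lemma hasFDerivAt_α_normal (hu : u ∈ D.U) (hN : fderiv ℝ D.A u = 0) (hy : y ≠ 0) :
    HasFDerivAt (fun v => D.α v y) (0 : E →L[ℝ] ℝ) u :=
  (hasFDerivAt_α_base hu hy).congr_fderiv (by ext; simp [hN])

lemma hasFDerivAt_r_base (hu : u ∈ D.U) (y z : E) :
    HasFDerivAt (fun v => D.r v y z) (((fderiv ℝ D.r u).flip y).flip z) u := by
  have hd := (contDiffAt_r hu).differentiableAt (by simp)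
  have h1 := ((hd.hasFDerivAt.clm_apply (hasFDerivAt_const y u)).clm_apply
      (hasFDerivAt_const z u))
  exact h1.congr_fderiv (by ext w; simp)

lemma hasFDerivAt_s_base (hu : u ∈ D.U) (y : E) :
    HasFDerivAt (fun v => D.s v y) ((fderiv ℝ D.s u).flip y) u := by
  have hd := (contDiffAt_s hu).differentiableAt (by simp)
  have h1 := (hd.hasFDerivAt.clm_apply (hasFDerivAt_const y u))
  exact h1.congr_fderiv (by ext w; simp)

lemma hasFDerivAt_S_base (hu : u ∈ D.U) (y : E) :
    HasFDerivAt (fun v => D.S v y) ((fderiv ℝ D.S u).flip y) u := by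
  have hd := (contDiffAt_S hu).differentiableAt (by simp)
  have h1 := (hd.hasFDerivAt.clm_apply (hasFDerivAt_const y u))
  exact h1.congr_fderiv (by ext w; simp)

lemma hasFDerivAt_Γ_base (hu : u ∈ D.U) (y z : E) :
    HasFDerivAt (fun v => D.Γ v y z) (((fderiv ℝ D.Γ u).flip y).flip z) u := by
  have hd := (contDiffAt_Γ hu).differentiableAt (by simp)
  have h1 := ((hd.hasFDerivAt.clm_apply (hasFDerivAt_const y u)).clm_apply
      (hasFDerivAt_const z u))
  exact h1.congr_fderiv (by ext w; simp)

lemma hasFDerivAt_N_normal (hu : u ∈ D.U) (hN : fderiv ℝ D.A u = 0) (hy : y ≠ 0) :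
    HasFDerivAt (fun v => D.N v y) (((fderiv ℝ D.r u).flip y).flip y
      - (2 * D.α u y) • (fderiv ℝ D.s u).flip y) u := by
  have h := (hasFDerivAt_r_base hu y y).sub
    (((hasFDerivAt_α_normal hu hN hy).const_mul 2).mul (hasFDerivAt_s_base hu y))
  exact h.congr_fderiv (by ext w; simp)

lemma hasFDerivAt_P_normal (hu : u ∈ D.U) (hN : fderiv ℝ D.A u = 0) (hy : y ≠ 0) :
    HasFDerivAt (fun v => D.P v y) ((2 * D.F u y)⁻¹ • (((fderiv ℝ D.r u).flip y).flip y
      - (2 * D.α u y) • (fderiv ℝ D.s u).flip y)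
      - (D.N u y / (2 * D.F u y) ^ 2) • ((2 : ℝ) • (fderiv ℝ D.b u).flip y)) u := by
  have hF : HasFDerivAt (fun v => D.F v y) ((fderiv ℝ D.b u).flip y) u :=
    ((hasFDerivAt_α_normal hu hN hy).add (hasFDerivAt_b_base hu y)).congr_fderiv (by simp)
  exact hasFDerivAt_div (hasFDerivAt_N_normal hu hN hy) (hF.const_mul 2)
    (mul_ne_zero two_ne_zero (F_pos hu hy).ne')

lemma hasFDerivAt_G_normal (hu : u ∈ D.U) (hN : fderiv ℝ D.A u = 0) (hy : y ≠ 0) :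
    HasFDerivAt (fun v => D.G v y) ((1 / 2 : ℝ) • ((fderiv ℝ D.Γ u).flip y).flip y
      + (fderiv ℝ (fun v => D.P v y) u).smulRight y + D.α u y • (fderiv ℝ D.S u).flip y) u := by
  have hP := (hasFDerivAt_P_normal hu hN hy)
  rw [hP.fderiv]
  have h := (((hasFDerivAt_Γ_base hu y y).const_smul (1 / 2 : ℝ)).add
    (hP.smul (hasFDerivAt_const y u))).add
    ((hasFDerivAt_α_normal hu hN hy).smul (hasFDerivAt_S_base hu y))
  refine h.congr_fderiv ?_
  ext1 w; simp

/-- The derivative of the projective factor along the spray of `½ Γ_00 + α s_0`. -/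
lemma fderiv_P_spray (hu : u ∈ D.U) (hN : fderiv ℝ D.A u = 0) (hy : y ≠ 0) :
    fderiv ℝ (fun v => D.P v y) u y - 2 * D.α u y * D.Pfib u y (D.S u y)
      = D.Ndot u y / (2 * D.F u y) - D.N u y ^ 2 / (2 * D.F u y ^ 2) := by
  have hF := (F_pos hu hy).ne'
  have hα := (α_pos hu hy).ne'
  have h1 : D.r u y y = fderiv ℝ D.b u y y := by
    rw [r_apply, Γ_eq_zero hu hN]; simp; ring
  have h2 : D.ell u y (D.S u y) = D.s u y := by
    rw [ell_apply, D.symm u hu, A_S_self hu, s_apply]; simp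
  have h3 : D.Nfib u y (D.S u y) = 2 * D.r u y (D.S u y) - 2 * D.α u y * D.s u (D.S u y) := by
    simp [Nfib, D.symm u hu y, A_S_self hu]; ring
  have h4 : fderiv ℝ D.b u y y = D.N u y + 2 * D.α u y * D.s u y := by rw [← h1, N]; ring
  rw [(hasFDerivAt_P_normal hu hN hy).fderiv]
  simp only [Pfib, sub_apply, smul_apply, smul_eq_mul, ContinuousLinearMap.flip_apply, h2, h3, h4,
    Ndot]
  field_simp
  ring

lemma tr_Gfib_comp_self (hu : u ∈ D.U) (hN : fderiv ℝ D.A u = 0) (hy : y ≠ 0) :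
    tr E (D.Gfib u y ∘L D.Gfib u y) = (Module.finrank ℝ E + 3) * D.P u y ^ 2
      + 4 * D.α u y * D.Pfib u y (D.S u y) + D.α u y ^ 2 * tr E (D.S u ∘L D.S u)
      + 2 * D.A u y (D.S u (D.S u y)) := by
  have hα := (α_pos hu hy).ne'
  have h0 : D.A u y (D.S u y) = 0 := by rw [D.symm u hu, A_S_self hu]
  have h1 : (ContinuousLinearMap.id ℝ E : E →L[ℝ] E) ∘L ContinuousLinearMap.id ℝ E
    = ContinuousLinearMap.id ℝ E := rfl
  have h2 : ∀ (φ : E →L[ℝ] ℝ) (v : E) (L : E →L[ℝ] E), L ∘L φ.smulRight v = φ.smulRight (L v) := by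
    intro φ v L; ext; simp
  simp only [Gfib, Γ_eq_zero hu hN, zero_apply, zero_add, ContinuousLinearMap.add_comp,
    ContinuousLinearMap.comp_add, h2, smulRight_comp', ContinuousLinearMap.smul_comp,
    ContinuousLinearMap.comp_smul, ContinuousLinearMap.id_comp, ContinuousLinearMap.comp_id,
    map_add, map_smul, tr_smulRight, tr_id, tr_S hu, ContinuousLinearMap.smulRight_apply,
    smul_apply, add_apply, ContinuousLinearMap.comp_apply, Pfib_self hu hy, h0, smul_eq_mul,
    ContinuousLinearMap.id_apply, ← α_sq hu y]
  field_simp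
  ring

end Abstract

variable {n : ℕ} {D : LocalRanders (Coord n)} {u y : Coord n}

lemma proj_fderiv {F : Type*} [NormedAddCommGroup F] [NormedSpace ℝ F] {f : F → Coord n} {x : F}
    (hf : DifferentiableAt ℝ f x) (i : Fin n) (w : F) :
    fderiv ℝ (fun z => f z i) x w = fderiv ℝ f x w i := by
  have := (EuclideanSpace.proj (𝕜 := ℝ) i).hasFDerivAt.comp x hf.hasFDerivAt
  have h2 : HasFDerivAt (fun z => f z i) _ x := this
  rw [h2.fderiv]; rfl

/-- The Ricci curvature in terms of the geodesic coefficients as a vector-valued function. -/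
lemma ricci_eq_trace (hu : u ∈ D.U) (hy : y ≠ 0) :
    ricci D.F u y = 2 * tr _ (fderiv ℝ (fun v => D.G v y) u)
      - fderiv ℝ (fun v => tr _ (D.Gfib v y)) u y
      + 2 * fderiv ℝ (fun z => tr _ (D.Gfib u z)) y (D.G u y)
      - tr _ (D.Gfib u y ∘L D.Gfib u y) := by
  have hdx : ∀ i k, dx k (geodCoeff D.F i) u y
      = fderiv ℝ (fun v => D.G v y) u (EuclideanSpace.single k 1) i := by
    intro i k
    have h : (fun v => geodCoeff D.F i v y) =ᶠ[𝓝 u] fun v => D.G v y i := by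
      filter_upwards [D.isOpen.mem_nhds hu] with v hv using geodCoeff_eq hv hy i
    rw [dx, h.fderiv_eq, proj_fderiv (differentiableAt_G_base hu hy)]
  have hdy : ∀ v ∈ D.U, ∀ z, z ≠ 0 → ∀ i k, dy k (geodCoeff D.F i) v z
      = D.Gfib v z (EuclideanSpace.single k 1) i := by
    intro v hv z hz i k
    have h : (fun z => geodCoeff D.F i v z) =ᶠ[𝓝 z] fun z => D.G v z i := by
      filter_upwards [eventually_ne_zero hz] with z hz using geodCoeff_eq hv hz i
    rw [dy, h.fderiv_eq, proj_fderiv (hasFDerivAt_G_fibre hv hz).differentiableAt,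
      (hasFDerivAt_G_fibre hv hz).fderiv]
  have hdb := (contDiffAt_Gfib_base hu hy).differentiableAt (by simp)
  have hdf := (contDiffAt_Gfib_fibre hu hy).differentiableAt (by simp)
  have hdxdy : ∀ i j, dx j (dy i (geodCoeff D.F i)) u y
      = fderiv ℝ (fun v => D.Gfib v y) u (EuclideanSpace.single j 1)
        (EuclideanSpace.single i 1) i := by
    intro i j
    have h : (fun v => dy i (geodCoeff D.F i) v y) =ᶠ[𝓝 u]
        fun v => D.Gfib v y (EuclideanSpace.single i 1) i := by
      filter_upwards [D.isOpen.mem_nhds hu] with v hv using hdy v hv y hy i i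
    have h2 : HasFDerivAt (fun v => D.Gfib v y (EuclideanSpace.single i 1)) _ u :=
      hdb.hasFDerivAt.clm_apply (hasFDerivAt_const _ u)
    rw [dx, h.fderiv_eq, proj_fderiv h2.differentiableAt, h2.fderiv]
    simp
  have hdydy : ∀ i j, dy j (dy i (geodCoeff D.F i)) u y
      = fderiv ℝ (fun z => D.Gfib u z) y (EuclideanSpace.single j 1)
        (EuclideanSpace.single i 1) i := by
    intro i j
    have h : (fun z => dy i (geodCoeff D.F i) u z) =ᶠ[𝓝 y]
        fun z => D.Gfib u z (EuclideanSpace.single i 1) i := by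
      filter_upwards [eventually_ne_zero hy] with z hz using hdy u hu z hz i i
    have h2 : HasFDerivAt (fun z => D.Gfib u z (EuclideanSpace.single i 1)) _ y :=
      hdf.hasFDerivAt.clm_apply (hasFDerivAt_const _ y)
    rw [dy, h.fderiv_eq, proj_fderiv h2.differentiableAt, h2.fderiv]
    simp
  have e1 : fderiv ℝ (fun v => tr _ (D.Gfib v y)) u = tr _ ∘L fderiv ℝ (fun v => D.Gfib v y) u :=
    ((tr (Coord n)).hasFDerivAt.comp u hdb.hasFDerivAt).fderiv
  have e2 : fderiv ℝ (fun z => tr _ (D.Gfib u z)) y = tr _ ∘L fderiv ℝ (fun z => D.Gfib u z) y :=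
    ((tr (Coord n)).hasFDerivAt.comp y hdf.hasFDerivAt).fderiv
  have e3 : ∀ (L : Coord n →L[ℝ] Coord n →L[ℝ] Coord n) (z : Coord n), tr _ (L z)
      = ∑ i, ∑ j, z j * L (EuclideanSpace.single j 1) (EuclideanSpace.single i 1) i := by
    intro L z
    rw [tr_eq_sum]
    refine Finset.sum_congr rfl fun i _ => ?_
    conv_lhs => rw [eq_sum_single z]
    simp [map_sum]
  have e4 : ∀ L : Coord n →L[ℝ] Coord n, tr _ (L ∘L L)
      = ∑ i, ∑ j, L (EuclideanSpace.single j 1) i * L (EuclideanSpace.single i 1) j := by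
    intro L
    rw [tr_eq_sum]
    refine Finset.sum_congr rfl fun i _ => ?_
    rw [ContinuousLinearMap.comp_apply]
    conv_lhs => rw [eq_sum_single (L (EuclideanSpace.single i 1))]
    simp [map_sum, mul_comm]
  rw [e1, e2, ContinuousLinearMap.comp_apply, ContinuousLinearMap.comp_apply, e3, e3, e4,
    tr_eq_sum]
  simp only [ricci, riemannCurv, hdx, hdxdy, hdydy, hdy u hu y hy, geodCoeff_eq hu hy]
  simp only [Finset.sum_add_distrib, Finset.sum_sub_distrib, Finset.mul_sum]

/-- The Ricci curvature of a Randers metric at a point where the Christoffel symbols vanish. -/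
theorem ricci_normal (hu : u ∈ D.U) (hN : fderiv ℝ D.A u = 0) (hy : y ≠ 0) :
    ricci D.F u y = D.ricA u y + 2 * D.α u y * D.divS u y - 2 * D.A u y (D.S u (D.S u y))
      - D.α u y ^ 2 * tr _ (D.S u ∘L D.S u)
      + (n - 1) * (3 * D.N u y ^ 2 / (4 * D.F u y ^ 2) - D.Ndot u y / (2 * D.F u y)) := by
  have hF := (F_pos hu hy).ne'
  have hb : fderiv ℝ (fun v => tr _ (D.Gfib v y)) u y
      = tr _ (fderiv ℝ D.Γ u y y) + (n + 1) * fderiv ℝ (fun v => D.P v y) u y := by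
    have h : (fun v => tr _ (D.Gfib v y)) =ᶠ[𝓝 u]
        fun v => tr _ (D.Γ v y) + (n + 1) * D.P v y := by
      filter_upwards [D.isOpen.mem_nhds hu] with v hv
      rw [tr_Gfib hv hy, finrank_euclideanSpace_fin]
    have hd := (contDiffAt_Γ hu).differentiableAt (by simp)
    have h1 : HasFDerivAt (fun v => D.Γ v y) _ u :=
      hd.hasFDerivAt.clm_apply (hasFDerivAt_const y u)
    have h2 := ((tr (Coord n)).hasFDerivAt.comp u h1).add
      ((hasFDerivAt_P_normal hu hN hy).const_mul ((n : ℝ) + 1))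
    rw [h.fderiv_eq]
    have h3 : HasFDerivAt (fun v => tr (Coord n) (D.Γ v y) + ((n : ℝ) + 1) * D.P v y) _ u := h2
    rw [h3.fderiv, (hasFDerivAt_P_normal hu hN hy).fderiv]
    simp
  have hf : fderiv ℝ (fun z => tr _ (D.Gfib u z)) y (D.G u y)
      = (n + 1) * (D.P u y ^ 2 + D.α u y * D.Pfib u y (D.S u y)) := by
    have h : (fun z => tr _ (D.Gfib u z)) =ᶠ[𝓝 y] fun z => (n + 1) * D.P u z := by
      filter_upwards [eventually_ne_zero hy] with z hz
      rw [tr_Gfib hu hz, finrank_euclideanSpace_fin, Γ_eq_zero hu hN]; simp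
    rw [h.fderiv_eq, ((hasFDerivAt_P_fibre hu hy).const_mul ((n : ℝ) + 1)).fderiv]
    simp [G, Γ_eq_zero hu hN, Pfib_self hu hy]; ring_nf; simp
  have hs := fderiv_P_spray hu hN hy
  rw [ricci_eq_trace hu hy, hb, hf, tr_Gfib_comp_self hu hN hy, finrank_euclideanSpace_fin,
    (hasFDerivAt_G_normal hu hN hy).fderiv]
  simp only [map_add, map_smul, tr_smulRight, smul_eq_mul]
  have hP : D.P u y = D.N u y / (2 * D.F u y) := rfl
  have hP2 : D.P u y ^ 2 = D.N u y ^ 2 / (4 * D.F u y ^ 2) := by rw [hP]; ring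
  have hs' : fderiv ℝ (fun v => D.P v y) u y = 2 * D.α u y * D.Pfib u y (D.S u y)
      + (D.Ndot u y / (2 * D.F u y) - D.N u y ^ 2 / (2 * D.F u y ^ 2)) := by linarith
  rw [hs', hP2, ricA, divS]
  ring

end LocalRanders

/-! ### The Busemann-Hausdorff distortion and the S-curvature -/

namespace LocalRanders

section Abstract

variable {E : Type*} [NormedAddCommGroup E] [NormedSpace ℝ E] [FiniteDimensional ℝ E]
  {D : LocalRanders E} {u y : E}

variable (D) in
/-- The square `‖β‖²_α` of the norm of the one-form. -/
def bsq (u : E) : ℝ := D.b u (D.X u)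

lemma bsq_eq (hu : u ∈ D.U) : D.bsq u = D.A u (D.X u) (D.X u) := (A_X hu _).symm

lemma bsq_lt_one (hu : u ∈ D.U) : D.bsq u < 1 := by
  by_cases h : D.X u = 0
  · simp [bsq, h]
  · have h1 := D.sq_lt u hu _ h
    have h2 := D.pos u hu _ h
    rw [A_X hu] at h1 h2
    rw [bsq]; nlinarith

lemma contDiffAt_bsq (hu : u ∈ D.U) : ContDiffAt ℝ ∞ D.bsq u :=
  (contDiffAt_b hu).clm_apply (contDiffAt_X hu)

/-- The indicatrix `F < 1` is an ellipsoid of `(1 - ‖β‖²) (α² - β²)`, translated. -/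
lemma F_lt_one_iff (hu : u ∈ D.U) (y : E) : D.F u y < 1 ↔
    (1 - D.bsq u) * (D.A u (y + (1 - D.bsq u)⁻¹ • D.X u) (y + (1 - D.bsq u)⁻¹ • D.X u)
      - D.b u (y + (1 - D.bsq u)⁻¹ • D.X u) ^ 2) < 1 := by
  have hb : 0 < 1 - D.bsq u := sub_pos.2 (bsq_lt_one hu)
  have h1 : (1 - D.bsq u) * (D.A u (y + (1 - D.bsq u)⁻¹ • D.X u) (y + (1 - D.bsq u)⁻¹ • D.X u)
      - D.b u (y + (1 - D.bsq u)⁻¹ • D.X u) ^ 2) - 1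
      = (1 - D.bsq u) * (D.α u y ^ 2 - (1 - D.b u y) ^ 2) := by
    have e1 : D.b u (D.X u) = D.bsq u := rfl
    simp only [map_add, map_smul, add_apply, smul_apply, smul_eq_mul, A_X hu, D.symm u hu y, e1,
      α_sq hu]
    field_simp
    ring
  have h2 : D.α u y ^ 2 - (1 - D.b u y) ^ 2 < 0 ↔ D.F u y < 1 := by
    have hα : 0 ≤ D.α u y := Real.sqrt_nonneg _
    have hab : |D.b u y| ≤ D.α u y := by
      by_cases hy : y = 0
      · simp [hy, α]
      · exact (abs_b_lt hu hy).le
    have := abs_le.1 hab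
    rw [F]
    constructor
    · intro h; by_contra h'; nlinarith
    · intro h; nlinarith
  rw [← h2, ← sub_neg (b := (1 : ℝ)), h1]
  exact ⟨fun h => mul_neg_of_pos_of_neg hb h, fun h => by by_contra h'; nlinarith⟩

/-- The derivative of `α` along the spray `yⁱ ∂/∂xⁱ - 2 Gⁱ ∂/∂yⁱ` is `-2 P α`. -/
lemma spray_α (hu : u ∈ D.U) (hy : y ≠ 0) :
    fderiv ℝ D.A u y y y / (2 * D.α u y) - 2 * (D.A u y (D.G u y) / D.α u y)
      = - 2 * D.P u y * D.α u y := by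
  have hα := (α_pos hu hy).ne'
  have e1 : D.A u y (D.Γ u y y) = 1 / 2 * fderiv ℝ D.A u y y y := by
    rw [D.symm u hu, A_Γ hu]; ring
  have e2 : D.A u y (D.S u y) = 0 := by rw [D.symm u hu, A_S_self hu]
  simp only [G, map_add, map_smul, smul_eq_mul, e1, e2, ← α_sq hu y]
  field_simp
  ring

/-- The metric `F` is constant along its own spray. -/
lemma spray_F (hu : u ∈ D.U) (hy : y ≠ 0) :
    fderiv ℝ D.A u y y y / (2 * D.α u y) + fderiv ℝ D.b u y y - 2 * D.ell u y (D.G u y) = 0 := by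
  have hF := (F_pos hu hy).ne'
  have h1 := spray_α hu hy
  have e3 : D.b u (D.Γ u y y) = fderiv ℝ D.b u y y - D.r u y y := by rw [r_apply]; ring
  have e4 : D.b u (D.S u y) = D.s u y := rfl
  have e5 : D.b u (D.G u y) = 1 / 2 * (fderiv ℝ D.b u y y - D.r u y y) + D.P u y * D.b u y
      + D.α u y * D.s u y := by
    simp [G, e3, e4]
  have e6 : 2 * D.P u y * D.F u y = D.N u y := by rw [P]; field_simp
  rw [ell_apply, e5]
  have e7 : D.N u y = D.r u y y - 2 * D.α u y * D.s u y := rfl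
  have e8 : D.F u y = D.α u y + D.b u y := rfl
  rw [e7, e8] at e6
  linarith

end Abstract

variable {n : ℕ} {D : LocalRanders (Coord n)} {u y : Coord n}

open scoped MatrixOrder Matrix.Norms.L2Operator in
lemma exists_conjTranspose_mul_self {M : Matrix (Fin n) (Fin n) ℝ} (hM : M.PosSemidef) :
    ∃ B : Matrix (Fin n) (Fin n) ℝ, M = B.conjTranspose * B :=
  CStarAlgebra.nonneg_iff_eq_star_mul_self.mp hM.nonneg

/-- The volume of the ellipsoid `{y | yᵀ M y < 1}` translated by `y₀`. -/
lemma volume_ellipsoid {M : Matrix (Fin n) (Fin n) ℝ} (hM : M.PosDef) (y₀ : Coord n)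
    {s : Set (Coord n)}
    (hs : ∀ y, y ∈ s ↔ (∑ i, ∑ j, M i j * (y + y₀) i * (y + y₀) j) < 1) :
    (MeasureTheory.volume s).toReal = (Real.sqrt M.det)⁻¹
      * (MeasureTheory.volume (Metric.ball (0 : Coord n) 1)).toReal := by
  obtain ⟨B, hB⟩ := exists_conjTranspose_mul_self hM.posSemidef
  have hdet : M.det = B.det ^ 2 := by
    rw [hB, Matrix.det_mul, Matrix.det_conjTranspose]; simp [sq]
  have hBne : B.det ≠ 0 := by
    intro h; have := hM.det_pos; rw [hdet, h] at this; simp at this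
  let L : Coord n →ₗ[ℝ] Coord n := Matrix.toLin (EuclideanSpace.basisFun (Fin n) ℝ).toBasis
    (EuclideanSpace.basisFun (Fin n) ℝ).toBasis B
  have hL : LinearMap.det L = B.det := LinearMap.det_toLin _ _
  have hLv : ∀ z i, L z i = ∑ j, B i j * z j := by
    intro z i
    have h0 : z = ∑ j, z j • (EuclideanSpace.basisFun (Fin n) ℝ).toBasis j := by
      conv_lhs => rw [eq_sum_single z]
      simp
    conv_lhs => rw [h0]
    simp only [map_sum, map_smul, L, Matrix.toLin_self]
    simp [Finset.sum_apply, mul_comm, Pi.single_apply]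
  have hnorm : ∀ z, ‖L z‖ ^ 2 = ∑ i, ∑ j, M i j * z i * z j := by
    intro z
    rw [EuclideanSpace.norm_sq_eq]
    simp only [hLv, hB, Matrix.mul_apply, Matrix.conjTranspose_apply, Real.norm_eq_abs, sq_abs,
      star_trivial, Finset.sum_mul]
    simp only [sq, Finset.sum_mul_sum]
    rw [Finset.sum_comm]
    refine Finset.sum_congr rfl fun i _ => ?_
    rw [Finset.sum_comm]
    refine Finset.sum_congr rfl fun j _ => Finset.sum_congr rfl fun k _ => by ring
  have hs2 : s = (fun y => y + y₀) ⁻¹' (L ⁻¹' Metric.ball 0 1) := by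
    ext y
    rw [hs, ← hnorm]
    simp only [Set.mem_preimage, mem_ball_zero_iff]
    constructor
    · intro h; nlinarith [norm_nonneg (L (y + y₀))]
    · intro h; nlinarith [norm_nonneg (L (y + y₀))]
  rw [hs2, MeasureTheory.measure_preimage_add_right,
    MeasureTheory.Measure.addHaar_preimage_linearMap _ (by rw [hL]; exact hBne), hL, hdet,
    Real.sqrt_sq_eq_abs, ENNReal.toReal_mul, ENNReal.toReal_ofReal (abs_nonneg _), abs_inv]

/-- The matrix of the quadratic form `(1 - ‖β‖²) (α² - β²)`. -/
def hMat (D : LocalRanders (Coord n)) (u : Coord n) : Matrix (Fin n) (Fin n) ℝ :=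
  Matrix.of fun i j => (1 - D.bsq u) * (aMat D u i j
    - D.b u (EuclideanSpace.single i 1) * D.b u (EuclideanSpace.single j 1))

lemma sum_bilin_single (B : Coord n →L[ℝ] Coord n →L[ℝ] ℝ) (y z : Coord n) :
    ∑ i, ∑ j, B (EuclideanSpace.single i 1) (EuclideanSpace.single j 1) * y i * z j = B y z := by
  have h1 : ∀ i, ∑ j, B (EuclideanSpace.single i 1) (EuclideanSpace.single j 1) * y i * z j
      = (B.flip z) (EuclideanSpace.single i 1) * y i := by
    intro i
    rw [ContinuousLinearMap.flip_apply, ← sum_clm_single (B (EuclideanSpace.single i 1)) z,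
      Finset.sum_mul]
    exact Finset.sum_congr rfl fun j _ => by ring
  simp only [h1]
  exact sum_clm_single (B.flip z) y

lemma sum_hMat (u y : Coord n) : ∑ i, ∑ j, hMat D u i j * y i * y j
    = (1 - D.bsq u) * (D.A u y y - D.b u y ^ 2) := by
  have h := sum_bilin_single
    ((1 - D.bsq u) • (D.A u - (D.b u).smulRight (D.b u))) y y
  simp only [smul_apply, sub_apply, ContinuousLinearMap.smulRight_apply, smul_eq_mul] at h
  rw [sq, ← h]
  rfl

lemma hMat_posDef (hu : u ∈ D.U) : (hMat D u).PosDef := by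
  refine Matrix.PosDef.of_dotProduct_mulVec_pos ?_ ?_
  · ext i j
    simp [hMat, aMat, D.symm u hu (EuclideanSpace.single j 1)]
    left; ring
  · intro x hx
    have h1 := sum_hMat (D := D) u (WithLp.toLp 2 x)
    have h2 : star x ⬝ᵥ (hMat D u).mulVec x = ∑ i, ∑ j, hMat D u i j * x i * x j := by
      simp only [dotProduct, Matrix.mulVec, Finset.mul_sum, Pi.star_apply, star_trivial]
      exact Finset.sum_congr rfl fun i _ => Finset.sum_congr rfl fun j _ => by ring
    rw [h2]
    have h3 : WithLp.toLp 2 x ≠ (0 : Coord n) := by simpa using hx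
    have h4 : 0 < (1 - D.bsq u) *
        (D.A u (WithLp.toLp 2 x) (WithLp.toLp 2 x) - D.b u (WithLp.toLp 2 x) ^ 2) :=
      mul_pos (sub_pos.2 (bsq_lt_one hu)) (sub_pos.2 (D.sq_lt u hu _ h3))
    rw [← h1] at h4
    exact h4

lemma det_hMat (hu : u ∈ D.U) :
    (hMat D u).det = (1 - D.bsq u) ^ (n + 1) * (aMat D u).det := by
  let B : Matrix (Fin n) (Fin 1) ℝ := Matrix.of fun i _ => D.X u i
  let C : Matrix (Fin 1) (Fin n) ℝ := Matrix.of fun _ j => - D.b u (EuclideanSpace.single j 1)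
  have h1 : hMat D u = (1 - D.bsq u) • (aMat D u * (1 + B * C)) := by
    ext i j
    rw [Matrix.mul_add, Matrix.mul_one, ← Matrix.mul_assoc]
    have h2 : ∀ k, (aMat D u * B) i k = D.b u (EuclideanSpace.single i 1) := by
      intro k
      rw [← A_X hu, D.symm u hu]
      simp only [Matrix.mul_apply, aMat, Matrix.of_apply, B]
      exact sum_clm_single _ _
    rw [Matrix.smul_apply, Matrix.add_apply, Matrix.mul_apply (M := aMat D u * B)]
    simp [h2, C, hMat]
    left; ring
  have h3 : (1 + C * B).det = 1 - D.bsq u := by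
    have e00 : (C * B) 0 0 = - D.bsq u := by
      simp only [Matrix.mul_apply, C, B, Matrix.of_apply, neg_mul, Finset.sum_neg_distrib]
      rw [sum_clm_single, bsq]
    rw [Matrix.det_fin_one, Matrix.add_apply, e00]
    simp; ring
  rw [h1, Matrix.det_smul, Matrix.det_mul, Matrix.det_one_add_mul_comm, h3, Fintype.card_fin]
  ring

lemma volume_indicatrix (hu : u ∈ D.U) :
    (MeasureTheory.volume {y : Coord n | D.F u y < 1}).toReal
      = (Real.sqrt ((1 - D.bsq u) ^ (n + 1) * (aMat D u).det))⁻¹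
        * (MeasureTheory.volume (Metric.ball (0 : Coord n) 1)).toReal := by
  rw [← det_hMat hu]
  refine volume_ellipsoid (hMat_posDef hu) ((1 - D.bsq u)⁻¹ • D.X u) fun y => ?_
  rw [Set.mem_ofPred_eq, F_lt_one_iff hu, sum_hMat]

/-- The distortion of a Randers metric: the determinant of `a_ij` cancels between
`det_fundTensor` and `volume_indicatrix`. -/
lemma distortion_eq (hu : u ∈ D.U) (hy : y ≠ 0) :
    distortionBH D.F u y = (n + 1) / 2 *
      (Real.log (D.F u y) - Real.log (D.α u y) - Real.log (1 - D.bsq u)) := by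
  have hF := F_pos hu hy
  have hα := α_pos hu hy
  have hb : 0 < 1 - D.bsq u := sub_pos.2 (bsq_lt_one hu)
  have ha := (aMat_posDef hu).det_pos
  have hv : (MeasureTheory.volume (Metric.ball (0 : Coord n) 1)).toReal ≠ 0 :=
    (ENNReal.toReal_pos (Metric.measure_ball_pos _ _ one_pos).ne'
      MeasureTheory.measure_ball_lt_top.ne).ne'
  have h1 : densityBH D.F u = Real.sqrt ((1 - D.bsq u) ^ (n + 1) * (aMat D u).det) := by
    rw [densityBH, volume_indicatrix hu]
    have : Real.sqrt ((1 - D.bsq u) ^ (n + 1) * (aMat D u).det) ≠ 0 :=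
      (Real.sqrt_pos.2 (mul_pos (pow_pos hb _) ha)).ne'
    field_simp
  rw [distortionBH, h1, det_fundTensor hu hy, ← Real.sqrt_div (by positivity),
    Real.log_sqrt (by positivity), mul_div_mul_right _ _ ha.ne', ← div_pow, Real.log_pow,
    Real.log_div (by positivity) hb.ne', Real.log_div hF.ne' hα.ne']
  push_cast
  ring

/-- The S-curvature of a Randers metric. The distortion is
`½ (n + 1) (log F - log α - log (1 - ‖β‖²))`, and its derivative along the spray is given by
`spray_α` and `spray_F`. -/
theorem sCurvBH_eq (hu : u ∈ D.U) (hy : y ≠ 0) :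
    sCurvBH D.F u y
      = (n + 1) * (D.P u y + fderiv ℝ D.bsq u y / (2 * (1 - D.bsq u))) := by
  have hF := (F_pos hu hy).ne'
  have hα := (α_pos hu hy).ne'
  have hb : 1 - D.bsq u ≠ 0 := (sub_pos.2 (bsq_lt_one hu)).ne'
  have hx : (fun v => distortionBH D.F v y) =ᶠ[𝓝 u] fun v => (n + 1) / 2 *
      (Real.log (D.F v y) - Real.log (D.α v y) - Real.log (1 - D.bsq v)) := by
    filter_upwards [D.isOpen.mem_nhds hu] with v hv using distortion_eq hv hy
  have hz : (fun z => distortionBH D.F u z) =ᶠ[𝓝 y] fun z => (n + 1) / 2 *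
      (Real.log (D.F u z) - Real.log (D.α u z) - Real.log (1 - D.bsq u)) := by
    filter_upwards [eventually_ne_zero hy] with z hz using distortion_eq hu hz
  have hdb := ((contDiffAt_bsq hu).differentiableAt (by simp)).hasFDerivAt
  have hx' : HasFDerivAt (fun v => ((n : ℝ) + 1) / 2 *
      (Real.log (D.F v y) - Real.log (D.α v y) - Real.log (1 - D.bsq v))) _ u :=
    ((((hasFDerivAt_F_base hu hy).log hF).sub ((hasFDerivAt_α_base hu hy).log hα)).sub
    ((hdb.const_sub 1).log hb)).const_mul (((n : ℝ) + 1) / 2)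
  have hz' : HasFDerivAt (fun z => ((n : ℝ) + 1) / 2 *
      (Real.log (D.F u z) - Real.log (D.α u z) - Real.log (1 - D.bsq u))) _ y :=
    ((((hasFDerivAt_F_fibre hu hy).log hF).sub ((hasFDerivAt_α_fibre hu hy).log hα)).sub
    (hasFDerivAt_const (Real.log (1 - D.bsq u)) y)).const_mul (((n : ℝ) + 1) / 2)
  have e1 : ∑ i, y i * dx i (distortionBH D.F) u y
      = fderiv ℝ (fun v => distortionBH D.F v y) u y := by
    rw [← sum_clm_single _ y]; simp only [dx, mul_comm]
  have e2 : ∑ i, geodCoeff D.F i u y * dy i (distortionBH D.F) u y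
      = fderiv ℝ (fun z => distortionBH D.F u z) y (D.G u y) := by
    rw [← sum_clm_single _ (D.G u y)]; simp only [dy, geodCoeff_eq hu hy, mul_comm]
  rw [sCurvBH, e1, e2, hx.fderiv_eq, hz.fderiv_eq, hx'.fderiv, hz'.fderiv]
  have h1 := spray_α hu hy
  have h2 := spray_F hu hy
  have h3 : fderiv ℝ D.b u y y = 2 * D.ell u y (D.G u y)
    - fderiv ℝ D.A u y y y / (2 * D.α u y) := by linarith
  have h4 : fderiv ℝ D.A u y y y = 2 * D.α u y * (2 * (D.A u y (D.G u y) / D.α u y)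
      - 2 * D.P u y * D.α u y) := by
    rw [← sub_eq_zero] at h1 ⊢
    field_simp at h1 ⊢
    linarith
  simp only [smul_apply, sub_apply, add_apply, neg_apply, smul_eq_mul, zero_apply,
    ContinuousLinearMap.flip_apply, h3, ell_apply]
  rw [h4]
  field_simp
  ring

end LocalRanders

/-! ### Divisibility by a definite quadratic form -/

section Poly

variable {E : Type*} [NormedAddCommGroup E] [NormedSpace ℝ E]

/-- A function on a vector space that is polynomial along each affine line. -/
def PolyOnLines (f : E → ℝ) : Prop :=
  ∀ w v : E, ∃ p : Polynomial ℝ, ∀ t : ℝ, f (w + t • v) = p.eval t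

namespace PolyOnLines

lemma const (c : ℝ) : PolyOnLines (fun _ : E => c) := fun _ _ => ⟨Polynomial.C c, by simp⟩

lemma clm (φ : E →L[ℝ] ℝ) : PolyOnLines (fun y => φ y) := fun w v =>
  ⟨Polynomial.C (φ w) + Polynomial.C (φ v) * Polynomial.X, fun t => by simp; ring⟩

lemma add {f g : E → ℝ} (hf : PolyOnLines f) (hg : PolyOnLines g) :
    PolyOnLines (fun y => f y + g y) := fun w v => by
  obtain ⟨p, hp⟩ := hf w v
  obtain ⟨q, hq⟩ := hg w v
  exact ⟨p + q, fun t => by simp [hp, hq]⟩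

lemma mul {f g : E → ℝ} (hf : PolyOnLines f) (hg : PolyOnLines g) :
    PolyOnLines (fun y => f y * g y) := fun w v => by
  obtain ⟨p, hp⟩ := hf w v
  obtain ⟨q, hq⟩ := hg w v
  exact ⟨p * q, fun t => by simp [hp, hq]⟩

lemma sub {f g : E → ℝ} (hf : PolyOnLines f) (hg : PolyOnLines g) :
    PolyOnLines (fun y => f y - g y) := fun w v => by
  obtain ⟨p, hp⟩ := hf w v
  obtain ⟨q, hq⟩ := hg w v
  exact ⟨p - q, fun t => by simp [hp, hq]⟩

lemma pow {f : E → ℝ} (hf : PolyOnLines f) (k : ℕ) : PolyOnLines (fun y => f y ^ k) :=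
  fun w v => by
  obtain ⟨p, hp⟩ := hf w v
  exact ⟨p ^ k, fun t => by simp [hp]⟩

lemma bilin (B : E →L[ℝ] E →L[ℝ] ℝ) : PolyOnLines (fun y => B y y) := fun w v =>
  ⟨Polynomial.C (B w w) + Polynomial.C (B w v + B v w) * Polynomial.X
    + Polynomial.C (B v v) * Polynomial.X ^ 2, fun t => by simp; ring⟩

lemma trilin (T : E →L[ℝ] E →L[ℝ] E →L[ℝ] ℝ) : PolyOnLines (fun y => T y y y) := fun w v =>
  ⟨Polynomial.C (T w w w) + Polynomial.C (T w w v + T w v w + T v w w) * Polynomial.X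
    + Polynomial.C (T w v v + T v w v + T v v w) * Polynomial.X ^ 2
    + Polynomial.C (T v v v) * Polynomial.X ^ 3, fun t => by simp; ring⟩

end PolyOnLines

/-- If a definite quadratic form `h` divides a nonzero multiple of `e²` along the lines through `w`
in the directions `h`-orthogonal to `w`, then the quadratic form `e` is a multiple of `h`: it
vanishes at the complex zeros of `h` on these lines. -/
lemma proportional_of_dvd_sq {eb hb : E →L[ℝ] E →L[ℝ] ℝ} (he : ∀ y z, eb y z = eb z y)
    (hh : ∀ y z, hb y z = hb z y) (hpos : ∀ y, y ≠ 0 → 0 < hb y y) {w : E} (hw : w ≠ 0) {m : ℝ}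
    (hm : m ≠ 0)
    (H : ∀ v, hb w v = 0 → ∃ p : Polynomial ℝ, ∀ t : ℝ,
      eb (w + t • v) (w + t • v) ^ 2 * m = hb (w + t • v) (w + t • v) * p.eval t) :
    ∃ c : ℝ, ∀ y, eb y y = c * hb y y := by
  have hw0 := hpos w hw
  have key : ∀ v, hb w v = 0 → eb w v = 0 ∧ eb v v = eb w w / hb w w * hb v v := by
    intro v hv
    by_cases hv0 : v = 0
    · simp [hv0]
    have hv1 := hpos v hv0
    obtain ⟨p, hp⟩ := H v hv
    let e₁ : Polynomial ℝ := Polynomial.C (eb w w) + Polynomial.C (2 * eb w v) * Polynomial.X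
      + Polynomial.C (eb v v) * Polynomial.X ^ 2
    let h₁ : Polynomial ℝ := Polynomial.C (hb w w) + Polynomial.C (hb v v) * Polynomial.X ^ 2
    have hpoly : e₁ ^ 2 * Polynomial.C m = h₁ * p := by
      refine Polynomial.funext fun t => ?_
      have := hp t
      simp only [map_add, map_smul, add_apply, smul_apply, smul_eq_mul, he v w, hh v w,
        hv] at this
      simp only [e₁, h₁, Polynomial.eval_mul, Polynomial.eval_pow, Polynomial.eval_add,
        Polynomial.eval_C, Polynomial.eval_X]
      linear_combination this
    set ρ : ℝ := Real.sqrt (hb w w / hb v v) with hρ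
    have hρ2 : ρ ^ 2 = hb w w / hb v v := Real.sq_sqrt (div_pos hw0 hv1).le
    have hρ0 : 0 < ρ := Real.sqrt_pos.2 (div_pos hw0 hv1)
    have hz2 : ((ρ : ℂ) * Complex.I) ^ 2 = ((- (hb w w / hb v v) : ℝ) : ℂ) := by
      rw [mul_pow, Complex.I_sq, ← Complex.ofReal_pow, hρ2]; push_cast; ring
    have h0 : Polynomial.aeval ((ρ : ℂ) * Complex.I) h₁ = 0 := by
      simp only [h₁, map_add, map_mul, map_pow, Polynomial.aeval_C, Polynomial.aeval_X, hz2,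
        Complex.coe_algebraMap]
      rw [← Complex.ofReal_mul, ← Complex.ofReal_add]
      simp only [Complex.ofReal_eq_zero]
      field_simp
      ring
    have h2 : Polynomial.aeval ((ρ : ℂ) * Complex.I) e₁ = 0 := by
      have := congrArg (Polynomial.aeval ((ρ : ℂ) * Complex.I)) hpoly
      rw [map_mul, map_mul, h0, zero_mul, map_pow, Polynomial.aeval_C] at this
      have hm' : algebraMap ℝ ℂ m ≠ 0 := by simpa using hm
      exact pow_eq_zero_iff (two_ne_zero) |>.1 ((mul_eq_zero.1 this).resolve_right hm')
    simp only [e₁, map_add, map_mul, map_pow, Polynomial.aeval_C, Polynomial.aeval_X, hz2,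
      Complex.coe_algebraMap] at h2
    have hre := congrArg Complex.re h2
    have him := congrArg Complex.im h2
    simp at hre him
    constructor
    · exact him.resolve_right hρ0.ne'
    · have : eb w w = eb v v * (hb w w / hb v v) := by linarith
      rw [this]; field_simp
  refine ⟨eb w w / hb w w, fun y => ?_⟩
  set μ : ℝ := hb w y / hb w w with hμ
  set v : E := y - μ • w with hv
  have hv0 : hb w v = 0 := by
    rw [hv, map_sub, map_smul, hμ, smul_eq_mul]; field_simp; ring
  obtain ⟨k1, k2⟩ := key v hv0
  have hy : y = μ • w + v := by rw [hv]; abel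
  rw [hy]
  simp only [map_add, map_smul, add_apply, smul_apply, smul_eq_mul, he v w, hh v w, hv0, k1, k2]
  field_simp
  ring

end Poly

/-! ### Isotropy of the S-curvature -/

namespace LocalRanders

section Abstract

variable {E : Type*} [NormedAddCommGroup E] [NormedSpace ℝ E] [FiniteDimensional ℝ E]
  {D : LocalRanders E} {u y : E}

variable (D) in
/-- The bilinear form of `α² - β²`. -/
def hForm (u : E) : E →L[ℝ] E →L[ℝ] ℝ := D.A u - (D.b u).smulRight (D.b u)

lemma hForm_apply (u y z : E) : D.hForm u y z = D.A u y z - D.b u y * D.b u z := by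
  simp [hForm]

variable (D) in
/-- The bilinear form `e_ij = r_ij + b_i s_j + b_j s_i`. -/
def eForm (u : E) : E →L[ℝ] E →L[ℝ] ℝ :=
  D.r u + (D.b u).smulRight (D.s u) + (D.s u).smulRight (D.b u)

lemma eForm_apply (u y z : E) :
    D.eForm u y z = D.r u y z + D.b u y * D.s u z + D.s u y * D.b u z := by
  simp [eForm]

lemma eForm_self (u y : E) : D.eForm u y y = D.e u y := by rw [eForm_apply, e]; ring

variable (D) in
/-- The infinitesimal form of isotropic S-curvature: `e_ij = 2 σ (a_ij - b_i b_j)`. -/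
def IsoAt (σ : ℝ) (u : E) : Prop := ∀ y, D.e u y = 2 * σ * (D.A u y y - D.b u y ^ 2)

lemma IsoAt.polar {σ : ℝ} (hu : u ∈ D.U) (h : D.IsoAt σ u) (y z : E) :
    D.r u y z + D.b u y * D.s u z + D.b u z * D.s u y
      = 2 * σ * (D.A u y z - D.b u y * D.b u z) := by
  have h1 := h (y + z)
  have h2 := h y
  have h3 := h z
  simp only [e, map_add, add_apply, r_symm hu z y, D.symm u hu z y] at h1 h2 h3
  linear_combination (1 / 2 : ℝ) * (h1 - h2 - h3)

lemma fderiv_A_X (hu : u ∈ D.U) (w z : E) :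
    fderiv ℝ D.A u w (D.X u) z + D.A u (fderiv ℝ D.X u w) z = fderiv ℝ D.b u w z := by
  have hdA := ((contDiffAt_A hu).differentiableAt (by simp)).hasFDerivAt
  have hdX := ((contDiffAt_X hu).differentiableAt (by simp)).hasFDerivAt
  have h1 := (hdA.clm_apply hdX).clm_apply (hasFDerivAt_const z u)
  have h2 : (fun v => D.A v (D.X v) z) =ᶠ[𝓝 u] fun v => D.b v z := by
    filter_upwards [D.isOpen.mem_nhds hu] with v hv using A_X hv z
  have h3 := Filter.EventuallyEq.fderiv_eq (𝕜 := ℝ) h2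
  rw [h1.fderiv, (hasFDerivAt_b_base hu z).fderiv] at h3
  have h4 := DFunLike.congr_fun h3 w
  simp at h4
  linarith

/-- `½ ∂_j (‖β‖²) = r_j + s_j`. -/
lemma fderiv_bsq (hu : u ∈ D.U) (y : E) :
    fderiv ℝ D.bsq u y = 2 * (D.r u y (D.X u) + D.s u y) := by
  have hdb := ((contDiffAt_b hu).differentiableAt (by simp)).hasFDerivAt
  have hdX := ((contDiffAt_X hu).differentiableAt (by simp)).hasFDerivAt
  have h1 : HasFDerivAt D.bsq _ u := hdb.clm_apply hdX
  have h2 := fderiv_A_X hu y (D.X u)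
  rw [D.symm u hu (fderiv ℝ D.X u y), A_X hu] at h2
  have h3 : D.b u (D.Γ u y (D.X u)) = 1 / 2 * fderiv ℝ D.A u y (D.X u) (D.X u) := by
    rw [← A_X hu, D.symm u hu, A_Γ hu, fderiv_A_symm hu (D.X u) y]; ring
  rw [h1.fderiv, r_apply, h3, s_eq hu]
  simp
  linarith

lemma IsoAt.fderiv_bsq {σ : ℝ} (hu : u ∈ D.U) (h : D.IsoAt σ u) (y : E) :
    fderiv ℝ D.bsq u y = 2 * (1 - D.bsq u) * (2 * σ * D.b u y + D.s u y) := by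
  have h1 := h.polar hu y (D.X u)
  rw [s_X hu, D.symm u hu, A_X hu] at h1
  rw [LocalRanders.fderiv_bsq hu]
  have : D.bsq u = D.b u (D.X u) := rfl
  rw [this]
  linear_combination 2 * h1

lemma IsoAt.N_eq {σ : ℝ} (hu : u ∈ D.U) (h : D.IsoAt σ u) (y : E) :
    D.N u y = 2 * D.F u y * (σ * (D.α u y - D.b u y) - D.s u y) := by
  have h1 := h y
  rw [← α_sq hu] at h1
  rw [N, F]
  rw [e] at h1
  linear_combination h1

/-- The derivative of `α²` along the complete lift of `V`. -/
def lieA (D : LocalRanders E) (V : E → E) (u y : E) : ℝ :=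
  fderiv ℝ D.A u (V u) y y + 2 * D.A u (fderiv ℝ V u y) y

/-- The derivative of `β` along the complete lift of `V`. -/
def lieB (D : LocalRanders E) (V : E → E) (u : E) : E →L[ℝ] ℝ :=
  fderiv ℝ D.b u (V u) + D.b u ∘L fderiv ℝ V u

lemma lieB_apply (V : E → E) (u y : E) :
    D.lieB V u y = fderiv ℝ D.b u (V u) y + D.b u (fderiv ℝ V u y) := rfl

/-- The bilinear form of `lieA`. -/
def lieAForm (D : LocalRanders E) (V : E → E) (u : E) : E →L[ℝ] E →L[ℝ] ℝ :=
  fderiv ℝ D.A u (V u) + (2 : ℝ) • (D.A u ∘L fderiv ℝ V u)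

lemma lieAForm_self (V : E → E) (u y : E) : D.lieAForm V u y y = D.lieA V u y := by
  simp [lieAForm, lieA]

variable (D) in
/-- The bilinear form of `ricA`. -/
def ricForm (u : E) : E →L[ℝ] E →L[ℝ] ℝ :=
  (ContinuousLinearMap.compL ℝ E (E →L[ℝ] E) ℝ (tr E)) ∘L flipL E E E ∘L (fderiv ℝ D.Γ u).flip
    - (ContinuousLinearMap.compL ℝ E (E →L[ℝ] E) ℝ (tr E)) ∘L fderiv ℝ D.Γ u

lemma ricForm_apply (u y z : E) : D.ricForm u y z =
    tr E (((fderiv ℝ D.Γ u).flip y).flip z) - tr E (fderiv ℝ D.Γ u y z) := by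
  simp [ricForm]

lemma ricForm_self (u y : E) : D.ricForm u y y = D.ricA u y := ricForm_apply u y y

lemma hForm_pos (hu : u ∈ D.U) (hy : y ≠ 0) : 0 < D.hForm u y y := by
  rw [hForm_apply, ← sq]; exact sub_pos.2 (D.sq_lt u hu y hy)

lemma hForm_X (hu : u ∈ D.U) (v : E) : D.hForm u (D.X u) v = (1 - D.bsq u) * D.b u v := by
  rw [hForm_apply, A_X hu, bsq]; ring

lemma divS_neg (u y : E) : D.divS u (-y) = - D.divS u y := by
  have : (fderiv ℝ D.S u).flip (-y) = - (fderiv ℝ D.S u).flip y := map_neg _ _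
  rw [divS, divS, this, map_neg]

end Abstract

variable {n : ℕ} {D : LocalRanders (Coord n)} {u y : Coord n}

/-- The infinitesimal form `IsoAt` implies isotropic S-curvature in the sense of the distortion. -/
theorem IsoAt.sCurvBH {σ : ℝ} (hu : u ∈ D.U) (h : D.IsoAt σ u) (hy : y ≠ 0) :
    sCurvBH D.F u y = (n + 1) * σ * D.F u y := by
  have hF := (F_pos hu hy).ne'
  have hb : 1 - D.bsq u ≠ 0 := (sub_pos.2 (bsq_lt_one hu)).ne'
  rw [sCurvBH_eq hu hy, P, h.N_eq hu, h.fderiv_bsq hu]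
  have e8 : D.F u y = D.α u y + D.b u y := rfl
  rw [e8] at hF ⊢
  field_simp
  ring

lemma lieLift_eq (f : Coord n → Coord n → ℝ) {V : Coord n → Coord n}
    (hV : DifferentiableAt ℝ V u) :
    lieLift V f u y = fderiv ℝ (fun v => f v y) u (V u)
      + fderiv ℝ (fun z => f u z) y (fderiv ℝ V u y) := by
  have h : ∀ i, ∑ j, y j * fderiv ℝ (fun v => V v i) u (EuclideanSpace.single j 1)
      = fderiv ℝ V u y i := by
    intro i
    rw [← proj_fderiv hV, ← sum_clm_single _ y]
    simp only [mul_comm]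
  simp only [lieLift, h]
  rw [← sum_clm_single _ (V u), ← sum_clm_single _ (fderiv ℝ V u y)]
  simp only [dx, dy, mul_comm]

lemma lieLift_α (hu : u ∈ D.U) (hy : y ≠ 0) {V : Coord n → Coord n}
    (hV : DifferentiableAt ℝ V u) :
    lieLift V D.α u y = D.lieA V u y / (2 * D.α u y) := by
  have hα := (α_pos hu hy).ne'
  rw [lieLift_eq _ hV, (hasFDerivAt_α_base hu hy).fderiv, (hasFDerivAt_α_fibre hu hy).fderiv]
  simp only [smul_apply, ContinuousLinearMap.flip_apply, smul_eq_mul, lieA, D.symm u hu y]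
  field_simp

lemma lieLift_β (hu : u ∈ D.U) {V : Coord n → Coord n} (hV : DifferentiableAt ℝ V u) :
    lieLift V (fun v z => D.b v z) u y = D.lieB V u y := by
  rw [lieLift_eq _ hV, (hasFDerivAt_b_base hu y).fderiv, (D.b u).hasFDerivAt.fderiv]
  rfl

lemma lieLift_F (hu : u ∈ D.U) (hy : y ≠ 0) {V : Coord n → Coord n}
    (hV : DifferentiableAt ℝ V u) :
    lieLift V D.F u y = D.lieA V u y / (2 * D.α u y) + D.lieB V u y := by
  have hα := (α_pos hu hy).ne'
  rw [lieLift_eq _ hV, (hasFDerivAt_F_base hu hy).fderiv, (hasFDerivAt_F_fibre hu hy).fderiv]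
  simp only [smul_apply, add_apply, ContinuousLinearMap.flip_apply, smul_eq_mul, lieA, lieB_apply,
    D.symm u hu y]
  field_simp
  ring

lemma lieLift_sqFun (hu : u ∈ D.U) (hy : y ≠ 0) {V : Coord n → Coord n}
    (hV : DifferentiableAt ℝ V u) :
    lieLift V (sqFun D.F) u y
      = 2 * D.F u y * (D.lieA V u y / (2 * D.α u y) + D.lieB V u y) := by
  have hα := (α_pos hu hy).ne'
  rw [lieLift_eq _ hV]
  simp only [sqFun]
  rw [(hasFDerivAt_sq_base hu hy).fderiv, (hasFDerivAt_sq_fibre hu hy).fderiv]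
  simp only [smul_apply, add_apply, ContinuousLinearMap.flip_apply, smul_eq_mul, lieA, lieB_apply,
    D.symm u hu y, ell_apply]
  field_simp
  ring

/-- The soliton equation at a point. -/
def SolitonAt (D : LocalRanders (Coord n)) (V : Coord n → Coord n) (κ : ℝ) (u : Coord n) : Prop :=
  ∀ y : Coord n, y ≠ 0 → 2 * ricci D.F u y + lieLift V (sqFun D.F) u y = 2 * κ * D.F u y ^ 2

/-- The soliton equation at `y` and at `-y`, split into its even and odd parts. Cleared of
denominators, it reads `p(y) α + q(y) = 0` with `p` even and `q` odd in `y`, both polynomial, so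
that `p = q = 0`. The first conclusion is `p = 0`; the second is the combination of both by which
`α² - β²` divides `e² β`. The variables stand for the terms of `ricci_normal` and
`lieLift_sqFun`. -/
lemma soliton_split {α β k κ RE D₀ e s R₃ q s₁ t₀ W L : ℝ} (hα : 0 < α)
    (hF : 0 < α + β) (hF' : 0 < α - β)
    (h₁ : 2 * (RE + 2 * α * D₀ + k * (3 * (e - 2 * (α + β) * s) ^ 2 / (4 * (α + β) ^ 2)
      - (R₃ - 4 * α * q - 2 * α * (s₁ - 2 * α * t₀)) / (2 * (α + β))))
      + 2 * (α + β) * (W / (2 * α) + L) = 2 * κ * (α + β) ^ 2)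
    (h₂ : 2 * (RE - 2 * α * D₀ + k * (3 * (e + 2 * (α - β) * s) ^ 2 / (4 * (α - β) ^ 2)
      - (-R₃ - 4 * α * q - 2 * α * (s₁ + 2 * α * t₀)) / (2 * (α - β))))
      + 2 * (α - β) * (W / (2 * α) - L) = 2 * κ * (α - β) ^ 2) :
    (3 / 2 * k * e ^ 2
      + (α ^ 2 * (6 * k * s ^ 2 + 2 * RE + 4 * β * D₀ + k * (4 * q + 2 * s₁) + W + 4 * β * L
          - 2 * κ * (α ^ 2 + 3 * β ^ 2)) + β ^ 2 * W)
      + β * (-6 * k * e * s + 6 * k * β * s ^ 2 + 2 * β * RE + 4 * α ^ 2 * D₀ - k * R₃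
          - 4 * k * α ^ 2 * t₀ + 2 * β * W + 2 * α ^ 2 * L + 2 * β ^ 2 * L - 6 * κ * α ^ 2 * β
          - 2 * κ * β ^ 3) = 0) ∧
    3 / 2 * k * e ^ 2 * β = (α ^ 2 - β ^ 2) *
      (-6 * k * e * s + 6 * k * β * s ^ 2 + 2 * β * RE + 4 * α ^ 2 * D₀ - k * R₃
          - 4 * k * α ^ 2 * t₀ + 2 * β * W + 2 * α ^ 2 * L + 2 * β ^ 2 * L - 6 * κ * α ^ 2 * β
          - 2 * κ * β ^ 3) := by
  field_simp at h₁ h₂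
  set D₃ := -6 * k * e * s + 6 * k * β * s ^ 2 + 2 * β * RE + 4 * α ^ 2 * D₀ - k * R₃
          - 4 * k * α ^ 2 * t₀ + 2 * β * W + 2 * α ^ 2 * L + 2 * β ^ 2 * L - 6 * κ * α ^ 2 * β
          - 2 * κ * β ^ 3 with hD₃
  set D₄ := α ^ 2 * (6 * k * s ^ 2 + 2 * RE + 4 * β * D₀ + k * (4 * q + 2 * s₁) + W + 4 * β * L
          - 2 * κ * (α ^ 2 + 3 * β ^ 2)) + β ^ 2 * W with hD₄
  have k₁ : α * (3 / 2 * k * e ^ 2 + D₄ + β * D₃) + (β * D₄ + α ^ 2 * D₃) = 0 := by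
    rw [hD₃, hD₄]; linear_combination (1 / 4 : ℝ) * h₁
  have k₂ : α * (3 / 2 * k * e ^ 2 + D₄ + β * D₃) - (β * D₄ + α ^ 2 * D₃) = 0 := by
    rw [hD₃, hD₄]; linear_combination (1 / 4 : ℝ) * h₂
  have k₃ : 3 / 2 * k * e ^ 2 + D₄ + β * D₃ = 0 := by
    have : α * (3 / 2 * k * e ^ 2 + D₄ + β * D₃) = 0 := by linarith
    exact (mul_eq_zero.1 this).resolve_left hα.ne'
  have k₄ : β * D₄ + α ^ 2 * D₃ = 0 := by linarith
  exact ⟨k₃, by linear_combination β * k₃ - k₄⟩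

/-- At a point where the metric is constant to first order, the soliton equation forces the
S-curvature to be isotropic: `α² - β²` divides `e² β`, or `e²` where `β = 0`. -/
theorem SolitonAt.exists_isoAt (hn : 2 ≤ n) (hu : u ∈ D.U) (hN : fderiv ℝ D.A u = 0)
    {V : Coord n → Coord n} (hV : DifferentiableAt ℝ V u) {κ : ℝ} (h : D.SolitonAt V κ u) :
    ∃ σ, D.IsoAt σ u := by
  have hk : ((n : ℝ) - 1) ≠ 0 := by
    have : (2 : ℝ) ≤ n := by exact_mod_cast hn
    linarith
  let RE : Coord n → ℝ := fun y => D.ricForm u y y - 2 * (D.A u y (D.S u (D.S u y)))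
      - D.A u y y * tr _ (D.S u ∘L D.S u)
  let D₃ : Coord n → ℝ := fun y =>
    -6 * ((n : ℝ) - 1) * D.eForm u y y * D.s u y + 6 * ((n : ℝ) - 1) * D.b u y * D.s u y ^ 2
      + 2 * D.b u y * RE y + 4 * D.A u y y * D.divS u y - ((n : ℝ) - 1) * fderiv ℝ D.r u y y y
      - 4 * ((n : ℝ) - 1) * D.A u y y * (D.s u ∘L D.S u) y + 2 * D.b u y * D.lieAForm V u y y
      + 2 * D.A u y y * D.lieB V u y + 2 * D.b u y ^ 2 * D.lieB V u y
      - 6 * κ * D.A u y y * D.b u y - 2 * κ * D.b u y ^ 3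
  let D₂ : Coord n → ℝ := fun y =>
    6 * ((n : ℝ) - 1) * D.s u y ^ 2 + 2 * RE y + 4 * D.b u y * D.divS u y
      + ((n : ℝ) - 1) * (4 * D.r u y (D.S u y) + 2 * fderiv ℝ D.s u y y) + D.lieAForm V u y y
      + 4 * D.b u y * D.lieB V u y - 2 * κ * (D.A u y y + 3 * D.b u y ^ 2)
  have key : ∀ y, y ≠ 0 → (3 / 2 * ((n : ℝ) - 1) * D.eForm u y y ^ 2
      + (D.A u y y * D₂ y + D.b u y ^ 2 * D.lieAForm V u y y) + D.b u y * D₃ y = 0) ∧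
      3 / 2 * ((n : ℝ) - 1) * D.eForm u y y ^ 2 * D.b u y = D.hForm u y y * D₃ y := by
    intro y hy
    have hy' : -y ≠ 0 := neg_ne_zero.2 hy
    have hab := abs_lt.1 (abs_b_lt hu hy)
    have h₁ := h y hy
    have h₂ := h (-y) hy'
    rw [ricci_normal hu hN hy, lieLift_sqFun hu hy hV] at h₁
    rw [ricci_normal hu hN hy', lieLift_sqFun hu hy' hV] at h₂
    have hNe : ∀ y, D.N u y = D.eForm u y y - 2 * (D.α u y + D.b u y) * D.s u y := by
      intro y; rw [N, eForm_self, e]; ring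
    have := soliton_split (α := D.α u y) (β := D.b u y) (k := (n : ℝ) - 1) (κ := κ) (RE := RE y)
      (D₀ := D.divS u y) (e := D.eForm u y y) (s := D.s u y) (R₃ := fderiv ℝ D.r u y y y)
      (q := D.r u y (D.S u y)) (s₁ := fderiv ℝ D.s u y y) (t₀ := (D.s u ∘L D.S u) y)
      (W := D.lieAForm V u y y) (L := D.lieB V u y) (α_pos hu hy) (by linarith) (by linarith)
      (by
        simp only [hNe, Ndot, F, ← ricForm_self, ← lieAForm_self] at h₁
        simp only [RE, ← α_sq hu y, ContinuousLinearMap.comp_apply]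
        rw [← h₁]; ring)
      (by
        simp only [hNe, Ndot, F, ← ricForm_self, ← lieAForm_self, α_neg, map_neg, neg_apply,
          neg_neg, divS_neg] at h₂
        simp only [RE, ← α_sq hu y, ContinuousLinearMap.comp_apply]
        rw [show 2 * κ * (D.α u y - D.b u y) ^ 2 = 2 * κ * (D.α u y + - D.b u y) ^ 2 by ring,
          ← h₂]
        ring)
    rw [α_sq hu] at this
    refine ⟨this.1, ?_⟩
    rw [hForm_apply, ← sq]
    exact this.2
  have hRE : PolyOnLines RE := by
    have h1 : PolyOnLines (fun y => D.A u y (D.S u (D.S u y))) :=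
      PolyOnLines.bilin ((D.A u).flip ∘L D.S u ∘L D.S u).flip
    exact ((PolyOnLines.bilin _).sub ((PolyOnLines.const 2).mul h1)).sub
      ((PolyOnLines.bilin (D.A u)).mul (PolyOnLines.const _))
  have hdiv : PolyOnLines (fun y => D.divS u y) :=
    PolyOnLines.clm (tr _ ∘L (fderiv ℝ D.S u).flip)
  have pA := PolyOnLines.bilin (D.A u)
  have pb := PolyOnLines.clm (D.b u)
  have ps := PolyOnLines.clm (D.s u)
  have pL := PolyOnLines.clm (D.lieB V u)
  have pW := PolyOnLines.bilin (D.lieAForm V u)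
  have pc : ∀ c : ℝ, PolyOnLines (fun _ : Coord n => c) := PolyOnLines.const
  have hD₃ : PolyOnLines D₃ := by
    refine PolyOnLines.sub (PolyOnLines.sub (PolyOnLines.add (PolyOnLines.add (PolyOnLines.add
      (PolyOnLines.sub (PolyOnLines.sub (PolyOnLines.add (PolyOnLines.add (PolyOnLines.add
      ?_ ?_) ?_) ?_) ?_) ?_) ?_) ?_) ?_) ?_) ?_
    · exact ((pc _).mul (PolyOnLines.bilin (D.eForm u))).mul ps
    · exact ((pc _).mul pb).mul (ps.pow 2)
    · exact ((pc _).mul pb).mul hRE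
    · exact ((pc _).mul pA).mul hdiv
    · exact (pc _).mul (PolyOnLines.trilin (fderiv ℝ D.r u))
    · exact ((pc _).mul pA).mul (PolyOnLines.clm _)
    · exact ((pc _).mul pb).mul pW
    · exact ((pc _).mul pA).mul pL
    · exact ((pc _).mul (pb.pow 2)).mul pL
    · exact ((pc _).mul pA).mul pb
    · exact (pc _).mul (pb.pow 3)
  have hD₂ : PolyOnLines D₂ := by
    have hq : PolyOnLines (fun y => D.r u y (D.S u y)) :=
      PolyOnLines.bilin ((D.r u).flip ∘L D.S u).flip
    refine PolyOnLines.sub (PolyOnLines.add (PolyOnLines.add (PolyOnLines.add (PolyOnLines.add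
      (PolyOnLines.add ?_ ?_) ?_) ?_) ?_) ?_) ?_
    · exact (pc _).mul (ps.pow 2)
    · exact (pc _).mul hRE
    · exact ((pc _).mul pb).mul hdiv
    · exact (pc _).mul (((pc _).mul hq).add ((pc _).mul (PolyOnLines.bilin (fderiv ℝ D.s u))))
    · exact pW
    · exact ((pc _).mul pb).mul pL
    · exact (pc _).mul (pA.add ((pc _).mul (pb.pow 2)))
  have he : ∀ y z, D.eForm u y z = D.eForm u z y := by
    intro y z; rw [eForm_apply, eForm_apply, r_symm hu y z]; ring
  have hh : ∀ y z, D.hForm u y z = D.hForm u z y := by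
    intro y z; rw [hForm_apply, hForm_apply, D.symm u hu y z]; ring
  have hne : ∀ w v : Coord n, w ≠ 0 → D.hForm u w v = 0 → ∀ t : ℝ, w + t • v ≠ 0 := by
    intro w v hw hv t ht
    have h1 : D.hForm u w (w + t • v) = 0 := by rw [ht]; simp
    rw [map_add, map_smul, hv] at h1
    have := hForm_pos hu hw
    simp at h1
    linarith
  suffices hc : ∃ c : ℝ, ∀ y, D.eForm u y y = c * D.hForm u y y by
    obtain ⟨c, hc⟩ := hc
    refine ⟨c / 2, fun y => ?_⟩
    rw [← eForm_self, hc, hForm_apply]; ring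
  by_cases hX : D.X u = 0
  · have hb : ∀ z, D.b u z = 0 := by intro z; rw [← A_X hu, hX]; simp
    obtain ⟨w, hw⟩ : ∃ w : Coord n, w ≠ 0 :=
      ⟨EuclideanSpace.single ⟨0, by omega⟩ 1, by simp⟩
    refine proportional_of_dvd_sq he hh (fun y hy => hForm_pos hu hy) hw (m := 3 / 2 * (n - 1))
      (by simpa using hk) fun v hv => ?_
    obtain ⟨p, hp⟩ := hD₂ w v
    refine ⟨-p, fun t => ?_⟩
    have := (key _ (hne w v hw hv t)).1
    simp only [hb, hForm_apply, Polynomial.eval_neg, ← hp] at this ⊢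
    linear_combination this
  · have hbX : D.b u (D.X u) ≠ 0 := by rw [← A_X hu]; exact (D.pos u hu _ hX).ne'
    refine proportional_of_dvd_sq he hh (fun y hy => hForm_pos hu hy) hX
      (m := 3 / 2 * (n - 1) * D.b u (D.X u)) (by simpa using ⟨hk, hbX⟩) fun v hv => ?_
    -- along the line `X + t v` the one-form `β` has the constant value `‖β‖²`
    obtain ⟨p, hp⟩ := hD₃ (D.X u) v
    refine ⟨p, fun t => ?_⟩
    have h1 := (key _ (hne _ v hX hv t)).2
    have hbv : D.b u v = 0 := by
      rw [hForm_X hu] at hv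
      exact (mul_eq_zero.1 hv).resolve_left (sub_pos.2 (bsq_lt_one hu)).ne'
    have hb : D.b u (D.X u + t • v) = D.b u (D.X u) := by simp [hbv]
    rw [hb, hp] at h1
    linear_combination h1

end LocalRanders

/-! ### The soliton equation with isotropic S-curvature -/

namespace LocalRanders

section Abstract

variable {E : Type*} [NormedAddCommGroup E] [NormedSpace ℝ E] [FiniteDimensional ℝ E]
  {D : LocalRanders E} {u y : E}

/-- The second derivative of the metric is symmetric in its directions. -/
lemma fderiv2_A_comm (hu : u ∈ D.U) (w v y z : E) :
    fderiv ℝ (fderiv ℝ D.A) u w v y z = fderiv ℝ (fderiv ℝ D.A) u v w y z := by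
  rw [((contDiffAt_A hu).isSymmSndFDerivAt (by
    simpa using (WithTop.coe_le_coe.2 (le_top : (2 : ℕ∞) ≤ ⊤) : ((2 : ℕ∞) : WithTop ℕ∞) ≤ _))) w v]

lemma fderiv2_b_comm (hu : u ∈ D.U) (w v y : E) :
    fderiv ℝ (fderiv ℝ D.b) u w v y = fderiv ℝ (fderiv ℝ D.b) u v w y := by
  rw [((contDiffAt_b hu).isSymmSndFDerivAt (by
    simpa using (WithTop.coe_le_coe.2 (le_top : (2 : ℕ∞) ≤ ⊤) : ((2 : ℕ∞) : WithTop ℕ∞) ≤ _))) w v]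

lemma hasFDerivAt_fderiv_A (hu : u ∈ D.U) (v y z : E) :
    HasFDerivAt (fun p => fderiv ℝ D.A p v y z)
      ((((fderiv ℝ (fderiv ℝ D.A) u).flip v).flip y).flip z) u := by
  have hd := ((contDiffAt_fderiv_A hu).differentiableAt (by simp)).hasFDerivAt
  have h1 := ((hd.clm_apply (hasFDerivAt_const v u)).clm_apply
    (hasFDerivAt_const y u)).clm_apply (hasFDerivAt_const z u)
  exact h1.congr_fderiv (by ext w; simp)

lemma hasFDerivAt_fderiv_b (hu : u ∈ D.U) (v y : E) :
    HasFDerivAt (fun p => fderiv ℝ D.b p v y) (((fderiv ℝ (fderiv ℝ D.b) u).flip v).flip y) u := by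
  have hd := ((contDiffAt_fderiv_b hu).differentiableAt (by simp)).hasFDerivAt
  have h1 := (hd.clm_apply (hasFDerivAt_const v u)).clm_apply (hasFDerivAt_const y u)
  exact h1.congr_fderiv (by ext w; simp)

lemma fderiv2_A_symm (hu : u ∈ D.U) (w v y z : E) :
    fderiv ℝ (fderiv ℝ D.A) u w v y z = fderiv ℝ (fderiv ℝ D.A) u w v z y := by
  have h : (fun p => fderiv ℝ D.A p v y z) =ᶠ[𝓝 u] fun p => fderiv ℝ D.A p v z y := by
    filter_upwards [D.isOpen.mem_nhds hu] with p hp using fderiv_A_symm hp v y z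
  have h1 := Filter.EventuallyEq.fderiv_eq (𝕜 := ℝ) h
  rw [(hasFDerivAt_fderiv_A hu v y z).fderiv, (hasFDerivAt_fderiv_A hu v z y).fderiv] at h1
  exact DFunLike.congr_fun h1 w

lemma A_fderiv_Γ (hu : u ∈ D.U) (hN : fderiv ℝ D.A u = 0) (w y z x : E) :
    D.A u (fderiv ℝ D.Γ u w y z) x = 1 / 2 * (fderiv ℝ (fderiv ℝ D.A) u w y z x
      + fderiv ℝ (fderiv ℝ D.A) u w z y x - fderiv ℝ (fderiv ℝ D.A) u w x y z) := by
  have h : (fun p => D.A p (D.Γ p y z) x) =ᶠ[𝓝 u] fun p =>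
      1 / 2 * (fderiv ℝ D.A p y z x + fderiv ℝ D.A p z y x - fderiv ℝ D.A p x y z) := by
    filter_upwards [D.isOpen.mem_nhds hu] with p hp using A_Γ hp y z x
  have h1 := Filter.EventuallyEq.fderiv_eq (𝕜 := ℝ) h
  have hdA := ((contDiffAt_A hu).differentiableAt (by simp)).hasFDerivAt
  have h2 := (hdA.clm_apply (hasFDerivAt_Γ_base hu y z)).clm_apply (hasFDerivAt_const x u)
  have h3 : HasFDerivAt (fun p =>
      1 / 2 * (fderiv ℝ D.A p y z x + fderiv ℝ D.A p z y x - fderiv ℝ D.A p x y z)) _ u :=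
    (((hasFDerivAt_fderiv_A hu y z x).add (hasFDerivAt_fderiv_A hu z y x)).sub
    (hasFDerivAt_fderiv_A hu x y z)).const_mul (1 / 2 : ℝ)
  rw [h2.fderiv, h3.fderiv] at h1
  have h4 := DFunLike.congr_fun h1 w
  simpa [hN] using h4

lemma A_fderiv_S (hu : u ∈ D.U) (hN : fderiv ℝ D.A u = 0) (w y z : E) :
    D.A u (fderiv ℝ D.S u w y) z = 1 / 2 * (fderiv ℝ (fderiv ℝ D.b) u w y z
      - fderiv ℝ (fderiv ℝ D.b) u w z y) := by
  have h : (fun p => D.A p (D.S p y) z) =ᶠ[𝓝 u] fun p =>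
      1 / 2 * (fderiv ℝ D.b p y z - fderiv ℝ D.b p z y) := by
    filter_upwards [D.isOpen.mem_nhds hu] with p hp using A_S hp y z
  have h1 := Filter.EventuallyEq.fderiv_eq (𝕜 := ℝ) h
  have hdA := ((contDiffAt_A hu).differentiableAt (by simp)).hasFDerivAt
  have h2 := (hdA.clm_apply (hasFDerivAt_S_base hu y)).clm_apply (hasFDerivAt_const z u)
  have h3 : HasFDerivAt (fun p =>
      1 / 2 * (fderiv ℝ D.b p y z - fderiv ℝ D.b p z y)) _ u :=
    ((hasFDerivAt_fderiv_b hu y z).sub (hasFDerivAt_fderiv_b hu z y)).const_mul (1 / 2 : ℝ)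
  rw [h2.fderiv, h3.fderiv] at h1
  have h4 := DFunLike.congr_fun h1 w
  simpa [hN] using h4

lemma fderiv_r_normal (hu : u ∈ D.U) (hN : fderiv ℝ D.A u = 0) (w y z : E) :
    fderiv ℝ D.r u w y z = 1 / 2 * (fderiv ℝ (fderiv ℝ D.b) u w y z
      + fderiv ℝ (fderiv ℝ D.b) u w z y) - D.b u (fderiv ℝ D.Γ u w y z) := by
  have h : (fun p => D.r p y z) = fun p =>
      1 / 2 * (fderiv ℝ D.b p y z + fderiv ℝ D.b p z y) - D.b p (D.Γ p y z) := by
    funext p; exact r_apply y z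
  have hdb := ((contDiffAt_b hu).differentiableAt (by simp)).hasFDerivAt
  have h3 : HasFDerivAt (fun p =>
      1 / 2 * (fderiv ℝ D.b p y z + fderiv ℝ D.b p z y) - D.b p (D.Γ p y z)) _ u :=
    (((hasFDerivAt_fderiv_b hu y z).add (hasFDerivAt_fderiv_b hu z y)).const_mul (1 / 2 : ℝ)).sub
      (hdb.clm_apply (hasFDerivAt_Γ_base hu y z))
  have h1 := (hasFDerivAt_r_base hu y z).fderiv
  rw [h, h3.fderiv] at h1
  have h4 := DFunLike.congr_fun h1 w
  simp [Γ_eq_zero hu hN] at h4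
  rw [← h4]; ring

lemma fderiv_b_normal (hu : u ∈ D.U) (hN : fderiv ℝ D.A u = 0) (y z : E) :
    fderiv ℝ D.b u y z = D.r u y z + D.A u (D.S u y) z := by
  rw [r_apply, A_S hu, Γ_eq_zero hu hN]; simp; ring

lemma fderiv_s_apply (hu : u ∈ D.U) (w y : E) :
    fderiv ℝ D.s u w y = fderiv ℝ D.b u w (D.S u y) + D.b u (fderiv ℝ D.S u w y) := by
  have hdb := ((contDiffAt_b hu).differentiableAt (by simp)).hasFDerivAt
  have h1 : HasFDerivAt (fun p => D.s p y) _ u := hdb.clm_apply (hasFDerivAt_S_base hu y)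
  have h2 := DFunLike.congr_fun ((hasFDerivAt_s_base hu y).unique h1) w
  simp at h2
  rw [h2]; ring

lemma IsoAt.fderiv_r {σ : E → ℝ} (hu : u ∈ D.U) (hN : fderiv ℝ D.A u = 0)
    (hσ : DifferentiableAt ℝ σ u) (h : ∀ v ∈ D.U, D.IsoAt (σ v) v) (w y z : E) :
    fderiv ℝ D.r u w y z = 2 * fderiv ℝ σ u w * (D.A u y z - D.b u y * D.b u z)
      - 2 * σ u * (fderiv ℝ D.b u w y * D.b u z + D.b u y * fderiv ℝ D.b u w z)
      - fderiv ℝ D.b u w y * D.s u z - D.b u y * fderiv ℝ D.s u w z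
      - fderiv ℝ D.b u w z * D.s u y - D.b u z * fderiv ℝ D.s u w y := by
  have h0 : (fun p => D.r p y z) =ᶠ[𝓝 u] fun p =>
      2 * σ p * (D.A p y z - D.b p y * D.b p z) - (D.b p y * D.s p z + D.b p z * D.s p y) := by
    filter_upwards [D.isOpen.mem_nhds hu] with p hp
    linear_combination (h p hp).polar hp y z
  have h1 := Filter.EventuallyEq.fderiv_eq (𝕜 := ℝ) h0
  have hby := hasFDerivAt_b_base hu y
  have hbz := hasFDerivAt_b_base hu z
  have hsy := hasFDerivAt_s_base hu y
  have hsz := hasFDerivAt_s_base hu z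
  have h3 : HasFDerivAt (fun p => 2 * σ p * (D.A p y z - D.b p y * D.b p z)
      - (D.b p y * D.s p z + D.b p z * D.s p y)) _ u :=
    ((hσ.hasFDerivAt.const_mul 2).mul ((hasFDerivAt_A_base hu y z).sub (hby.mul hbz))).sub
      ((hby.mul hsz).add (hbz.mul hsy))
  rw [(hasFDerivAt_r_base hu y z).fderiv, h3.fderiv] at h1
  have h4 := DFunLike.congr_fun h1 w
  simp [hN] at h4
  rw [h4]; ring

/-- The function `σ` is smooth: it is determined by the metric and the one-form. -/
lemma contDiffAt_of_isoAt [Nontrivial E] {σ : E → ℝ} (h : ∀ v ∈ D.U, D.IsoAt (σ v) v)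
    (hu : u ∈ D.U) : ContDiffAt ℝ ∞ σ u := by
  obtain ⟨y, hy⟩ := exists_ne (0 : E)
  have h1 : σ =ᶠ[𝓝 u] fun v => (D.r v y y + 2 * D.b v y * D.s v y)
      / (2 * (D.A v y y - D.b v y ^ 2)) := by
    filter_upwards [D.isOpen.mem_nhds hu] with v hv
    have h2 := h v hv y
    have h3 := sub_pos.2 (D.sq_lt v hv y hy)
    rw [e] at h2
    rw [h2]; field_simp
  refine ContDiffAt.congr_of_eventuallyEq ?_ h1
  have cr := ((contDiffAt_r hu).clm_apply (contDiffAt_const (c := y))).clm_apply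
    (contDiffAt_const (c := y))
  have cA := ((contDiffAt_A hu).clm_apply (contDiffAt_const (c := y))).clm_apply
    (contDiffAt_const (c := y))
  have cb := (contDiffAt_b hu).clm_apply (contDiffAt_const (c := y))
  have cs := (contDiffAt_s hu).clm_apply (contDiffAt_const (c := y))
  exact (cr.add ((contDiffAt_const.mul cb).mul cs)).div
    (contDiffAt_const.mul (cA.sub (cb.pow 2)))
    (mul_ne_zero two_ne_zero (sub_pos.2 (D.sq_lt u hu y hy)).ne')

end Abstract

variable {n : ℕ} {D : LocalRanders (Coord n)} {u y : Coord n}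

/-- Frames that are orthonormal for the metric at a point. -/
lemma exists_frame (hu : u ∈ D.U) : ∃ f : Fin n → Coord n,
    (∀ i j, D.A u (f i) (f j) = if i = j then 1 else 0) ∧
    ∀ y, y = ∑ i, D.A u (f i) y • f i := by
  obtain ⟨B, hB⟩ := exists_conjTranspose_mul_self (aMat_posDef hu).posSemidef
  have hBdet : IsUnit B.det := by
    have h1 := (aMat_posDef hu).det_pos
    rw [hB, Matrix.det_mul, Matrix.det_conjTranspose] at h1
    refine isUnit_iff_ne_zero.2 fun h => ?_
    rw [h] at h1; simp at h1
  let f : Fin n → Coord n := fun i => WithLp.toLp 2 fun k => B⁻¹ k i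
  have hA : ∀ i z, D.A u (f i) z = B.mulVec z.ofLp i := by
    intro i z
    have h1 : D.A u (f i) z = ((aMat D u).mulVec (fun k => B⁻¹ k i)) ⬝ᵥ z.ofLp := by
      rw [← sum_bilin_single (D.A u) (f i) z, Finset.sum_comm]
      simp only [dotProduct, Matrix.mulVec, Finset.sum_mul]
      refine Finset.sum_congr rfl fun j _ => Finset.sum_congr rfl fun k _ => ?_
      simp only [aMat, Matrix.of_apply, f, D.symm u hu (EuclideanSpace.single j 1)]
    have h2 : (fun k => B⁻¹ k i) = B⁻¹.mulVec (Pi.single i 1) := by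
      ext k; simp
    rw [h1, h2, Matrix.mulVec_mulVec, hB, Matrix.mul_assoc, Matrix.mul_nonsing_inv _ hBdet,
      Matrix.mul_one]
    simp [Matrix.mulVec, dotProduct, Pi.single_apply]
  refine ⟨f, fun i j => ?_, fun y => ?_⟩
  · rw [hA]
    have h2 : (f j).ofLp = B⁻¹.mulVec (Pi.single j 1) := by ext k; simp [f]
    rw [h2, Matrix.mulVec_mulVec, Matrix.mul_nonsing_inv _ hBdet, Matrix.one_mulVec]
    simp [Pi.single_apply]
  · ext k
    have h3 : y.ofLp = B⁻¹.mulVec (B.mulVec y.ofLp) := by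
      rw [Matrix.mulVec_mulVec, Matrix.nonsing_inv_mul _ hBdet, Matrix.one_mulVec]
    conv_lhs => rw [h3]
    simp only [hA, f]
    rw [Matrix.mulVec, dotProduct]
    simp [mul_comm]

lemma tr_frame {f : Fin n → Coord n} (hf : ∀ y, y = ∑ i, D.A u (f i) y • f i)
    (L : Coord n →L[ℝ] Coord n) : tr _ L = ∑ i, D.A u (f i) (L (f i)) := by
  have h1 : L = ∑ i, ((D.A u (f i)) ∘L L).smulRight (f i) := by
    ext1 z
    rw [sum_apply]
    conv_lhs => rw [hf (L z)]
    rfl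
  conv_lhs => rw [h1]
  simp [map_sum, tr_smulRight]

lemma sum_frame {f : Fin n → Coord n} (hf : ∀ y, y = ∑ i, D.A u (f i) y • f i)
    (φ : Coord n →L[ℝ] ℝ) (y : Coord n) : ∑ i, φ (f i) * D.A u (f i) y = φ y := by
  conv_rhs => rw [hf y]
  simp [map_sum, mul_comm]

lemma ricForm_frame (hu : u ∈ D.U) (hN : fderiv ℝ D.A u = 0) {f : Fin n → Coord n}
    (hf : ∀ y, y = ∑ i, D.A u (f i) y • f i) (y z : Coord n) :
    D.ricForm u y z = ∑ i, 1 / 2 * (fderiv ℝ (fderiv ℝ D.A) u (f i) y z (f i)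
      + fderiv ℝ (fderiv ℝ D.A) u (f i) z y (f i) - fderiv ℝ (fderiv ℝ D.A) u (f i) (f i) y z
      - fderiv ℝ (fderiv ℝ D.A) u y z (f i) (f i)) := by
  rw [ricForm_apply, tr_frame hf, tr_frame hf, ← Finset.sum_sub_distrib]
  refine Finset.sum_congr rfl fun i _ => ?_
  simp only [ContinuousLinearMap.flip_apply]
  rw [D.symm u hu, A_fderiv_Γ hu hN, D.symm u hu, A_fderiv_Γ hu hN]
  ring

/-- On a surface the Ricci curvature is a multiple of the metric. -/
lemma ricForm_two {D : LocalRanders (Coord 2)} {u : Coord 2} (hu : u ∈ D.U)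
    (hN : fderiv ℝ D.A u = 0) : ∃ c : ℝ, ∀ y, D.ricForm u y y = c * D.A u y y := by
  obtain ⟨f, hf1, hf2⟩ := exists_frame hu
  set Q := fderiv ℝ (fderiv ℝ D.A) u with hQ
  refine ⟨Q (f 0) (f 1) (f 0) (f 1) - 1 / 2 * Q (f 1) (f 1) (f 0) (f 0)
    - 1 / 2 * Q (f 0) (f 0) (f 1) (f 1), fun y => ?_⟩
  have hy := hf2 y
  rw [Fin.sum_univ_two] at hy
  have h00 : D.A u (f 0) (f 0) = 1 := by simp [hf1]
  have h01 : D.A u (f 0) (f 1) = 0 := by simp [hf1]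
  have h10 : D.A u (f 1) (f 0) = 0 := by simp [hf1]
  have h11 : D.A u (f 1) (f 1) = 1 := by simp [hf1]
  rw [ricForm_frame hu hN hf2, Fin.sum_univ_two]
  generalize D.A u (f 0) y = a at hy
  generalize D.A u (f 1) y = b at hy
  have c1 : ∀ y z, Q (f 1) (f 0) y z = Q (f 0) (f 1) y z := fun y z => fderiv2_A_comm hu _ _ _ _
  have c2 : ∀ w v, Q w v (f 1) (f 0) = Q w v (f 0) (f 1) := fun w v => fderiv2_A_symm hu _ _ _ _
  rw [hy]
  simp only [← hQ, map_add, map_smul, add_apply, smul_apply, smul_eq_mul, c1, c2, h00, h01, h10,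
    h11]
  ring

lemma A_S_S_two {D : LocalRanders (Coord 2)} {u : Coord 2} (hu : u ∈ D.U) :
    ∃ c : ℝ, ∀ y, D.A u (D.S u y) (D.S u y) = c * D.A u y y := by
  obtain ⟨f, hf1, hf2⟩ := exists_frame hu
  refine ⟨D.A u (f 1) (D.S u (f 0)) ^ 2, fun y => ?_⟩
  have hy := hf2 y
  have h0 := hf2 (D.S u (f 0))
  have h1 := hf2 (D.S u (f 1))
  rw [Fin.sum_univ_two] at hy h0 h1
  have h00 : D.A u (f 0) (f 0) = 1 := by simp [hf1]
  have h01 : D.A u (f 0) (f 1) = 0 := by simp [hf1]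
  have h10 : D.A u (f 1) (f 0) = 0 := by simp [hf1]
  have h11 : D.A u (f 1) (f 1) = 1 := by simp [hf1]
  have k0 : D.A u (f 0) (D.S u (f 0)) = 0 := by rw [D.symm u hu, A_S_self hu]
  have k1 : D.A u (f 1) (D.S u (f 1)) = 0 := by rw [D.symm u hu, A_S_self hu]
  have k2 : D.A u (f 0) (D.S u (f 1)) = - D.A u (f 1) (D.S u (f 0)) := by
    rw [D.symm u hu, A_skew hu, D.symm u hu (f 1)]
  rw [k0] at h0
  rw [k1, k2] at h1
  generalize D.A u (f 1) (D.S u (f 0)) = c at *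
  generalize D.A u (f 0) y = a at hy
  generalize D.A u (f 1) y = b at hy
  rw [hy, map_add, map_smul, map_smul, h0, h1]
  simp only [map_add, map_smul, add_apply, smul_apply, smul_eq_mul, h00, h01, h10, h11]
  ring

/-- The contribution of the projective factor to the Ricci curvature is polynomial in `α` and `y`
when the S-curvature is isotropic. -/
lemma projective_term {α β σ σ₀ s s₁ t₀ N R₃ q : ℝ} (hF : α + β ≠ 0)
    (hN : N = 2 * (α + β) * (σ * (α - β) - s))
    (hR : R₃ = 2 * σ₀ * (α ^ 2 - β ^ 2) - 4 * σ * β * (2 * σ * (α ^ 2 - β ^ 2) - 2 * β * s)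
      - 2 * (2 * σ * (α ^ 2 - β ^ 2) - 2 * β * s) * s - 2 * β * s₁)
    (hq : q = - β * t₀ - s ^ 2 - 2 * σ * β * s) :
    3 * N ^ 2 / (4 * (α + β) ^ 2)
      - (R₃ - 4 * α * q - 2 * α * (s₁ - 2 * α * t₀)) / (2 * (α + β))
    = (3 * σ ^ 2 * α ^ 2 - σ ^ 2 * β ^ 2 + s ^ 2 + σ₀ * β + s₁)
      + α * (-2 * t₀ - 2 * σ ^ 2 * β - 4 * σ * s - σ₀) := by
  rw [hN, hR, hq]
  field_simp
  ring

/-- With isotropic S-curvature, the Ricci curvature is the sum of a quadratic form in `y` and of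
`α` times a linear form. -/
lemma ricci_isotropic (hu : u ∈ D.U) (hN : fderiv ℝ D.A u = 0) {σ : Coord n → ℝ}
    (hσ : DifferentiableAt ℝ σ u) (hiso : ∀ v ∈ D.U, D.IsoAt (σ v) v) (hy : y ≠ 0) :
    ricci D.F u y = D.ricForm u y y - 2 * D.A u y (D.S u (D.S u y))
      - D.A u y y * tr _ (D.S u ∘L D.S u)
      + (n - 1) * (3 * σ u ^ 2 * D.A u y y - σ u ^ 2 * D.b u y ^ 2 + D.s u y ^ 2
        + fderiv ℝ σ u y * D.b u y + fderiv ℝ D.s u y y)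
      + D.α u y * (2 * D.divS u y + (n - 1) * (-2 * D.s u (D.S u y) - 2 * σ u ^ 2 * D.b u y
        - 4 * σ u * D.s u y - fderiv ℝ σ u y)) := by
  have hF := (F_pos hu hy).ne'
  have hr := (hiso u hu).polar hu y y
  have hb : fderiv ℝ D.b u y y = 2 * σ u * (D.α u y ^ 2 - D.b u y ^ 2)
      - 2 * D.b u y * D.s u y := by
    rw [fderiv_b_normal hu hN, A_S_self hu, α_sq hu]; linear_combination hr
  have hq : D.r u y (D.S u y) = - D.b u y * D.s u (D.S u y) - D.s u y ^ 2
      - 2 * σ u * D.b u y * D.s u y := by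
    have h1 := (hiso u hu).polar hu y (D.S u y)
    rw [D.symm u hu y, A_S_self hu] at h1
    have h2 : D.b u (D.S u y) = D.s u y := rfl
    rw [h2] at h1
    linear_combination h1
  have hR : fderiv ℝ D.r u y y y = 2 * fderiv ℝ σ u y * (D.α u y ^ 2 - D.b u y ^ 2)
      - 4 * σ u * D.b u y * (2 * σ u * (D.α u y ^ 2 - D.b u y ^ 2) - 2 * D.b u y * D.s u y)
      - 2 * (2 * σ u * (D.α u y ^ 2 - D.b u y ^ 2) - 2 * D.b u y * D.s u y) * D.s u y
      - 2 * D.b u y * fderiv ℝ D.s u y y := by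
    rw [IsoAt.fderiv_r hu hN hσ hiso, ← hb, α_sq hu]; ring
  have := projective_term (α := D.α u y) (β := D.b u y) hF ((hiso u hu).N_eq hu y) hR hq
  rw [ricci_normal hu hN hy, ← ricForm_self, Ndot]
  have e8 : D.F u y = D.α u y + D.b u y := rfl
  rw [e8, this, α_sq hu]
  ring

/-- The even and the odd part of the soliton equation. -/
theorem SolitonAt.even_odd (hu : u ∈ D.U) (hN : fderiv ℝ D.A u = 0) {σ : Coord n → ℝ}
    (hσ : DifferentiableAt ℝ σ u) (hiso : ∀ v ∈ D.U, D.IsoAt (σ v) v)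
    {V : Coord n → Coord n} (hV : DifferentiableAt ℝ V u) {κ : ℝ} (h : D.SolitonAt V κ u)
    (y : Coord n) :
    (2 * (D.ricForm u y y - 2 * D.A u y (D.S u (D.S u y))
      - D.A u y y * tr _ (D.S u ∘L D.S u)
      + (n - 1) * (3 * σ u ^ 2 * D.A u y y - σ u ^ 2 * D.b u y ^ 2 + D.s u y ^ 2
        + fderiv ℝ σ u y * D.b u y + fderiv ℝ D.s u y y))
      + D.lieA V u y + 2 * D.b u y * D.lieB V u y = 2 * κ * (D.A u y y + D.b u y ^ 2)) ∧
    (D.A u y y * (2 * (2 * D.divS u y + (n - 1) * (-2 * D.s u (D.S u y) - 2 * σ u ^ 2 * D.b u y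
        - 4 * σ u * D.s u y - fderiv ℝ σ u y)) + 2 * D.lieB V u y - 4 * κ * D.b u y)
      + D.b u y * D.lieA V u y = 0) := by
  by_cases hy : y = 0
  · simp [hy, lieA]
  have hy' : -y ≠ 0 := neg_ne_zero.2 hy
  have hα := α_pos hu hy
  have h₁ := h y hy
  have h₂ := h (-y) hy'
  rw [ricci_isotropic hu hN hσ hiso hy, lieLift_sqFun hu hy hV] at h₁
  rw [ricci_isotropic hu hN hσ hiso hy', lieLift_sqFun hu hy' hV] at h₂
  have hW : D.lieA V u (-y) = D.lieA V u y := by simp [lieA]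
  simp only [F, α_neg, map_neg, neg_apply, neg_neg, divS_neg, hW] at h₁ h₂
  have ha := α_sq hu y
  rw [← ha] at h₁ h₂ ⊢
  have hWα : D.lieA V u y = 2 * D.α u y * (D.lieA V u y / (2 * D.α u y)) := by field_simp
  generalize D.lieA V u y / (2 * D.α u y) = W at *
  constructor
  · rw [hWα]; linear_combination (1 / 2 : ℝ) * (h₁ + h₂)
  · rw [hWα]; linear_combination (1 / 2 : ℝ) * D.α u y * (h₁ - h₂)

/-- Where the one-form does not vanish, the odd part of the soliton equation shows that the vector
field is conformal for the Riemannian metric. -/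
theorem SolitonAt.conformal_of_ne (hu : u ∈ D.U) (hN : fderiv ℝ D.A u = 0) {σ : Coord n → ℝ}
    (hσ : DifferentiableAt ℝ σ u) (hiso : ∀ v ∈ D.U, D.IsoAt (σ v) v)
    {V : Coord n → Coord n} (hV : DifferentiableAt ℝ V u) {κ : ℝ} (h : D.SolitonAt V κ u)
    (hX : D.X u ≠ 0) : ∃ c : ℝ, ∀ y, D.lieA V u y = c * D.A u y y := by
  let ℓ : Coord n →L[ℝ] ℝ := (4 : ℝ) • (tr _ ∘L (fderiv ℝ D.S u).flip)
    + (2 * ((n : ℝ) - 1)) • ((-2 : ℝ) • (D.s u ∘L D.S u) - (2 * σ u ^ 2) • D.b u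
      - (4 * σ u) • D.s u - fderiv ℝ σ u) + (2 : ℝ) • D.lieB V u - (4 * κ) • D.b u
  have key : ∀ y, D.A u y y * ℓ y + D.b u y * D.lieA V u y = 0 := by
    intro y
    have := (h.even_odd hu hN hσ hiso hV y).2
    rw [← this]
    simp only [ℓ, divS, add_apply, sub_apply, smul_apply, smul_eq_mul,
      ContinuousLinearMap.comp_apply]
    ring
  have hbX : D.b u (D.X u) ≠ 0 := by rw [← A_X hu]; exact (D.pos u hu _ hX).ne'
  have hker : ∀ v, D.b u v = 0 → ℓ v = 0 := by
    intro v hv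
    by_cases hv0 : v = 0
    · simp [hv0]
    have := key v
    rw [hv, zero_mul, add_zero] at this
    exact (mul_eq_zero.1 this).resolve_left (D.pos u hu v hv0).ne'
  set μ : ℝ := ℓ (D.X u) / D.b u (D.X u) with hμ
  have hℓ : ∀ y, ℓ y = μ * D.b u y := by
    intro y
    have := hker (y - (D.b u y / D.b u (D.X u)) • D.X u) (by simp; field_simp; ring)
    simp only [map_sub, map_smul, smul_eq_mul] at this
    rw [hμ]; field_simp at this ⊢; linarith
  have hne : ∀ y, D.b u y ≠ 0 → D.lieA V u y = - μ * D.A u y y := by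
    intro y hy
    have := key y
    rw [hℓ] at this
    have h2 : D.b u y * (D.lieA V u y + μ * D.A u y y) = 0 := by linear_combination this
    linarith [(mul_eq_zero.1 h2).resolve_left hy]
  refine ⟨-μ, fun v => ?_⟩
  by_cases hv : D.b u v = 0
  · -- the parallelogram identity reduces the kernel of `b` to its complement
    have h1 := hne (D.X u + v) (by rw [map_add, hv, add_zero]; exact hbX)
    have h2 := hne (D.X u - v) (by rw [map_sub, hv, sub_zero]; exact hbX)
    have h3 := hne (D.X u) hbX
    simp only [lieA, map_add, map_sub, add_apply, sub_apply] at h1 h2 h3 ⊢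
    linear_combination (1 / 2 : ℝ) * (h1 + h2) - h3
  · exact hne v hv

/-- On a surface, the vector field is conformal also at the zeros of the one-form. -/
theorem SolitonAt.conformal_two {D : LocalRanders (Coord 2)} {u : Coord 2} (hu : u ∈ D.U)
    (hN : fderiv ℝ D.A u = 0) {σ : Coord 2 → ℝ}
    (hσ : DifferentiableAt ℝ σ u) (hiso : ∀ v ∈ D.U, D.IsoAt (σ v) v)
    {V : Coord 2 → Coord 2} (hV : DifferentiableAt ℝ V u) {κ : ℝ} (h : D.SolitonAt V κ u)
    (hX : D.X u = 0) : ∃ c : ℝ, ∀ y, D.lieA V u y = c * D.A u y y := by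
  obtain ⟨c₁, hc₁⟩ := ricForm_two hu hN
  obtain ⟨c₂, hc₂⟩ := A_S_S_two hu
  have hb : ∀ z, D.b u z = 0 := by intro z; rw [← A_X hu, hX]; simp
  refine ⟨2 * κ - 2 * (c₁ + 2 * c₂ - tr _ (D.S u ∘L D.S u) + 3 * σ u ^ 2 + c₂), fun y => ?_⟩
  have h1 := (h.even_odd hu hN hσ hiso hV y).1
  have hs : ∀ z, D.s u z = 0 := fun z => hb _
  have h2 : D.A u y (D.S u (D.S u y)) = - (c₂ * D.A u y y) := by
    rw [D.symm u hu, A_skew hu, hc₂]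
  have h3 : fderiv ℝ D.s u y y = c₂ * D.A u y y := by
    have h4 := (hiso u hu).polar hu y (D.S u y)
    rw [hb, hb, D.symm u hu y, A_S_self hu] at h4
    rw [fderiv_s_apply hu, hb, fderiv_b_normal hu hN, hc₂]
    linear_combination h4
  rw [hb, hs, hc₁, h2, h3] at h1
  push_cast at h1
  linear_combination h1

end LocalRanders

/-! ### Constancy of the S-curvature -/

namespace LocalRanders

section Abstract

variable {E : Type*} [NormedAddCommGroup E] [NormedSpace ℝ E] [FiniteDimensional ℝ E]
variable {D : LocalRanders E} {u : E}

/-- The one-form `s + 2 σ b` is closed, since it equals `-½ d log (1 - ‖β‖²)`. -/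
lemma fderiv_s_antisymm (hu : u ∈ D.U) {σ : E → ℝ}
    (hσ : DifferentiableAt ℝ σ u) (hiso : ∀ v ∈ D.U, D.IsoAt (σ v) v) (w y : E) :
    fderiv ℝ D.s u w y - fderiv ℝ D.s u y w
      = - 2 * (fderiv ℝ σ u w * D.b u y - fderiv ℝ σ u y * D.b u w)
        - 2 * σ u * (fderiv ℝ D.b u w y - fderiv ℝ D.b u y w) := by
  have hb : ∀ v ∈ D.U, 1 - D.bsq v ≠ 0 := fun v hv => (sub_pos.2 (bsq_lt_one hv)).ne'
  have hφ : ContDiffAt ℝ ∞ (fun v => - Real.log (1 - D.bsq v)) u :=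
    ((contDiffAt_const.sub (contDiffAt_bsq hu)).log (hb u hu)).neg
  have hφ' : ∀ v ∈ D.U, ∀ z, fderiv ℝ (fun v => - Real.log (1 - D.bsq v)) v z
      = 2 * D.s v z + 4 * σ v * D.b v z := by
    intro v hv z
    have h1 := ((contDiffAt_bsq hv).differentiableAt (by simp)).hasFDerivAt
    have h2 : HasFDerivAt (fun v => - Real.log (1 - D.bsq v)) _ v :=
      ((h1.const_sub 1).log (hb v hv)).neg
    rw [h2.fderiv]
    simp only [neg_apply, smul_apply, smul_eq_mul, (hiso v hv).fderiv_bsq hv]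
    have := hb v hv
    field_simp
    ring
  have hsym := (hφ.isSymmSndFDerivAt (by
    simpa using (WithTop.coe_le_coe.2 (le_top : (2 : ℕ∞) ≤ ⊤) : ((2 : ℕ∞) : WithTop ℕ∞) ≤ _))) w y
  have h2 : ∀ w z, fderiv ℝ (fderiv ℝ (fun v => - Real.log (1 - D.bsq v))) u w z
      = 2 * fderiv ℝ D.s u w z + 4 * fderiv ℝ σ u w * D.b u z + 4 * σ u * fderiv ℝ D.b u w z := by
    intro w z
    have hd := ((hφ.fderiv_right (m := ∞) (by simp)).differentiableAt (by simp)).hasFDerivAt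
    have h3 := hd.clm_apply (hasFDerivAt_const z u)
    have h4 : (fun v => fderiv ℝ (fun v => - Real.log (1 - D.bsq v)) v z) =ᶠ[𝓝 u]
        fun v => 2 * D.s v z + 4 * σ v * D.b v z := by
      filter_upwards [D.isOpen.mem_nhds hu] with v hv using hφ' v hv z
    have h5 := Filter.EventuallyEq.fderiv_eq (𝕜 := ℝ) h4
    have h6 : HasFDerivAt (fun v => 2 * D.s v z + 4 * σ v * D.b v z) _ u :=
      ((hasFDerivAt_s_base hu z).const_mul 2).add
        ((hσ.hasFDerivAt.const_mul 4).mul (hasFDerivAt_b_base hu z))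
    rw [h3.fderiv, h6.fderiv] at h5
    have h7 := DFunLike.congr_fun h5 w
    simp at h7
    rw [h7]; ring
  rw [h2, h2] at hsym
  linear_combination (1 / 2 : ℝ) * hsym

end Abstract

variable {n : ℕ} {D : LocalRanders (Coord n)} {u y : Coord n}

/-- The contracted Ricci identity `b^i_{|j|i} - b^i_{|i|j} = Ric_{jm} b^m` for the one-form, with
`b_{i|j}` split into its symmetric and antisymmetric parts. -/
lemma divS_eq (hu : u ∈ D.U) (hN : fderiv ℝ D.A u = 0) {f : Fin n → Coord n}
    (hf : ∀ y, y = ∑ i, D.A u (f i) y • f i) (y : Coord n) :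
    D.divS u y = D.ricForm u (D.X u) y - ∑ i, fderiv ℝ D.r u (f i) (f i) y
      + ∑ i, fderiv ℝ D.r u y (f i) (f i) := by
  have hb : ∀ w y z, D.b u (fderiv ℝ D.Γ u w y z) =
      1 / 2 * (fderiv ℝ (fderiv ℝ D.A) u w y z (D.X u)
        + fderiv ℝ (fderiv ℝ D.A) u w z y (D.X u)
        - fderiv ℝ (fderiv ℝ D.A) u w (D.X u) y z) := by
    intro w y z
    rw [← A_X hu, D.symm u hu, A_fderiv_Γ hu hN]
  rw [divS, tr_frame hf, ricForm_frame hu hN hf, ← Finset.sum_sub_distrib,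
    ← Finset.sum_add_distrib]
  refine Finset.sum_congr rfl fun i _ => ?_
  rw [ContinuousLinearMap.flip_apply, D.symm u hu, A_fderiv_S hu hN, fderiv_r_normal hu hN,
    fderiv_r_normal hu hN, hb, hb]
  have q1 := fderiv2_b_comm hu y (f i) (f i)
  have q2 := fderiv2_A_comm hu y (f i) (f i) (D.X u)
  have q3 := fderiv2_A_comm hu y (D.X u) (f i) (f i)
  have q4 := fderiv2_A_symm hu (f i) y (f i) (D.X u)
  have q5 := fderiv2_A_symm hu (f i) (D.X u) y (f i)
  have q6 := fderiv2_A_symm hu (f i) (f i) y (D.X u)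
  linear_combination (-1 : ℝ) * q1 + q2 - (1 / 2 : ℝ) * q3 + (1 / 2 : ℝ) * q4 - (1 / 2 : ℝ) * q5
    - (1 / 2 : ℝ) * q6

/-- If the soliton field is conformal for `F`, then `F` is an Einstein metric and its isotropic
S-curvature is constant: the differential of `σ` vanishes. This is obtained by comparing the two
expressions for `sⁱ_{j|i}` given by the odd part of the Einstein equation and by the contracted
Ricci identity, in which the Ricci curvature of `α` is known from the even part. -/
theorem SolitonAt.fderiv_sigma_eq_zero (hn : 2 ≤ n) (hu : u ∈ D.U) (hN : fderiv ℝ D.A u = 0)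
    {σ : Coord n → ℝ} (hσ : DifferentiableAt ℝ σ u) (hiso : ∀ v ∈ D.U, D.IsoAt (σ v) v)
    {V : Coord n → Coord n} (hV : DifferentiableAt ℝ V u) {κ c : ℝ} (h : D.SolitonAt V κ u)
    (hcA : ∀ y, D.lieA V u y = 4 * c * D.A u y y) (hcB : ∀ y, D.lieB V u y = 2 * c * D.b u y) :
    fderiv ℝ σ u = 0 := by
  have hk : ((n : ℝ) - 1) ≠ 0 := by
    have : (2 : ℝ) ≤ n := by exact_mod_cast hn
    linarith
  obtain ⟨f, hf1, hf⟩ := exists_frame hu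
  -- the vector dual to the one-form `s`
  set T : Coord n := - D.S u (D.X u) with hT
  have hAT : ∀ z, D.A u T z = D.s u z := by
    intro z
    rw [hT, map_neg, neg_apply, A_skew hu, neg_neg, D.symm u hu, A_X hu, s_apply]
  have hAX := A_X hu
  have iso := (hiso u hu).polar hu
  have hDb := fderiv_b_normal hu hN
  have hsX := s_X hu
  have hbT : D.b u T = 0 := by rw [← hAX, D.symm u hu, hAT, hsX]
  have hbS : ∀ z, D.b u (D.S u z) = D.s u z := fun z => rfl
  have hsST : ∀ z, D.A u (D.S u T) z = - D.s u (D.S u z) := by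
    intro z; rw [A_skew hu, D.symm u hu, hAT]
  have hX2 : D.b u (D.X u) = D.bsq u := rfl
  ext1 y
  rw [zero_apply]
  -- scalar consequences of the equation for `r_ij`
  have rX : D.r u y (D.X u) = 2 * σ u * D.b u y * (1 - D.bsq u) - D.bsq u * D.s u y := by
    have := iso y (D.X u)
    rw [hsX, D.symm u hu y, hAX, hX2] at this
    linear_combination this
  have bX : fderiv ℝ D.b u y (D.X u) = D.r u y (D.X u) + D.s u y := by
    rw [hDb, D.symm u hu, hAX, hbS]
  have bX' : fderiv ℝ D.b u (D.X u) y = D.r u y (D.X u) - D.s u y := by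
    rw [hDb, r_symm hu, A_skew hu, D.symm u hu, hAX, hbS]; ring
  have rT : D.r u y T = 2 * σ u * D.s u y - D.b u y * D.s u T := by
    have := iso y T
    rw [hbT, D.symm u hu y, hAT] at this
    linear_combination this
  have bT : fderiv ℝ D.b u T y = 2 * σ u * D.s u y - D.b u y * D.s u T - D.s u (D.S u y) := by
    rw [hDb, r_symm hu, rT, hsST]; ring
  have bT' : fderiv ℝ D.b u y T = 2 * σ u * D.s u y - D.b u y * D.s u T + D.s u (D.S u y) := by
    rw [hDb, rT, D.symm u hu, hAT]
  have sTX : D.s u (D.S u (D.X u)) = - D.s u T := by rw [hT, map_neg, neg_neg]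
  -- differentiating `s(X) = 0`
  have sX' : fderiv ℝ D.s u y (D.X u) = - fderiv ℝ D.b u y T := by
    have hds := ((contDiffAt_s hu).differentiableAt (by simp)).hasFDerivAt
    have hdX := ((contDiffAt_X hu).differentiableAt (by simp)).hasFDerivAt
    have h1 : (fun v => D.s v (D.X v)) =ᶠ[𝓝 u] fun _ => (0 : ℝ) := by
      filter_upwards [D.isOpen.mem_nhds hu] with v hv using s_X hv
    have h2 := Filter.EventuallyEq.fderiv_eq (𝕜 := ℝ) h1
    rw [(hds.clm_apply hdX).fderiv] at h2
    have h3 := DFunLike.congr_fun h2 y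
    simp at h3
    have h4 := fderiv_A_X hu y T
    rw [hN, zero_apply, zero_apply, zero_apply, zero_add, D.symm u hu, hAT] at h4
    linarith
  have closed := fderiv_s_antisymm hu hσ hiso (D.X u) y
  -- contractions
  have cA : ∀ φ : Coord n →L[ℝ] ℝ, ∑ i, φ (f i) * D.A u (f i) y = φ y :=
    fun φ => sum_frame hf φ y
  have cb : ∀ φ : Coord n →L[ℝ] ℝ, ∑ i, φ (f i) * D.b u (f i) = φ (D.X u) := by
    intro φ
    rw [← sum_frame hf φ (D.X u)]
    exact Finset.sum_congr rfl fun i _ => by rw [D.symm u hu, hAX]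
  have cs : ∀ φ : Coord n →L[ℝ] ℝ, ∑ i, φ (f i) * D.s u (f i) = φ T := by
    intro φ
    rw [← sum_frame hf φ T]
    exact Finset.sum_congr rfl fun i _ => by rw [D.symm u hu, hAT]
  have cone : ∑ i, D.A u (f i) (f i) = n := by simp [hf1]
  have divb : ∑ i, fderiv ℝ D.b u (f i) (f i) = 2 * σ u * (n - D.bsq u) := by
    have h1 : ∀ i, fderiv ℝ D.b u (f i) (f i) = 2 * σ u * (D.A u (f i) (f i))
        - 2 * σ u * (D.b u (f i) * D.b u (f i)) - 2 * (D.s u (f i) * D.b u (f i)) := by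
      intro i
      rw [hDb, A_S_self hu]
      linear_combination iso (f i) (f i)
    simp only [h1, Finset.sum_sub_distrib, ← Finset.mul_sum, cone, cb, hsX, hX2]
    ring
  have divs : ∑ i, fderiv ℝ D.s u (f i) (f i) = - tr _ (D.S u ∘L D.S u) - D.divS u (D.X u) := by
    have h1 : ∀ i, fderiv ℝ D.s u (f i) (f i) = - (D.s u ∘L D.S u) (f i) * D.b u (f i)
        - D.s u (f i) * D.s u (f i) - 2 * σ u * (D.s u (f i) * D.b u (f i))
        - D.A u (f i) ((D.S u ∘L D.S u) (f i))
        - D.A u (f i) (((fderiv ℝ D.S u).flip (D.X u)) (f i)) := by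
      intro i
      have h2 := iso (f i) (D.S u (f i))
      rw [D.symm u hu (f i), A_S_self hu, hbS] at h2
      have h3 : D.b u (fderiv ℝ D.S u (f i) (f i))
          = - D.A u (f i) (fderiv ℝ D.S u (f i) (D.X u)) := by
        rw [← hAX, D.symm u hu, A_fderiv_S hu hN, D.symm u hu (f i), A_fderiv_S hu hN]; ring
      have h4 : D.A u (D.S u (f i)) (D.S u (f i)) = - D.A u (f i) (D.S u (D.S u (f i))) := by
        rw [A_skew hu, D.symm u hu]
      rw [fderiv_s_apply hu, h3, hDb, h4]
      simp only [ContinuousLinearMap.comp_apply, ContinuousLinearMap.flip_apply]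
      linear_combination h2
    simp only [h1, Finset.sum_sub_distrib, ← Finset.mul_sum, cs, cb, hsX, neg_mul,
      Finset.sum_neg_distrib, ContinuousLinearMap.comp_apply (D.s u)]
    rw [divS, tr_frame hf, tr_frame hf]
    simp only [ContinuousLinearMap.comp_apply, ContinuousLinearMap.flip_apply]
    have := cb (D.s u ∘L D.S u)
    simp only [ContinuousLinearMap.comp_apply, sTX] at this
    rw [this]
    ring
  have R1 : ∑ i, fderiv ℝ D.r u (f i) (f i) y = 2 * fderiv ℝ σ u y
      - 2 * fderiv ℝ σ u (D.X u) * D.b u y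
      - 2 * σ u * (2 * σ u * (n - D.bsq u) * D.b u y + fderiv ℝ D.b u (D.X u) y)
      - 2 * σ u * (n - D.bsq u) * D.s u y - fderiv ℝ D.s u (D.X u) y - fderiv ℝ D.b u T y
      - D.b u y * (- tr _ (D.S u ∘L D.S u) - D.divS u (D.X u)) := by
    have h1 : ∀ i, fderiv ℝ D.r u (f i) (f i) y =
        2 * (fderiv ℝ σ u (f i) * D.A u (f i) y) - 2 * D.b u y * (fderiv ℝ σ u (f i) * D.b u (f i))
        - 2 * σ u * D.b u y * fderiv ℝ D.b u (f i) (f i)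
        - 2 * σ u * ((fderiv ℝ D.b u).flip y (f i) * D.b u (f i))
        - D.s u y * fderiv ℝ D.b u (f i) (f i) - (fderiv ℝ D.s u).flip y (f i) * D.b u (f i)
        - (fderiv ℝ D.b u).flip y (f i) * D.s u (f i)
        - D.b u y * fderiv ℝ D.s u (f i) (f i) := by
      intro i
      rw [IsoAt.fderiv_r hu hN hσ hiso]
      simp only [ContinuousLinearMap.flip_apply]; ring
    simp only [h1, Finset.sum_sub_distrib, ← Finset.mul_sum, cA, cb, cs, divb, divs]
    simp only [ContinuousLinearMap.flip_apply]
    ring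
  have R2 : ∑ i, fderiv ℝ D.r u y (f i) (f i) = 2 * fderiv ℝ σ u y * (n - D.bsq u)
      - 4 * σ u * fderiv ℝ D.b u y (D.X u) := by
    have h1 : ∀ i, fderiv ℝ D.r u y (f i) (f i) =
        2 * fderiv ℝ σ u y * D.A u (f i) (f i) - 2 * fderiv ℝ σ u y * (D.b u (f i) * D.b u (f i))
        - 4 * σ u * (fderiv ℝ D.b u y (f i) * D.b u (f i))
        - 2 * (fderiv ℝ D.b u y (f i) * D.s u (f i))
        - 2 * (fderiv ℝ D.s u y (f i) * D.b u (f i)) := by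
      intro i
      rw [IsoAt.fderiv_r hu hN hσ hiso]; ring
    simp only [h1, Finset.sum_sub_distrib, ← Finset.mul_sum, cone, cb, cs, hX2, sX']
    ring
  have comm := divS_eq hu hN hf y
  rw [R1, R2] at comm
  -- the Einstein equation, split and evaluated at `y` and at `X`
  have ev : ∀ z, D.ricForm u z z - 2 * D.A u z (D.S u (D.S u z))
      - D.A u z z * tr _ (D.S u ∘L D.S u)
      + (n - 1) * (3 * σ u ^ 2 * D.A u z z - σ u ^ 2 * D.b u z ^ 2 + D.s u z ^ 2
        + fderiv ℝ σ u z * D.b u z + fderiv ℝ D.s u z z)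
      = (κ - 2 * c) * (D.A u z z + D.b u z ^ 2) := by
    intro z
    have := (h.even_odd hu hN hσ hiso hV z).1
    rw [hcA, hcB] at this
    linear_combination (1 / 2 : ℝ) * this
  have od : ∀ z, 2 * D.divS u z + (n - 1) * (-2 * D.s u (D.S u z) - 2 * σ u ^ 2 * D.b u z
        - 4 * σ u * D.s u z - fderiv ℝ σ u z) = 2 * (κ - 2 * c) * D.b u z := by
    intro z
    by_cases hz : z = 0
    · simp [hz, divS]
    have := (h.even_odd hu hN hσ hiso hV z).2
    rw [hcA, hcB] at this
    have h2 : D.A u z z * (2 * D.divS u z + (n - 1) * (-2 * D.s u (D.S u z)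
        - 2 * σ u ^ 2 * D.b u z - 4 * σ u * D.s u z - fderiv ℝ σ u z)
        - 2 * (κ - 2 * c) * D.b u z) = 0 := by linear_combination (1 / 2 : ℝ) * this
    linarith [(mul_eq_zero.1 h2).resolve_left (D.pos u hu z hz).ne']
  have ricsymm : D.ricForm u y (D.X u) = D.ricForm u (D.X u) y := by
    rw [ricForm_frame hu hN hf, ricForm_frame hu hN hf]
    refine Finset.sum_congr rfl fun i _ => ?_
    rw [fderiv2_A_symm hu (f i) (f i) y, fderiv2_A_comm hu y]
    ring
  have evp : 2 * D.ricForm u (D.X u) y - 4 * D.s u (D.S u y)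
      - 2 * D.b u y * tr _ (D.S u ∘L D.S u)
      + (n - 1) * (6 * σ u ^ 2 * D.b u y - 2 * σ u ^ 2 * D.bsq u * D.b u y
        + fderiv ℝ σ u y * D.bsq u + fderiv ℝ σ u (D.X u) * D.b u y
        + fderiv ℝ D.s u (D.X u) y + fderiv ℝ D.s u y (D.X u))
      = 2 * (κ - 2 * c) * D.b u y * (1 + D.bsq u) := by
    have e1 := ev (y + D.X u)
    have e2 := ev y
    have e3 := ev (D.X u)
    have a1 : D.A u (D.X u) (D.S u (D.S u y)) = D.s u (D.S u y) := by rw [hAX, hbS]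
    have a2 : D.A u y (D.S u (D.S u (D.X u))) = D.s u (D.S u y) := by
      rw [D.symm u hu, A_skew hu, D.symm u hu, ← hAT (D.S u y), hT, map_neg, neg_apply]
    have a3 : D.A u y (D.X u) = D.b u y := by rw [D.symm u hu, hAX]
    simp only [map_add, add_apply, a1, a2, a3, hAX, hsX, hX2, ricsymm] at e1 e2 e3
    linear_combination e1 - e2 - e3
  have odX := od (D.X u)
  have ody := od y
  rw [sTX, hsX, hX2] at odX
  rw [sX', bT'] at evp
  rw [bX, bX', rX, bT] at comm
  rw [sX', bT', bX, bX', rX, hX2] at closed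
  -- this combination eliminates `sⁱ_{j|i}`, the Ricci curvature of `α` and the derivative
  -- of `s` along `X`
  have hfin : ((n : ℝ) - 1) * (1 - D.bsq u) * fderiv ℝ σ u y = 0 := by
    linear_combination -(2 / 3 : ℝ) * comm + (1 / 3 : ℝ) * ody - (1 / 3 : ℝ) * evp
      + (1 / 3 : ℝ) * D.b u y * odX - ((2 : ℝ) / 3 - (n - 1) / 3) * closed
  have hb : 1 - D.bsq u ≠ 0 := (sub_pos.2 (bsq_lt_one hu)).ne'
  exact (mul_eq_zero.1 hfin).resolve_left (mul_ne_zero hk hb)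

end LocalRanders

/-! ### Constancy of the conformal factor -/

namespace LocalRanders

section Abstract

variable {E : Type*} [NormedAddCommGroup E] [NormedSpace ℝ E] [FiniteDimensional ℝ E]
variable {D : LocalRanders E} {u : E} {V : E → E} {c : E → ℝ} {σ : ℝ}

/-- The form `r` is half the Lie derivative of `α²` along the dual vector field of `β`. -/
lemma lieA_X (hu : u ∈ D.U) (y : E) : D.lieA D.X u y = 2 * D.r u y y := by
  have h1 := fderiv_A_X hu y y
  have h2 : D.b u (D.Γ u y y) = 1 / 2 * (fderiv ℝ D.A u y y (D.X u)
      + fderiv ℝ D.A u y y (D.X u) - fderiv ℝ D.A u (D.X u) y y) := by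
    rw [← A_X hu, D.symm u hu, A_Γ hu]
  rw [lieA, r_apply, h2, fderiv_A_symm hu y y (D.X u)]
  linear_combination (2 : ℝ) * h1

lemma lieA_polar (hu : u ∈ D.U) {μ : ℝ} (hA : ∀ y, D.lieA V u y = μ * D.A u y y) (y z : E) :
    fderiv ℝ D.A u (V u) y z + D.A u (fderiv ℝ V u y) z + D.A u (fderiv ℝ V u z) y
      = μ * D.A u y z := by
  have h1 := hA (y + z)
  have h2 := hA y
  have h3 := hA z
  simp only [lieA, map_add, add_apply] at h1 h2 h3
  rw [fderiv_A_symm hu (V u) z y, D.symm u hu z y] at h1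
  linear_combination (1 / 2 : ℝ) * (h1 - h2 - h3)

/-- The Lie bracket of a conformal field scaling `β` with the dual vector field of `β`. -/
lemma bracket_X (hu : u ∈ D.U) {k : ℝ} (hA : ∀ y, D.lieA V u y = 4 * k * D.A u y y)
    (hB : ∀ y, D.lieB V u y = 2 * k * D.b u y) :
    fderiv ℝ D.X u (V u) = fderiv ℝ V u (D.X u) - (2 * k) • D.X u := by
  apply A_injective hu
  intro z
  have h1 := lieA_polar hu hA (D.X u) z
  have h2 := hB z
  have h3 := fderiv_A_X hu (V u) z
  rw [lieB_apply] at h2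
  have h4 : D.A u (fderiv ℝ V u z) (D.X u) = D.b u (fderiv ℝ V u z) := by
    rw [D.symm u hu, A_X hu]
  rw [h4, A_X hu] at h1
  simp only [map_sub, map_smul, sub_apply, smul_apply, smul_eq_mul, A_X hu]
  linear_combination h3 + h2 - h1

/-- The norm of `β` is preserved by such a field. -/
lemma fderiv_bsq_V (hu : u ∈ D.U) {k : ℝ} (hA : ∀ y, D.lieA V u y = 4 * k * D.A u y y)
    (hB : ∀ y, D.lieB V u y = 2 * k * D.b u y) : fderiv ℝ D.bsq u (V u) = 0 := by
  have hdb := ((contDiffAt_b hu).differentiableAt (by simp)).hasFDerivAt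
  have hdX := ((contDiffAt_X hu).differentiableAt (by simp)).hasFDerivAt
  have h : HasFDerivAt D.bsq _ u := hdb.clm_apply hdX
  have h1 := hB (D.X u)
  rw [lieB_apply] at h1
  rw [h.fderiv]
  simp only [add_apply, ContinuousLinearMap.comp_apply, ContinuousLinearMap.flip_apply,
    bracket_X hu hA hB, map_sub, map_smul, smul_eq_mul]
  linear_combination h1

/-- The differential of `ℒ_V β = 2 c β`. -/
lemma fderiv_lieB (hu : u ∈ D.U) (hV : ContDiffAt ℝ 2 V u) (hc : DifferentiableAt ℝ c u)
    (hB : ∀ v ∈ D.U, ∀ y, D.lieB V v y = 2 * c v * D.b v y) (w z : E) :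
    fderiv ℝ (fderiv ℝ D.b) u w (V u) z + fderiv ℝ D.b u (fderiv ℝ V u w) z
      + fderiv ℝ D.b u w (fderiv ℝ V u z) + D.b u (fderiv ℝ (fderiv ℝ V) u w z)
      = 2 * fderiv ℝ c u w * D.b u z + 2 * c u * fderiv ℝ D.b u w z := by
  have hdV := (hV.differentiableAt (by simp)).hasFDerivAt
  have hdDV := ((hV.fderiv_right (m := 1) (by norm_num)).differentiableAt (by simp)).hasFDerivAt
  have hdb := ((contDiffAt_b hu).differentiableAt (by simp)).hasFDerivAt
  have hdDb := ((contDiffAt_fderiv_b hu).differentiableAt (by simp)).hasFDerivAt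
  have h1 : HasFDerivAt (fun v => fderiv ℝ D.b v (V v) z + D.b v (fderiv ℝ V v z)) _ u :=
    ((hdDb.clm_apply hdV).clm_apply (hasFDerivAt_const z u)).add
      (hdb.clm_apply (hdDV.clm_apply (hasFDerivAt_const z u)))
  have h2 : HasFDerivAt (fun v => 2 * c v * D.b v z) _ u :=
    (hc.hasFDerivAt.const_mul 2).mul (hasFDerivAt_b_base hu z)
  have h3 : (fun v => fderiv ℝ D.b v (V v) z + D.b v (fderiv ℝ V v z)) =ᶠ[𝓝 u]
      fun v => 2 * c v * D.b v z := by
    filter_upwards [D.isOpen.mem_nhds hu] with v hv using hB v hv z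
  have h4 := Filter.EventuallyEq.fderiv_eq (𝕜 := ℝ) h3
  rw [h1.fderiv, h2.fderiv] at h4
  have h5 := DFunLike.congr_fun h4 w
  simp at h5
  linear_combination h5

/-- The Lie derivative of the one-form `s` along a conformal field scaling `β`. -/
lemma lie_s (hu : u ∈ D.U) (hV : ContDiffAt ℝ 2 V u) (hc : DifferentiableAt ℝ c u)
    (hA : ∀ v ∈ D.U, ∀ y, D.lieA V v y = 4 * c v * D.A v y y)
    (hB : ∀ v ∈ D.U, ∀ y, D.lieB V v y = 2 * c v * D.b v y) (y : E) :
    fderiv ℝ D.s u (V u) y + D.s u (fderiv ℝ V u y)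
      = fderiv ℝ c u y * D.bsq u - fderiv ℝ c u (D.X u) * D.b u y := by
  have hdX := ((contDiffAt_X hu).differentiableAt (by simp)).hasFDerivAt
  have hdDb := ((contDiffAt_fderiv_b hu).differentiableAt (by simp)).hasFDerivAt
  have h1 : HasFDerivAt (fun v => 1 / 2 * (fderiv ℝ D.b v y (D.X v) - fderiv ℝ D.b v (D.X v) y))
      _ u :=
    (((hdDb.clm_apply (hasFDerivAt_const y u)).clm_apply hdX).sub
      ((hdDb.clm_apply hdX).clm_apply (hasFDerivAt_const y u))).const_mul (1 / 2)
  have h3 : (fun v => D.s v y) =ᶠ[𝓝 u]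
      fun v => 1 / 2 * (fderiv ℝ D.b v y (D.X v) - fderiv ℝ D.b v (D.X v) y) := by
    filter_upwards [D.isOpen.mem_nhds hu] with v hv using s_eq hv y
  have h4 := Filter.EventuallyEq.fderiv_eq (𝕜 := ℝ) h3
  rw [h1.fderiv, (hasFDerivAt_s_base hu y).fderiv] at h4
  have h5 := DFunLike.congr_fun h4 (V u)
  simp [bracket_X hu (hA u hu) (hB u hu)] at h5
  have b1 := fderiv_lieB hu hV hc hB y (D.X u)
  have b2 := fderiv_lieB hu hV hc hB (D.X u) y
  have hsym := (hV.isSymmSndFDerivAt (by simp)) y (D.X u)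
  rw [hsym] at b1
  have q1 := fderiv2_b_comm hu (V u) y (D.X u)
  have q2 := fderiv2_b_comm hu (V u) (D.X u) y
  have s1 := s_eq hu (fderiv ℝ V u y)
  have hX2 : D.b u (D.X u) = D.bsq u := rfl
  rw [hX2] at b1
  rw [h5, s1]
  linear_combination (1 / 2 : ℝ) * (b1 - b2 + q1 - q2)

/-- The derivative of the conformal factor along the dual vector field of `β`: compare the Lie
derivative of `ℒ_X α²` along `V` with that of `ℒ_V α²` along `X`, on the kernel of `β`. -/
lemma fderiv_factor_X (hu : u ∈ D.U) (hN : fderiv ℝ D.A u = 0) (hV : ContDiffAt ℝ 2 V u)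
    (hVd : ∀ v ∈ D.U, DifferentiableAt ℝ (fderiv ℝ V) v)
    (hc : DifferentiableAt ℝ c u) (hiso : ∀ v ∈ D.U, D.IsoAt σ v)
    (hA : ∀ v ∈ D.U, ∀ y, D.lieA V v y = 4 * c v * D.A v y y)
    (hB : ∀ v ∈ D.U, ∀ y, D.lieB V v y = 2 * c v * D.b v y)
    {y : E} (hy : y ≠ 0) (hby : D.b u y = 0) :
    fderiv ℝ c u (D.X u) = 2 * c u * σ := by
  have hdV := (hV.differentiableAt (by simp)).hasFDerivAt
  have hdDV := (hVd u hu).hasFDerivAt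
  have hdX := ((contDiffAt_X hu).differentiableAt (by simp)).hasFDerivAt
  have hdDX := (((contDiffAt_X hu).fderiv_right (m := ∞) (by simp)).differentiableAt
    (by simp)).hasFDerivAt
  have hdA := ((contDiffAt_A hu).differentiableAt (by simp)).hasFDerivAt
  have hdDA := ((contDiffAt_fderiv_A hu).differentiableAt (by simp)).hasFDerivAt
  have cy := hasFDerivAt_const (𝕜 := ℝ) y u
  -- the equation for `r` differentiated along `V`
  have e1 : fderiv ℝ (fderiv ℝ D.A) u (V u) (D.X u) y y
      + 2 * D.A u (fderiv ℝ (fderiv ℝ D.X) u (V u) y) y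
      = - 4 * D.s u y * fderiv ℝ D.b u (V u) y := by
    have h1 : HasFDerivAt (fun v => fderiv ℝ D.A v (D.X v) y y
        + 2 * D.A v (fderiv ℝ D.X v y) y) _ u :=
      (((hdDA.clm_apply hdX).clm_apply cy).clm_apply cy).add
        (((hdA.clm_apply (hdDX.clm_apply cy)).clm_apply cy).const_mul 2)
    have h2 : HasFDerivAt (fun v => 4 * σ * (D.A v y y - D.b v y * D.b v y)
        - 4 * (D.b v y * D.s v y)) _ u :=
      (((hasFDerivAt_A_base hu y y).sub ((hasFDerivAt_b_base hu y).mul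
        (hasFDerivAt_b_base hu y))).const_mul (4 * σ)).sub
        (((hasFDerivAt_b_base hu y).mul (hasFDerivAt_s_base hu y)).const_mul 4)
    have h3 : (fun v => fderiv ℝ D.A v (D.X v) y y + 2 * D.A v (fderiv ℝ D.X v y) y) =ᶠ[𝓝 u]
        fun v => 4 * σ * (D.A v y y - D.b v y * D.b v y) - 4 * (D.b v y * D.s v y) := by
      filter_upwards [D.isOpen.mem_nhds hu] with v hv
      have := lieA_X hv y
      rw [lieA] at this
      rw [this]
      have := (hiso v hv).polar hv y y
      linear_combination (2 : ℝ) * this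
    have h4 := Filter.EventuallyEq.fderiv_eq (𝕜 := ℝ) h3
    rw [h1.fderiv, h2.fderiv] at h4
    have h5 := DFunLike.congr_fun h4 (V u)
    simp [hN, hby] at h5
    linear_combination h5
  -- the conformal equation differentiated along `X`
  have e2 : fderiv ℝ (fderiv ℝ D.A) u (D.X u) (V u) y y
      + 2 * D.A u (fderiv ℝ (fderiv ℝ V) u (D.X u) y) y
      = 4 * fderiv ℝ c u (D.X u) * D.A u y y := by
    have h1 : HasFDerivAt (fun v => fderiv ℝ D.A v (V v) y y
        + 2 * D.A v (fderiv ℝ V v y) y) _ u :=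
      (((hdDA.clm_apply hdV).clm_apply cy).clm_apply cy).add
        (((hdA.clm_apply (hdDV.clm_apply cy)).clm_apply cy).const_mul 2)
    have h2 : HasFDerivAt (fun v => 4 * c v * D.A v y y) _ u :=
      (hc.hasFDerivAt.const_mul 4).mul (hasFDerivAt_A_base hu y y)
    have h3 : (fun v => fderiv ℝ D.A v (V v) y y + 2 * D.A v (fderiv ℝ V v y) y) =ᶠ[𝓝 u]
        fun v => 4 * c v * D.A v y y := by
      filter_upwards [D.isOpen.mem_nhds hu] with v hv using hA v hv y
    have h4 := Filter.EventuallyEq.fderiv_eq (𝕜 := ℝ) h3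
    rw [h1.fderiv, h2.fderiv] at h4
    have h5 := DFunLike.congr_fun h4 (D.X u)
    simp [hN] at h5
    linear_combination h5
  -- the bracket relation differentiated along `y`
  have e3 : fderiv ℝ (fderiv ℝ D.X) u y (V u) + fderiv ℝ D.X u (fderiv ℝ V u y)
      = fderiv ℝ (fderiv ℝ V) u y (D.X u) + fderiv ℝ V u (fderiv ℝ D.X u y)
        - (2 * fderiv ℝ c u y) • D.X u - (2 * c u) • fderiv ℝ D.X u y := by
    have h1 : HasFDerivAt (fun v => fderiv ℝ D.X v (V v)) _ u := hdDX.clm_apply hdV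
    have h2 : HasFDerivAt (fun v => fderiv ℝ V v (D.X v) - (2 * c v) • D.X v) _ u :=
      (hdDV.clm_apply hdX).sub ((hc.hasFDerivAt.const_mul 2).smul hdX)
    have h3 : (fun v => fderiv ℝ D.X v (V v)) =ᶠ[𝓝 u]
        fun v => fderiv ℝ V v (D.X v) - (2 * c v) • D.X v := by
      filter_upwards [D.isOpen.mem_nhds hu] with v hv using bracket_X hv (hA v hv) (hB v hv)
    have h4 := Filter.EventuallyEq.fderiv_eq (𝕜 := ℝ) h3
    rw [h1.fderiv, h2.fderiv] at h4
    have h5 := DFunLike.congr_fun h4 y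
    simp at h5
    rw [add_comm, h5]
    module
  have e3' := congrArg (fun z => D.A u z y) e3
  simp only [map_add, map_sub, map_smul, add_apply, sub_apply, smul_apply, smul_eq_mul, A_X hu,
    hby] at e3'
  have hsymX := ((contDiffAt_X hu).isSymmSndFDerivAt (by
    simpa using (WithTop.coe_le_coe.2 (le_top : (2 : ℕ∞) ≤ ⊤) : ((2 : ℕ∞) : WithTop ℕ∞) ≤ _)))
    y (V u)
  have hsymV := (hV.isSymmSndFDerivAt (by simp)) y (D.X u)
  have hsymA := fderiv2_A_comm hu (V u) (D.X u) y y
  rw [hsymX, hsymV] at e3'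
  have pX : ∀ z, D.A u (fderiv ℝ D.X u z) y + D.A u (fderiv ℝ D.X u y) z
      = 4 * σ * D.A u z y - 2 * D.s u y * D.b u z := by
    intro z
    have h1 := fderiv_A_X hu z y
    have h2 := fderiv_A_X hu y z
    have h3 := (hiso u hu).polar hu z y
    rw [r_apply, Γ_eq_zero hu hN] at h3
    rw [hN] at h1 h2
    simp [hby] at h1 h2 h3
    linear_combination h1 + h2 + (2 : ℝ) * h3
  have pV : ∀ z, D.A u (fderiv ℝ V u z) y + D.A u (fderiv ℝ V u y) z = 4 * c u * D.A u z y := by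
    intro z
    have := lieA_polar hu (hA u hu) z y
    rw [hN] at this
    simpa using this
  have lB := hB u hu y
  rw [lieB_apply, hby] at lB
  have p1 := pX (fderiv ℝ V u y)
  have p2 := pV (fderiv ℝ D.X u y)
  have p3 := pV y
  have p4 := pX y
  rw [hby] at p4
  rw [D.symm u hu (fderiv ℝ V u y) (fderiv ℝ D.X u y)] at p2
  have hfin : D.A u y y * (fderiv ℝ c u (D.X u) - 2 * c u * σ) = 0 := by
    linear_combination (1 / 4 : ℝ) * e1 - (1 / 4 : ℝ) * e2 - (1 / 2 : ℝ) * e3'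
      - (1 / 4 : ℝ) * hsymA + (1 / 2 : ℝ) * p1 - (1 / 2 : ℝ) * p2
      - D.s u y * lB + σ * p3 - (1 / 2 : ℝ) * c u * p4
  linarith [(mul_eq_zero.1 hfin).resolve_left (D.pos u hu y hy).ne']

/-- If the S-curvature is constant, a conformal field scaling `β` accordingly is homothetic where
`β` does not vanish. -/
theorem fderiv_factor_eq_zero (hn : 2 ≤ Module.finrank ℝ E) (hu : u ∈ D.U)
    (hN : fderiv ℝ D.A u = 0) (hV : ContDiffAt ℝ 2 V u)
    (hVd : ∀ v ∈ D.U, DifferentiableAt ℝ (fderiv ℝ V) v)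
    (hc : DifferentiableAt ℝ c u) (hiso : ∀ v ∈ D.U, D.IsoAt σ v)
    (hA : ∀ v ∈ D.U, ∀ y, D.lieA V v y = 4 * c v * D.A v y y)
    (hB : ∀ v ∈ D.U, ∀ y, D.lieB V v y = 2 * c v * D.b v y) (hb : D.X u ≠ 0) :
    fderiv ℝ c u = 0 := by
  obtain ⟨y₀, hy₀, hby₀⟩ : ∃ y, y ≠ 0 ∧ D.b u y = 0 := by
    have h1 : 0 < Module.finrank ℝ (D.b u : E →ₗ[ℝ] ℝ).ker := by
      have h2 := (D.b u : E →ₗ[ℝ] ℝ).finrank_range_add_finrank_ker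
      have h3 : Module.finrank ℝ (D.b u : E →ₗ[ℝ] ℝ).range ≤ 1 := by
        simpa using (D.b u : E →ₗ[ℝ] ℝ).range.finrank_le
      omega
    have := Module.finrank_pos_iff.1 h1
    obtain ⟨y, hy⟩ := exists_ne (0 : (D.b u : E →ₗ[ℝ] ℝ).ker)
    exact ⟨y, by simpa using hy, y.2⟩
  have hX := fderiv_factor_X hu hN hV hVd hc hiso hA hB hy₀ hby₀
  have hbsq : D.bsq u ≠ 0 := by rw [bsq_eq hu]; exact (D.pos u hu _ hb).ne'
  have hX2 : D.b u (D.X u) = D.bsq u := rfl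
  -- the one-form `2 σ b + s` annihilates `V`, because `‖β‖` is constant along `V`, and it is closed
  have key : ∀ y, 4 * σ * c u * D.b u y + fderiv ℝ c u y * D.bsq u
      - fderiv ℝ c u (D.X u) * D.b u y = 0 := by
    intro y
    have hdV := (hV.differentiableAt (by simp)).hasFDerivAt
    have hdb := ((contDiffAt_b hu).differentiableAt (by simp)).hasFDerivAt
    have hds := ((contDiffAt_s hu).differentiableAt (by simp)).hasFDerivAt
    have h1 : (fun v => 2 * σ * D.b v (V v) + D.s v (V v)) =ᶠ[𝓝 u] fun _ => (0 : ℝ) := by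
      filter_upwards [D.isOpen.mem_nhds hu] with v hv
      have h2 := fderiv_bsq_V hv (hA v hv) (hB v hv)
      rw [(hiso v hv).fderiv_bsq hv] at h2
      have h3 := sub_pos.2 (bsq_lt_one hv)
      exact (mul_eq_zero.1 h2).resolve_left (by positivity)
    have h2 := Filter.EventuallyEq.fderiv_eq (𝕜 := ℝ) h1
    have h3 : HasFDerivAt (fun v => 2 * σ * D.b v (V v) + D.s v (V v)) _ u :=
      ((hdb.clm_apply hdV).const_mul (2 * σ)).add (hds.clm_apply hdV)
    rw [h3.fderiv] at h2
    have h4 := DFunLike.congr_fun h2 y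
    simp at h4
    have h5 := lie_s hu hV hc hA hB y
    have h6 := fderiv_s_antisymm hu (differentiableAt_const σ) hiso (V u) y
    have h7 := hB u hu y
    rw [lieB_apply] at h7
    simp at h6
    linear_combination h4 + h6 - h5 - 2 * σ * h7
  have k1 := key (D.X u)
  rw [hX2] at k1
  have k2 : σ * c u = 0 := by
    have : D.bsq u * (σ * c u) = 0 := by linear_combination (1 / 4 : ℝ) * k1
    exact (mul_eq_zero.1 this).resolve_left hbsq
  ext1 y
  have k3 := key y
  rw [hX] at k3
  have : D.bsq u * fderiv ℝ c u y = 0 := by linear_combination k3 - 2 * D.b u y * k2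
  simpa using (mul_eq_zero.1 this).resolve_left hbsq

end Abstract

end LocalRanders

/-! ### Unique continuation for the one-form -/

section Partial

variable {n : ℕ} {U : Set (Coord n)} {u : Coord n} {f g : Coord n → ℝ}

/-- The partial derivative of a function of position. -/
def pd (i : Fin n) (f : Coord n → ℝ) (u : Coord n) : ℝ := fderiv ℝ f u (EuclideanSpace.single i 1)

lemma contDiffOn_pd (hU : IsOpen U) (hf : ContDiffOn ℝ ∞ f U) (i : Fin n) :
    ContDiffOn ℝ ∞ (pd i f) U :=
  (hf.fderiv_of_isOpen hU (m := ∞) (by simp)).clm_apply contDiffOn_const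

lemma pd_congr (hU : IsOpen U) (h : Set.EqOn f g U) (i : Fin n) :
    Set.EqOn (pd i f) (pd i g) U := fun v hv => by
  have h1 : f =ᶠ[𝓝 v] g := by filter_upwards [hU.mem_nhds hv] with w hw using h hw
  rw [pd, pd, Filter.EventuallyEq.fderiv_eq (𝕜 := ℝ) h1]

lemma pd_differentiableAt (hU : IsOpen U) (hf : ContDiffOn ℝ ∞ f U) (hu : u ∈ U) :
    DifferentiableAt ℝ f u :=
  (hf.contDiffAt (hU.mem_nhds hu)).differentiableAt (by simp)

lemma pd_add (hU : IsOpen U) (hf : ContDiffOn ℝ ∞ f U) (hg : ContDiffOn ℝ ∞ g U) (i : Fin n) :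
    Set.EqOn (pd i (fun v => f v + g v)) (fun v => pd i f v + pd i g v) U := fun v hv => by
  have h : HasFDerivAt (fun v => f v + g v) _ v :=
    (pd_differentiableAt hU hf hv).hasFDerivAt.add (pd_differentiableAt hU hg hv).hasFDerivAt
  simp [pd, h.fderiv]

lemma pd_mul (hU : IsOpen U) (hf : ContDiffOn ℝ ∞ f U) (hg : ContDiffOn ℝ ∞ g U) (i : Fin n) :
    Set.EqOn (pd i (fun v => f v * g v)) (fun v => f v * pd i g v + pd i f v * g v) U :=
  fun v hv => by
  have h : HasFDerivAt (fun v => f v * g v) _ v :=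
    (pd_differentiableAt hU hf hv).hasFDerivAt.mul (pd_differentiableAt hU hg hv).hasFDerivAt
  simp [pd, h.fderiv]; ring

lemma pd_sum {ι : Type*} (s : Finset ι) {f : ι → Coord n → ℝ} (hU : IsOpen U)
    (hf : ∀ k, ContDiffOn ℝ ∞ (f k) U) (i : Fin n) :
    Set.EqOn (pd i (fun v => ∑ k ∈ s, f k v)) (fun v => ∑ k ∈ s, pd i (f k) v) U :=
  fun v hv => by
  have h : HasFDerivAt (fun v => ∑ k ∈ s, f k v) _ v :=
    HasFDerivAt.fun_sum fun k _ => (pd_differentiableAt hU (hf k) hv).hasFDerivAt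
  simp [pd, h.fderiv]

lemma pd_comm (hU : IsOpen U) (hf : ContDiffOn ℝ ∞ f U) (i j : Fin n) :
    Set.EqOn (pd i (pd j f)) (pd j (pd i f)) U := fun v hv => by
  have hc := hf.contDiffAt (hU.mem_nhds hv)
  have hd := ((hc.fderiv_right (m := ∞) (by simp)).differentiableAt (by simp)).hasFDerivAt
  have h : ∀ j : Fin n, HasFDerivAt (pd j f) _ v := fun j =>
    hd.clm_apply (hasFDerivAt_const (EuclideanSpace.single j 1) v)
  have hs := (hc.isSymmSndFDerivAt (by
    simpa using (WithTop.coe_le_coe.2 (le_top : (2 : ℕ∞) ≤ ⊤) : ((2 : ℕ∞) : WithTop ℕ∞) ≤ _)))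
    (EuclideanSpace.single i 1) (EuclideanSpace.single j 1)
  rw [pd, pd, (h i).fderiv, (h j).fderiv]
  simpa using hs

lemma pd_pd_mul (hU : IsOpen U) (hf : ContDiffOn ℝ ∞ f U) (hg : ContDiffOn ℝ ∞ g U)
    (i j : Fin n) : Set.EqOn (pd i (pd j (fun v => f v * g v)))
      (fun v => f v * pd i (pd j g) v + pd i f v * pd j g v + pd j f v * pd i g v
        + pd i (pd j f) v * g v) U := fun v hv => by
  have hf' := contDiffOn_pd hU hf j
  have hg' := contDiffOn_pd hU hg j
  rw [pd_congr hU (pd_mul hU hf hg j) i hv,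
    pd_add hU (f := fun v => f v * pd j g v) (g := fun v => pd j f v * g v)
      (hf.mul hg') (hf'.mul hg) i hv]
  simp only [pd_mul hU hf hg' i hv, pd_mul hU hf' hg i hv]
  ring

/-- A family of functions whose first derivatives are bounded by the functions themselves near `u`
vanishes near `u` if all its members vanish together at points arbitrarily close to `u`. -/
theorem eventually_eq_zero_of_pd_isBigO {J : Type*} [Fintype J] (hU : IsOpen U) (hu : u ∈ U)
    {φ : J → Coord n → ℝ} (hφ : ∀ a, ContDiffOn ℝ ∞ (φ a) U)
    (hO : ∀ a i, (pd i (φ a)) =O[𝓝 u] fun v => ∑ b, |φ b v|)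
    (hz : ∃ᶠ p in 𝓝 u, ∀ a, φ a p = 0) : ∀ᶠ v in 𝓝 u, ∀ a, φ a v = 0 := by
  choose C hC using fun a i => (hO a i).bound
  have hev : ∀ᶠ v in 𝓝 u, v ∈ U ∧ ∀ a i, ‖pd i (φ a) v‖ ≤ C a i * ‖∑ b, |φ b v|‖ :=
    Filter.Eventually.and (hU.mem_nhds hu)
      (eventually_all.2 fun a => eventually_all.2 fun i => hC a i)
  obtain ⟨δ, hδ, hball⟩ := Metric.eventually_nhds_iff_ball.1 hev
  obtain ⟨p, hpz, hp⟩ := (hz.and_eventually (Metric.ball_mem_nhds u hδ)).exists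
  filter_upwards [Metric.ball_mem_nhds u hδ] with v hv
  have hseg : ∀ t ∈ Set.Icc (0 : ℝ) 1, p + t • (v - p) ∈ Metric.ball u δ := fun t ht =>
    (convex_ball u δ).add_smul_sub_mem hp hv ht
  set h := v - p
  have hder : ∀ t ∈ Set.Icc (0 : ℝ) 1, HasDerivAt (fun t : ℝ => fun a => φ a (p + t • h))
      (fun a => fderiv ℝ (φ a) (p + t • h) h) t := by
    intro t ht
    refine hasDerivAt_pi.2 fun a => ?_
    have h1 := (pd_differentiableAt hU (hφ a) (hball _ (hseg t ht)).1).hasFDerivAt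
    have h2 : HasDerivAt (fun t : ℝ => p + t • h) h t := by
      simpa using ((hasDerivAt_id t).smul_const h).const_add p
    exact h1.comp_hasDerivAt t h2
  set K : ℝ := ∑ a, ∑ i, ‖h i‖ * (|C a i| * Fintype.card J) with hK
  have hbound : ∀ t ∈ Set.Icc (0 : ℝ) 1, ‖fun a => fderiv ℝ (φ a) (p + t • h) h‖
      ≤ K * ‖fun a => φ a (p + t • h)‖ := by
    intro t ht
    set w := p + t • h
    have hw := (hball _ (hseg t ht)).2
    have hK0 : 0 ≤ K := by positivity
    refine (pi_norm_le_iff_of_nonneg (by positivity)).2 fun a => ?_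
    have h1 : fderiv ℝ (φ a) w h = ∑ i, h i * pd i (φ a) w := by
      conv_lhs => rw [eq_sum_single h]
      simp [pd]
    have h2 : ∑ b, |φ b w| ≤ Fintype.card J * ‖fun a => φ a w‖ := by
      have := Finset.sum_le_card_nsmul Finset.univ (fun b => |φ b w|) ‖fun a => φ a w‖
        (fun b _ => norm_le_pi_norm (fun a => φ a w) b)
      simpa using this
    rw [h1]
    calc ‖∑ i, h i * pd i (φ a) w‖ ≤ ∑ i, ‖h i * pd i (φ a) w‖ := norm_sum_le _ _
      _ ≤ ∑ i, ‖h i‖ * (|C a i| * Fintype.card J) * ‖fun a => φ a w‖ := by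
        refine Finset.sum_le_sum fun i _ => ?_
        rw [norm_mul, mul_assoc, mul_assoc]
        refine mul_le_mul_of_nonneg_left ((hw a i).trans ?_) (norm_nonneg _)
        rw [Real.norm_of_nonneg (Finset.sum_nonneg fun b _ => abs_nonneg _)]
        exact mul_le_mul (le_abs_self _) h2 (Finset.sum_nonneg fun b _ => abs_nonneg _)
          (abs_nonneg _)
      _ = (∑ i, ‖h i‖ * (|C a i| * Fintype.card J)) * ‖fun a => φ a w‖ := by
        rw [Finset.sum_mul]
      _ ≤ K * ‖fun a => φ a w‖ := by
        refine mul_le_mul_of_nonneg_right ?_ (norm_nonneg _)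
        exact Finset.single_le_sum (f := fun a => ∑ i, ‖h i‖ * (|C a i| * Fintype.card J))
          (fun a _ => by positivity) (Finset.mem_univ a)
  have := eq_zero_of_abs_deriv_le_mul_abs_self_of_eq_zero_right (K := K)
    (fun t ht => (hder t ht).continuousAt.continuousWithinAt)
    (fun t ht => (hder t ⟨ht.1, ht.2.le⟩).hasDerivWithinAt)
    (by ext a; simpa using hpz a) (fun t ht => hbound t ⟨ht.1, ht.2.le⟩) 1 (by simp)
  intro a
  simpa [h] using congrFun this a

/-- Unique continuation for the conformal Killing type system
`∂_i b_j + ∂_j b_i = σ a_ij + Σ_k Z^k_ij b_k`. The second derivatives of `b` are expressed by first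
derivatives of the right side, and the compatibility condition of Saint-Venant determines the
second derivatives of `σ` in dimension at least three, so that the system becomes an ordinary
differential equation for `(b, ∂b, σ, ∂σ)` along lines. -/
theorem eventually_eq_zero_of_killing (hU : IsOpen U) (hu : u ∈ U)
    {b : Fin n → Coord n → ℝ} {σ : Coord n → ℝ} {a g : Fin n → Fin n → Coord n → ℝ}
    {Z : Fin n → Fin n → Fin n → Coord n → ℝ}
    (hb : ∀ i, ContDiffOn ℝ ∞ (b i) U) (hσ : ContDiffOn ℝ ∞ σ U)
    (ha : ∀ i j, ContDiffOn ℝ ∞ (a i j) U) (hg : ∀ i j, ContDiffOn ℝ ∞ (g i j) U)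
    (hZ : ∀ i j k, ContDiffOn ℝ ∞ (Z i j k) U)
    (heq : ∀ v ∈ U, ∀ i j, pd i (b j) v + pd j (b i) v = σ v * a i j v + ∑ k, Z i j k v * b k v)
    (hsymm : ∀ v ∈ U, ∀ i j, a i j v = a j i v)
    (hga : ∀ v ∈ U, ∀ i j, ∑ k, g i k v * a k j v = if i = j then 1 else 0)
    (hag : ∀ v ∈ U, ∀ i j, ∑ k, a i k v * g k j v = if i = j then 1 else 0)
    (hn : 3 ≤ n ∨ ∀ v ∈ U, σ v = 0)
    (hz : ∃ᶠ p in 𝓝 u, (∀ᶠ v in 𝓝 p, ∀ i, b i v = 0) ∧ ∀ᶠ v in 𝓝 p, σ v = 0) :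
    ∀ᶠ v in 𝓝 u, ∀ i, b i v = 0 := by
  set φ : (Fin n ⊕ Fin n × Fin n) ⊕ (Unit ⊕ Fin n) → Coord n → ℝ :=
    Sum.elim (Sum.elim b fun p => pd p.1 (b p.2)) (Sum.elim (fun _ => σ) fun i => pd i σ) with hφdef
  set m : Coord n → ℝ := fun v => ∑ a, |φ a v| with hm
  have hφ : ∀ a, ContDiffOn ℝ ∞ (φ a) U := by
    rintro ((i | ⟨i, j⟩) | (_ | i))
    · exact hb i
    · exact contDiffOn_pd hU (hb j) i
    · exact hσ
    · exact contDiffOn_pd hU hσ i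
  -- functions bounded by `m` form a module over the continuous functions
  have hself : ∀ a, φ a =O[𝓝 u] m := fun a => by
    refine Asymptotics.IsBigO.of_bound 1 (Eventually.of_forall fun v => ?_)
    rw [one_mul, Real.norm_of_nonneg (Finset.sum_nonneg fun b _ => abs_nonneg _)]
    exact Finset.single_le_sum (f := fun a => |φ a v|) (fun a _ => abs_nonneg _)
      (Finset.mem_univ a)
  have hmul : ∀ {c f : Coord n → ℝ}, ContDiffOn ℝ ∞ c U → f =O[𝓝 u] m →
      (fun v => c v * f v) =O[𝓝 u] m := by
    intro c f hc hf
    have h1 := (hc.contDiffAt (hU.mem_nhds hu)).continuousAt.isBigO_one ℝ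
    simpa using h1.mul hf
  have hcongr : ∀ {f g : Coord n → ℝ}, Set.EqOn f g U → g =O[𝓝 u] m → f =O[𝓝 u] m := by
    intro f g hfg hg
    refine hg.congr' ?_ EventuallyEq.rfl
    filter_upwards [hU.mem_nhds hu] with w hw using (hfg hw).symm
  have hsum : ∀ {f : Fin n → Coord n → ℝ}, (∀ k, f k =O[𝓝 u] m) →
      (fun v => ∑ k, f k v) =O[𝓝 u] m :=
    fun hf => Asymptotics.IsBigO.fun_sum fun k _ => hf k
  have ob : ∀ i, b i =O[𝓝 u] m := fun i => hself (.inl (.inl i))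
  have odb : ∀ i j, pd i (b j) =O[𝓝 u] m := fun i j => hself (.inl (.inr (i, j)))
  have os : σ =O[𝓝 u] m := hself (.inr (.inl ()))
  have ods : ∀ i, pd i σ =O[𝓝 u] m := fun i => hself (.inr (.inr i))
  -- the right side of the system
  set Ef : Fin n → Fin n → Coord n → ℝ := fun i j v => σ v * a i j v + ∑ k, Z i j k v * b k v
  have hsa : ∀ i j, ContDiffOn ℝ ∞ (fun v => σ v * a i j v) U := fun i j => hσ.mul (ha i j)
  have hZb : ∀ i j k, ContDiffOn ℝ ∞ (fun v => Z i j k v * b k v) U :=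
    fun i j k => (hZ i j k).mul (hb k)
  have hZs : ∀ i j, ContDiffOn ℝ ∞ (fun v => ∑ k, Z i j k v * b k v) U :=
    fun i j => ContDiffOn.sum fun k _ => hZb i j k
  have hdE : ∀ l i j, Set.EqOn (pd l (Ef i j)) (fun v => (σ v * pd l (a i j) v + pd l σ v * a i j v)
      + ∑ k, (Z i j k v * pd l (b k) v + pd l (Z i j k) v * b k v)) U := by
    intro l i j v hv
    rw [pd_add hU (f := fun v => σ v * a i j v) (hsa i j) (hZs i j) l hv]
    simp only [pd_mul hU hσ (ha i j) l hv,
      pd_sum Finset.univ (f := fun k v => Z i j k v * b k v) hU (hZb i j) l hv,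
      pd_mul hU (hZ i j _) (hb _) l hv]
  have odE : ∀ l i j, pd l (Ef i j) =O[𝓝 u] m := by
    intro l i j
    refine hcongr (hdE l i j) (Asymptotics.IsBigO.add ?_ (hsum fun k => ?_))
    · refine Asymptotics.IsBigO.add ?_ ?_
      · simpa only [mul_comm] using hmul (contDiffOn_pd hU (ha i j) l) os
      · simpa only [mul_comm] using hmul (ha i j) (ods l)
    · exact (hmul (hZ i j k) (odb l k)).add (hmul (contDiffOn_pd hU (hZ i j k) l) (ob k))
  have hE : ∀ i j, Set.EqOn (fun v => pd i (b j) v + pd j (b i) v) (Ef i j) U :=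
    fun i j v hv => heq v hv i j
  have hE1 : ∀ l i j, Set.EqOn (fun v => pd l (pd i (b j)) v + pd l (pd j (b i)) v)
      (pd l (Ef i j)) U := by
    intro l i j v hv
    rw [← pd_congr hU (hE i j) l hv,
      pd_add hU (contDiffOn_pd hU (hb j) i) (contDiffOn_pd hU (hb i) j) l hv]
  have oddb : ∀ i j k, pd i (pd j (b k)) =O[𝓝 u] m := by
    intro i j k
    have h1 : Set.EqOn (pd i (pd j (b k)))
        (fun v => (1 / 2 : ℝ) * (pd i (Ef j k) v + pd j (Ef i k) v - pd k (Ef i j) v)) U := by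
      intro v hv
      have e1 := hE1 i j k hv
      have e2 := hE1 j i k hv
      have e3 := hE1 k i j hv
      have c1 := pd_comm hU (hb k) i j hv
      have c2 := pd_comm hU (hb j) i k hv
      have c3 := pd_comm hU (hb i) j k hv
      simp only at e1 e2 e3 ⊢
      linear_combination (1 / 2 : ℝ) * (e1 + e2 - e3 + c1 - c2 - c3)
    refine hcongr h1 (hmul contDiffOn_const (((odE i j k).add (odE j i k)).sub (odE k i j)))
  -- second derivatives of the right side, up to bounded terms
  have oddE : ∀ l r i j, (fun v => pd l (pd r (Ef i j)) v - pd l (pd r σ) v * a i j v)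
      =O[𝓝 u] m := by
    intro l r i j
    have h1 : Set.EqOn (fun v => pd l (pd r (Ef i j)) v - pd l (pd r σ) v * a i j v)
        (fun v => (pd l (pd r (a i j)) v * σ v + pd r (a i j) v * pd l σ v
          + pd l (a i j) v * pd r σ v)
          + ∑ k, (Z i j k v * pd l (pd r (b k)) v + pd l (Z i j k) v * pd r (b k) v
            + pd r (Z i j k) v * pd l (b k) v + pd l (pd r (Z i j k)) v * b k v)) U := by
      intro v hv
      have h2 := pd_congr hU (pd_add hU (f := fun v => σ v * a i j v) (hsa i j) (hZs i j) r) l hv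
      simp only at h2 ⊢
      rw [h2, pd_add hU (contDiffOn_pd hU (hsa i j) r) (contDiffOn_pd hU (hZs i j) r) l hv]
      simp only [pd_pd_mul hU hσ (ha i j) l r hv,
        pd_congr hU (pd_sum Finset.univ (f := fun k v => Z i j k v * b k v) hU (hZb i j) r) l hv,
        pd_sum Finset.univ (f := fun k => pd r (fun v => Z i j k v * b k v)) hU
          (fun k => contDiffOn_pd hU (hZb i j k) r) l hv, pd_pd_mul hU (hZ i j _) (hb _) l r hv]
      ring
    refine hcongr h1 (Asymptotics.IsBigO.add ?_ (hsum fun k => ?_))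
    · exact ((hmul (contDiffOn_pd hU (contDiffOn_pd hU (ha i j) r) l) os).add
        (hmul (contDiffOn_pd hU (ha i j) r) (ods l))).add
        (hmul (contDiffOn_pd hU (ha i j) l) (ods r))
    · exact (((hmul (hZ i j k) (oddb l r k)).add (hmul (contDiffOn_pd hU (hZ i j k) l)
        (odb r k))).add (hmul (contDiffOn_pd hU (hZ i j k) r) (odb l k))).add
        (hmul (contDiffOn_pd hU (contDiffOn_pd hU (hZ i j k) r) l) (ob k))
  have hE2 : ∀ l r i j, Set.EqOn (fun v => pd l (pd r (pd i (b j))) v + pd l (pd r (pd j (b i))) v)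
      (pd l (pd r (Ef i j))) U := by
    intro l r i j v hv
    rw [← pd_congr hU (hE1 r i j) l hv,
      pd_add hU (contDiffOn_pd hU (contDiffOn_pd hU (hb j) i) r)
        (contDiffOn_pd hU (contDiffOn_pd hU (hb i) j) r) l hv]
  have odds : ∀ i j, pd i (pd j σ) =O[𝓝 u] m := by
    intro x w
    rcases hn with hn | hn
    -- the Saint-Venant combination of second derivatives of the right side, up to bounded terms
    · set κ : Fin n → Fin n → Fin n → Fin n → Coord n → ℝ := fun x w y z v =>
        pd x (pd w σ) v * a y z v + pd y (pd z σ) v * a x w v - pd x (pd y σ) v * a w z v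
          - pd w (pd z σ) v * a x y v with hκ
      have oκ : ∀ x w y z, κ x w y z =O[𝓝 u] m := by
        intro x w y z
        have h1 := (((oddE x y w z).add (oddE w z x y)).sub (oddE x w y z)).sub (oddE y z x w)
        refine hcongr (fun v hv => ?_) h1
        have e1 := hE2 x w y z hv
        have e2 := hE2 y z x w hv
        have e3 := hE2 x y w z hv
        have e4 := hE2 w z x y hv
        -- third derivatives of `b` commute
        have comm : ∀ i j k l, pd i (pd j (pd k (b l))) v = pd j (pd i (pd k (b l))) v :=
          fun i j k l => pd_comm hU (contDiffOn_pd hU (hb l) k) i j hv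
        have comm' : ∀ i j k l, pd i (pd j (pd k (b l))) v = pd i (pd k (pd j (b l))) v :=
          fun i j k l => pd_congr hU (pd_comm hU (hb l) j k) i hv
        simp only [hκ] at e1 e2 e3 e4 ⊢
        have c1 := comm' x w y z
        have c2 := (comm x w z y).trans (comm' w x z y)
        have c3 := (comm y z x w).trans ((comm' z y x w).trans
          ((comm z x y w).trans (comm' x z y w)))
        have c4 := ((comm' y z w x).trans (comm y w z x)).trans (comm' w y z x)
        linear_combination -e1 - e2 + e3 + e4 + c1 + c2 + c3 + c4
      -- two contractions of `κ` give the trace of the second derivatives of `σ`, then all of them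
      set τ : Coord n → ℝ := fun v => ∑ y, ∑ z, g y z v * pd y (pd z σ) v with hτ
      have hn2 : ((n : ℝ) - 2) ≠ 0 := by
        have : (3 : ℝ) ≤ n := by exact_mod_cast hn
        linarith
      have o1 : ∀ x w, (fun v => ((n : ℝ) - 2) * pd x (pd w σ) v + a x w v * τ v) =O[𝓝 u] m := by
        intro x w
        have h1 : (fun v => ∑ y, ∑ z, g y z v * κ x w y z v) =O[𝓝 u] m :=
          hsum fun y => hsum fun z =>
            hmul (hg y z) (oκ x w y z)
        refine hcongr (fun v hv => ?_) h1
        have t1 : ∑ y, ∑ z, g y z v * a y z v = n := by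
          have : ∀ y, ∑ z, g y z v * a y z v = 1 := fun y => by
            simpa [hsymm v hv y] using hga v hv y y
          simp [this]
        have t2 : ∑ y, ∑ z, g y z v * (pd x (pd y σ) v * a w z v) = pd x (pd w σ) v := by
          have : ∀ y, ∑ z, g y z v * (pd x (pd y σ) v * a w z v)
              = pd x (pd y σ) v * if y = w then 1 else 0 := fun y => by
            rw [← hga v hv y w, Finset.mul_sum]
            exact Finset.sum_congr rfl fun z _ => by rw [hsymm v hv w z]; ring
          simp [this]
        have t3 : ∑ y, ∑ z, g y z v * (pd w (pd z σ) v * a x y v) = pd x (pd w σ) v := by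
          rw [Finset.sum_comm]
          have : ∀ z, ∑ y, g y z v * (pd w (pd z σ) v * a x y v)
              = pd w (pd z σ) v * if x = z then 1 else 0 := fun z => by
            rw [← hag v hv x z, Finset.mul_sum]
            exact Finset.sum_congr rfl fun y _ => by ring
          simp [this, pd_comm hU hσ x w hv]
        have t4 : ∑ y, ∑ z, g y z v * κ x w y z v
            = pd x (pd w σ) v * (∑ y, ∑ z, g y z v * a y z v) + a x w v * τ v
              - (∑ y, ∑ z, g y z v * (pd x (pd y σ) v * a w z v))
              - ∑ y, ∑ z, g y z v * (pd w (pd z σ) v * a x y v) := by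
          simp only [hτ, hκ, Finset.mul_sum, ← Finset.sum_sub_distrib, ← Finset.sum_add_distrib]
          exact Finset.sum_congr rfl fun y _ => Finset.sum_congr rfl fun z _ => by ring
        rw [t4, t1, t2, t3]; ring
      have o2 : τ =O[𝓝 u] m := by
        have h1 : (fun v => (2 * ((n : ℝ) - 1))⁻¹ * ∑ x, ∑ w, g x w v *
            (((n : ℝ) - 2) * pd x (pd w σ) v + a x w v * τ v)) =O[𝓝 u] m :=
          hmul contDiffOn_const (hsum fun y => hsum fun z => hmul (hg y z) (o1 y z))
        refine hcongr (fun v hv => ?_) h1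
        have t1 : ∑ y, ∑ z, g y z v * a y z v = n := by
          have : ∀ y, ∑ z, g y z v * a y z v = 1 := fun y => by
            simpa [hsymm v hv y] using hga v hv y y
          simp [this]
        have t2 : ∀ t : ℝ, ∑ x, ∑ w, g x w v * (((n : ℝ) - 2) * pd x (pd w σ) v + a x w v * t)
            = ((n : ℝ) - 2) * (∑ y, ∑ z, g y z v * pd y (pd z σ) v)
              + (∑ y, ∑ z, g y z v * a y z v) * t := by
          intro t
          simp only [Finset.mul_sum, Finset.sum_mul, ← Finset.sum_add_distrib]
          exact Finset.sum_congr rfl fun y _ => Finset.sum_congr rfl fun z _ => by ring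
        have hn1 : ((n : ℝ) - 1) ≠ 0 := by
          have : (3 : ℝ) ≤ n := by exact_mod_cast hn
          linarith
        rw [t2, t1]
        change τ v = (2 * ((n : ℝ) - 1))⁻¹ * (((n : ℝ) - 2) * τ v + n * τ v)
        field_simp
        ring
      have h1 : (fun v => ((n : ℝ) - 2)⁻¹ * ((((n : ℝ) - 2) * pd x (pd w σ) v + a x w v * τ v)
          - a x w v * τ v)) =O[𝓝 u] m :=
        hmul contDiffOn_const ((o1 x w).sub (hmul (ha x w) o2))
      refine hcongr (fun v hv => ?_) h1
      field_simp
      ring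
    · have h0 : ∀ i, Set.EqOn (pd i (fun _ : Coord n => (0 : ℝ))) (fun _ => 0) U :=
        fun i v _ => by simp [pd]
      have h1 : Set.EqOn (pd x (pd w σ)) (fun _ => 0) U :=
        (pd_congr hU ((pd_congr hU (fun v hv => hn v hv) w).trans (h0 w)) x).trans (h0 x)
      exact hcongr h1 (Asymptotics.isBigO_zero _ _)
  have key := eventually_eq_zero_of_pd_isBigO hU hu hφ (by
    rintro ((i | ⟨i, j⟩) | (_ | i)) l
    · exact odb l i
    · exact oddb l i j
    · exact ods l
    · exact odds l i) (by
    refine hz.mono fun p hp => ?_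
    have hpd : ∀ {f : Coord n → ℝ}, (∀ᶠ v in 𝓝 p, f v = 0) → ∀ i, pd i f p = 0 := by
      intro f hf i
      have : f =ᶠ[𝓝 p] fun _ => (0 : ℝ) := hf
      rw [pd, Filter.EventuallyEq.fderiv_eq (𝕜 := ℝ) this]; simp
    rintro ((i | ⟨i, j⟩) | (_ | i))
    · exact hp.1.self_of_nhds i
    · exact hpd (eventually_all.1 hp.1 j) i
    · exact hp.2.self_of_nhds
    · exact hpd hp.2 i)
  filter_upwards [key] with v hv i using hv (.inl (.inl i))

end Partial

namespace LocalRanders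

variable {n : ℕ} {D : LocalRanders (Coord n)} {u : Coord n} {σ : Coord n → ℝ}

/-- Isotropic S-curvature vanishes where `β` vanishes on an open set. -/
lemma IsoAt.eq_zero {E : Type*} [NormedAddCommGroup E] [NormedSpace ℝ E]
    [FiniteDimensional ℝ E] [Nontrivial E] {D : LocalRanders E} {u : E} {σ : ℝ} (hu : u ∈ D.U)
    (h : D.IsoAt σ u) (hb : ∀ᶠ v in 𝓝 u, D.b v = 0) : σ = 0 := by
  obtain ⟨y, hy⟩ := exists_ne (0 : E)
  have h1 := h y
  have h2 : fderiv ℝ D.b u = 0 := by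
    have : D.b =ᶠ[𝓝 u] fun _ => 0 := hb
    rw [Filter.EventuallyEq.fderiv_eq (𝕜 := ℝ) this]; simp
  rw [e, r_apply, hb.self_of_nhds, h2] at h1
  simp at h1
  have := (D.pos u hu y hy).ne'
  simpa [this] using h1

/-- Unique continuation: if `F` has isotropic S-curvature `σ` and `β` vanishes on open sets
accumulating at `u`, then `β` vanishes near `u`, provided `n ≥ 3` or `σ = 0`. -/
theorem eventually_b_eq_zero (hn : 2 ≤ n) (hu : u ∈ D.U) (hiso : ∀ v ∈ D.U, D.IsoAt (σ v) v)
    (h3 : 3 ≤ n ∨ ∀ v ∈ D.U, σ v = 0) (hz : ∃ᶠ p in 𝓝 u, ∀ᶠ v in 𝓝 p, D.b v = 0) :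
    ∀ᶠ v in 𝓝 u, D.b v = 0 := by
  have : Nontrivial (Coord n) := by
    have : Nonempty (Fin n) := ⟨⟨0, by omega⟩⟩
    infer_instance
  set E : Fin n → Coord n := fun i => EuclideanSpace.single i 1 with hE
  have hσ : ∀ v ∈ D.U, ContDiffAt ℝ ∞ σ v := fun v hv => contDiffAt_of_isoAt hiso hv
  have smooth : ∀ {f : Coord n → ℝ}, (∀ v ∈ D.U, ContDiffAt ℝ ∞ f v) → ContDiffOn ℝ ∞ f D.U :=
    fun hf v hv => (hf v hv).contDiffWithinAt
  have hcoord : ∀ {f : Coord n → Coord n} {v : Coord n}, ContDiffAt ℝ ∞ f v → ∀ k,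
      ContDiffAt ℝ ∞ (fun v => f v k) v := fun hf k =>
    (EuclideanSpace.proj (𝕜 := ℝ) k).contDiff.contDiffAt.comp _ hf
  have hga : ∀ v ∈ D.U, ∀ i j, ∑ k, D.sharp v (EuclideanSpace.proj i) k * D.A v (E k) (E j)
      = if i = j then 1 else 0 := by
    intro v hv i j
    have h1 := DFunLike.congr_fun (A_sharp hv (EuclideanSpace.proj i)) (E j)
    rw [eq_sum_single (D.sharp v _)] at h1
    simp only [map_sum, map_smul, sum_apply, smul_apply, smul_eq_mul] at h1
    rw [h1]
    simp [hE]
  have hag : ∀ v ∈ D.U, ∀ i j, ∑ k, D.A v (E i) (E k) * D.sharp v (EuclideanSpace.proj k) j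
      = if i = j then 1 else 0 := by
    intro v hv i j
    set M : Matrix (Fin n) (Fin n) ℝ := Matrix.of fun i j => D.sharp v (EuclideanSpace.proj i) j
    set N : Matrix (Fin n) (Fin n) ℝ := Matrix.of fun i j => D.A v (E i) (E j)
    have h1 : M * N = 1 := by
      ext i j
      simpa [Matrix.mul_apply, Matrix.one_apply, M, N] using hga v hv i j
    have h3 : N * M = 1 := mul_eq_one_comm.1 h1
    have h2 := congrFun (congrFun h3 i) j
    simpa [Matrix.mul_apply, Matrix.one_apply, M, N] using h2
  have hb0 : ∀ v, (∀ i, D.b v (E i) = 0) → D.b v = 0 := by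
    intro v hv
    ext y
    rw [eq_sum_single y]
    simp only [map_sum, map_smul]
    simp [hE] at hv
    simp [hv]
  have hb : ∀ i, ContDiffOn ℝ ∞ (fun v => D.b v (E i)) D.U := fun i =>
    smooth fun v hv => (contDiffAt_b hv).clm_apply contDiffAt_const
  have ha : ∀ i j, ContDiffOn ℝ ∞ (fun v => D.A v (E i) (E j)) D.U := fun i j =>
    smooth fun v hv => ((contDiffAt_A hv).clm_apply contDiffAt_const).clm_apply contDiffAt_const
  have hg : ∀ i j, ContDiffOn ℝ ∞ (fun v => D.sharp v (EuclideanSpace.proj i) j) D.U := fun i j =>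
    smooth fun v hv => hcoord ((contDiffAt_sharp hv).clm_apply contDiffAt_const) j
  set Z : Fin n → Fin n → Coord n → Coord n := fun i j v =>
    (2 : ℝ) • D.Γ v (E i) (E j) - (4 * σ v * D.b v (E j)) • E i
      - (2 * D.s v (E j)) • E i - (2 * D.s v (E i)) • E j with hZdef
  have hZ : ∀ i j k, ContDiffOn ℝ ∞ (fun v => Z i j v k) D.U := fun i j k =>
    smooth fun v hv => by
      have hΓ := ((contDiffAt_Γ hv).clm_apply (contDiffAt_const (c := E i))).clm_apply
        (contDiffAt_const (c := E j))
      have hbj := (contDiffAt_b hv).clm_apply (contDiffAt_const (c := E j))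
      have hsj := (contDiffAt_s hv).clm_apply (contDiffAt_const (c := E j))
      have hsi := (contDiffAt_s hv).clm_apply (contDiffAt_const (c := E i))
      have h1 : ContDiffAt ℝ ∞ (fun v => (2 : ℝ) • D.Γ v (E i) (E j)) v := hΓ.const_smul (2 : ℝ)
      have h2 : ContDiffAt ℝ ∞ (fun v => 4 * σ v * D.b v (E j)) v :=
        ((contDiffAt_const (c := (4 : ℝ))).mul (hσ v hv)).mul hbj
      have h3 : ContDiffAt ℝ ∞ (fun v => 2 * D.s v (E j)) v :=
        (contDiffAt_const (c := (2 : ℝ))).mul hsj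
      have h4 : ContDiffAt ℝ ∞ (fun v => 2 * D.s v (E i)) v :=
        (contDiffAt_const (c := (2 : ℝ))).mul hsi
      have h5 : ContDiffAt ℝ ∞ (Z i j) v :=
        ((h1.sub (h2.smul (contDiffAt_const (c := E i)))).sub
          (h3.smul (contDiffAt_const (c := E i)))).sub (h4.smul (contDiffAt_const (c := E j)))
      exact hcoord h5 k
  have heq : ∀ v ∈ D.U, ∀ i j, pd i (fun v => D.b v (E j)) v + pd j (fun v => D.b v (E i)) v
      = 4 * σ v * D.A v (E i) (E j) + ∑ k, Z i j v k * D.b v (E k) := by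
    intro v hv i j
    have h1 := (hiso v hv).polar hv (E i) (E j)
    rw [r_apply] at h1
    have h2 : ∀ i j, pd i (fun v => D.b v (E j)) v = fderiv ℝ D.b v (E i) (E j) := fun i j => by
      rw [pd, (hasFDerivAt_b_base hv (E j)).fderiv]; rfl
    have h3 : ∀ w : Coord n, ∑ k, w k * D.b v (E k) = D.b v w := fun w => by
      conv_rhs => rw [eq_sum_single w]
      simp only [map_sum, map_smul, smul_eq_mul, hE]
    rw [h2, h2, h3]
    simp only [hZdef, map_sub, map_smul, smul_eq_mul]
    linear_combination (2 : ℝ) * h1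
  have hz' : ∃ᶠ p in 𝓝 u, (∀ᶠ v in 𝓝 p, ∀ i, D.b v (E i) = 0) ∧ ∀ᶠ v in 𝓝 p, 4 * σ v = 0 := by
    refine (hz.and_eventually (D.isOpen.mem_nhds hu)).mono fun p hp => ?_
    have hs : ∀ᶠ v in 𝓝 p, D.b v = 0 ∧ v ∈ D.U := hp.1.and (D.isOpen.mem_nhds hp.2)
    refine ⟨hs.mono fun v hv i => by simp [hv.1], ?_⟩
    filter_upwards [hs.eventually_nhds] with v hv
    rw [(hiso v hv.self_of_nhds.2).eq_zero hv.self_of_nhds.2 (hv.mono fun w hw => hw.1), mul_zero]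
  have key := eventually_eq_zero_of_killing (Z := fun i j k v => Z i j v k) D.isOpen hu hb
    (smooth fun v hv => contDiffAt_const.mul (hσ v hv)) ha hg hZ heq
    (fun v hv i j => D.symm v hv _ _) hga hag
    (h3.imp id fun h v hv => by simp [h v hv]) hz'
  exact key.mono fun v hv => hb0 v hv

end LocalRanders

/-! ### Changes of coordinates -/

namespace LocalRanders

variable {E : Type*} [NormedAddCommGroup E] [NormedSpace ℝ E] [FiniteDimensional ℝ E]

/-- `φ` is a change of coordinates near `u` from the coordinate expression `D` of a Randers metric
to the coordinate expression `D'`: near `u`, `D` is the pull-back of `D'` by `φ`. -/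
structure Related (D D' : LocalRanders E) (φ : E → E) (u : E) : Prop where
  mem : u ∈ D.U
  mem' : φ u ∈ D'.U
  smooth_eventually : ∀ᶠ v in 𝓝 u, ContDiffAt ℝ ∞ φ v
  A_eq : ∀ᶠ v in 𝓝 u, ∀ y z, D.A v y z = D'.A (φ v) (fderiv ℝ φ v y) (fderiv ℝ φ v z)
  b_eq : ∀ᶠ v in 𝓝 u, ∀ y, D.b v y = D'.b (φ v) (fderiv ℝ φ v y)

namespace Related

variable {D D' : LocalRanders E} {φ : E → E} {u : E}

lemma smooth (h : D.Related D' φ u) : ContDiffAt ℝ ∞ φ u := h.smooth_eventually.self_of_nhds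

lemma hasFDerivAt (h : D.Related D' φ u) : HasFDerivAt φ (fderiv ℝ φ u) u :=
  (h.smooth.differentiableAt (by simp)).hasFDerivAt

lemma hasFDerivAt_fderiv (h : D.Related D' φ u) :
    HasFDerivAt (fderiv ℝ φ) (fderiv ℝ (fderiv ℝ φ) u) u :=
  ((h.smooth.fderiv_right (m := ∞) (by simp)).differentiableAt (by simp)).hasFDerivAt

lemma fderiv2_comm (h : D.Related D' φ u) (y z : E) :
    fderiv ℝ (fderiv ℝ φ) u y z = fderiv ℝ (fderiv ℝ φ) u z y :=
  (h.smooth.isSymmSndFDerivAt (by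
    simpa using (WithTop.coe_le_coe.2 (le_top : (2 : ℕ∞) ≤ ⊤) : ((2 : ℕ∞) : WithTop ℕ∞) ≤ _))) y z

lemma injective (h : D.Related D' φ u) : Function.Injective (fderiv ℝ φ u) := by
  rw [injective_iff_map_eq_zero]
  intro y hy
  by_contra hne
  have h1 := D.pos u h.mem y hne
  rw [h.A_eq.self_of_nhds y y, hy, map_zero] at h1
  exact lt_irrefl _ h1

lemma surjective (h : D.Related D' φ u) : Function.Surjective (fderiv ℝ φ u) :=
  (LinearMap.injective_iff_surjective (f := (fderiv ℝ φ u : E →ₗ[ℝ] E))).1 h.injective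

lemma eventually (h : D.Related D' φ u) : ∀ᶠ v in 𝓝 u, D.Related D' φ v := by
  filter_upwards [D.isOpen.mem_nhds h.mem,
    h.smooth.continuousAt.preimage_mem_nhds (D'.isOpen.mem_nhds h.mem'), h.A_eq.eventually_nhds,
    h.b_eq.eventually_nhds, h.smooth_eventually.eventually_nhds] with v h1 h2 h3 h4 h5
  exact ⟨h1, h2, h5, h3, h4⟩

/-- The derivative of the transformation rule of the metric. -/
lemma fderiv_A (h : D.Related D' φ u) (w y z : E) :
    fderiv ℝ D.A u w y z
      = fderiv ℝ D'.A (φ u) (fderiv ℝ φ u w) (fderiv ℝ φ u y) (fderiv ℝ φ u z)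
        + D'.A (φ u) (fderiv ℝ (fderiv ℝ φ) u w y) (fderiv ℝ φ u z)
        + D'.A (φ u) (fderiv ℝ φ u y) (fderiv ℝ (fderiv ℝ φ) u w z) := by
  have hA' := ((contDiffAt_A h.mem').differentiableAt (by simp)).hasFDerivAt
  have hφ := h.hasFDerivAt_fderiv
  have h1 : HasFDerivAt (fun v => D'.A (φ v) (fderiv ℝ φ v y) (fderiv ℝ φ v z)) _ u :=
    ((hA'.comp u h.hasFDerivAt).clm_apply (hφ.clm_apply (hasFDerivAt_const y u))).clm_apply
      (hφ.clm_apply (hasFDerivAt_const z u))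
  have h2 : (fun v => D.A v y z) =ᶠ[𝓝 u]
      fun v => D'.A (φ v) (fderiv ℝ φ v y) (fderiv ℝ φ v z) := h.A_eq.mono fun v hv => hv y z
  have h3 := Filter.EventuallyEq.fderiv_eq (𝕜 := ℝ) h2
  rw [h1.fderiv, (hasFDerivAt_A_base h.mem y z).fderiv] at h3
  have h4 := DFunLike.congr_fun h3 w
  simp at h4
  linear_combination h4

lemma fderiv_b (h : D.Related D' φ u) (w y : E) :
    fderiv ℝ D.b u w y = fderiv ℝ D'.b (φ u) (fderiv ℝ φ u w) (fderiv ℝ φ u y)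
      + D'.b (φ u) (fderiv ℝ (fderiv ℝ φ) u w y) := by
  have hb' := ((contDiffAt_b h.mem').differentiableAt (by simp)).hasFDerivAt
  have hφ := h.hasFDerivAt_fderiv
  have h1 : HasFDerivAt (fun v => D'.b (φ v) (fderiv ℝ φ v y)) _ u :=
    (hb'.comp u h.hasFDerivAt).clm_apply (hφ.clm_apply (hasFDerivAt_const y u))
  have h2 : (fun v => D.b v y) =ᶠ[𝓝 u] fun v => D'.b (φ v) (fderiv ℝ φ v y) :=
    h.b_eq.mono fun v hv => hv y
  have h3 := Filter.EventuallyEq.fderiv_eq (𝕜 := ℝ) h2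
  rw [h1.fderiv, (hasFDerivAt_b_base h.mem y).fderiv] at h3
  have h4 := DFunLike.congr_fun h3 w
  simp at h4
  linear_combination h4

/-- The derivative of the transformation rule of a vector field. -/
lemma fderiv_field (h : D.Related D' φ u) {V V' : E → E} (hV : DifferentiableAt ℝ V u)
    (hV' : DifferentiableAt ℝ V' (φ u)) (hVV : ∀ᶠ v in 𝓝 u, V' (φ v) = fderiv ℝ φ v (V v))
    (y : E) : fderiv ℝ V' (φ u) (fderiv ℝ φ u y)
      = fderiv ℝ (fderiv ℝ φ) u y (V u) + fderiv ℝ φ u (fderiv ℝ V u y) := by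
  have h1 : HasFDerivAt (fun v => V' (φ v)) _ u := hV'.hasFDerivAt.comp u h.hasFDerivAt
  have h2 : HasFDerivAt (fun v => fderiv ℝ φ v (V v)) _ u :=
    h.hasFDerivAt_fderiv.clm_apply hV.hasFDerivAt
  have h3 := Filter.EventuallyEq.fderiv_eq (𝕜 := ℝ) hVV
  rw [h1.fderiv, h2.fderiv] at h3
  have h4 := DFunLike.congr_fun h3 y
  simp at h4
  rw [h4, add_comm]

lemma lieA_eq (h : D.Related D' φ u) {V V' : E → E} (hV : DifferentiableAt ℝ V u)
    (hV' : DifferentiableAt ℝ V' (φ u)) (hVV : ∀ᶠ v in 𝓝 u, V' (φ v) = fderiv ℝ φ v (V v))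
    (y : E) : D.lieA V u y = D'.lieA V' (φ u) (fderiv ℝ φ u y) := by
  rw [lieA, lieA, h.fderiv_A, h.fderiv_field hV hV' hVV, hVV.self_of_nhds,
    h.A_eq.self_of_nhds, h.fderiv2_comm (V u) y, D'.symm _ h.mem' (fderiv ℝ φ u y)]
  simp only [map_add, add_apply]
  ring

lemma lieB_eq (h : D.Related D' φ u) {V V' : E → E} (hV : DifferentiableAt ℝ V u)
    (hV' : DifferentiableAt ℝ V' (φ u)) (hVV : ∀ᶠ v in 𝓝 u, V' (φ v) = fderiv ℝ φ v (V v))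
    (y : E) : D.lieB V u y = D'.lieB V' (φ u) (fderiv ℝ φ u y) := by
  rw [lieB_apply, lieB_apply, h.fderiv_b, h.fderiv_field hV hV' hVV, hVV.self_of_nhds,
    h.b_eq.self_of_nhds, h.fderiv2_comm (V u) y]
  simp only [map_add]
  ring

lemma X_eq (h : D.Related D' φ u) : D'.X (φ u) = fderiv ℝ φ u (D.X u) := by
  apply A_injective h.mem'
  intro z'
  obtain ⟨z, rfl⟩ := h.surjective z'
  rw [A_X h.mem', ← h.b_eq.self_of_nhds, ← h.A_eq.self_of_nhds, A_X h.mem]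

lemma bsq_eq (h : D.Related D' φ u) : D.bsq u = D'.bsq (φ u) := by
  rw [bsq, bsq, h.X_eq, h.b_eq.self_of_nhds]

/-- The one-form `s` in terms of Lie derivatives along the dual field of `β`. -/
lemma _root_.Randers.LocalRanders.two_s_eq (hu : u ∈ D.U) (y : E) :
    2 * D.s u y = fderiv ℝ D.bsq u y - D.lieB D.X u y := by
  have hdb := ((contDiffAt_b hu).differentiableAt (by simp)).hasFDerivAt
  have hdX := ((contDiffAt_X hu).differentiableAt (by simp)).hasFDerivAt
  have h1 : HasFDerivAt D.bsq _ u := hdb.clm_apply hdX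
  rw [h1.fderiv, lieB_apply, s_eq hu]
  simp
  ring

/-- The condition defining isotropic S-curvature does not depend on the coordinates. -/
lemma isoAt (h : D.Related D' φ u) {σ : ℝ} (hσ : D'.IsoAt σ (φ u)) : D.IsoAt σ u := by
  have hX := (contDiffAt_X h.mem).differentiableAt (by simp)
  have hX' := (contDiffAt_X h.mem').differentiableAt (by simp)
  have hXX : ∀ᶠ v in 𝓝 u, D'.X (φ v) = fderiv ℝ φ v (D.X v) :=
    h.eventually.mono fun v hv => hv.X_eq
  intro y
  have h1 : D.r u y y = D'.r (φ u) (fderiv ℝ φ u y) (fderiv ℝ φ u y) := by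
    have := h.lieA_eq hX hX' hXX y
    rw [lieA_X h.mem, lieA_X h.mem'] at this
    linarith
  have h2 : D.s u y = D'.s (φ u) (fderiv ℝ φ u y) := by
    have e1 := two_s_eq h.mem y
    have e2 := two_s_eq h.mem' (fderiv ℝ φ u y)
    have e3 : fderiv ℝ D.bsq u y = fderiv ℝ D'.bsq (φ u) (fderiv ℝ φ u y) := by
      have h3 : D.bsq =ᶠ[𝓝 u] fun v => D'.bsq (φ v) := h.eventually.mono fun v hv => hv.bsq_eq
      have h4 : HasFDerivAt (fun v => D'.bsq (φ v)) _ u :=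
        ((contDiffAt_bsq h.mem').differentiableAt (by simp)).hasFDerivAt.comp u h.hasFDerivAt
      rw [Filter.EventuallyEq.fderiv_eq (𝕜 := ℝ) h3, h4.fderiv]
      rfl
    rw [h.lieB_eq hX hX' hXX y] at e1
    linarith
  have h3 := hσ (fderiv ℝ φ u y)
  rw [e] at h3 ⊢
  rw [h1, h2, h.b_eq.self_of_nhds, h.A_eq.self_of_nhds, h3]

lemma congr (h : D.Related D' φ u) {ψ : E → E} (hψ : φ =ᶠ[𝓝 u] ψ) : D.Related D' ψ u := by
  have hd : ∀ᶠ v in 𝓝 u, φ v = ψ v ∧ fderiv ℝ φ v = fderiv ℝ ψ v :=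
    hψ.eventually_nhds.mono fun v hv =>
      ⟨hv.self_of_nhds, Filter.EventuallyEq.fderiv_eq (𝕜 := ℝ) hv⟩
  refine ⟨h.mem, hψ.self_of_nhds ▸ h.mem', ?_, ?_, ?_⟩
  · filter_upwards [h.smooth_eventually, hψ.eventually_nhds] with v h1 h2
    exact h1.congr_of_eventuallyEq (Filter.EventuallyEq.symm h2)
  · filter_upwards [h.A_eq, hd] with v h1 h2 y z
    rw [h1, h2.1, h2.2]
  · filter_upwards [h.b_eq, hd] with v h1 h2 y
    rw [h1, h2.1, h2.2]

end Related

variable (D : LocalRanders E)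

/-- The change of coordinates by which normal coordinates at `u` are mapped to the given ones, up to
second order. -/
def normalMap (u v : E) : E := v - (1 / 2 : ℝ) • D.Γ u (v - u) (v - u)

variable {D} {u : E}

lemma contDiff_normalMap : ContDiff ℝ ∞ (D.normalMap u) := by
  have h1 : ContDiff ℝ ∞ (fun v : E => v - u) := contDiff_id.sub contDiff_const
  exact contDiff_id.sub ((((D.Γ u).contDiff.comp h1).clm_apply h1).const_smul (1 / 2 : ℝ))

lemma normalMap_self : D.normalMap u u = u := by simp [normalMap]

lemma fderiv_normalMap (hu : u ∈ D.U) (v : E) :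
    fderiv ℝ (D.normalMap u) v = ContinuousLinearMap.id ℝ E - D.Γ u (v - u) := by
  have h1 : HasFDerivAt (fun v : E => v - u) (ContinuousLinearMap.id ℝ E) v :=
    (hasFDerivAt_id v).sub_const u
  have h2 : HasFDerivAt (D.normalMap u) _ v :=
    (hasFDerivAt_id v).sub ((((D.Γ u).hasFDerivAt.comp v h1).clm_apply h1).const_smul (1 / 2 : ℝ))
  rw [h2.fderiv]
  ext w
  simp [-map_sub]
  rw [Γ_symm hu w (v - u)]
  module

lemma fderiv2_normalMap (hu : u ∈ D.U) (w y : E) :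
    fderiv ℝ (fderiv ℝ (D.normalMap u)) u w y = - D.Γ u w y := by
  have h0 : fderiv ℝ (D.normalMap u) = fun v => ContinuousLinearMap.id ℝ E - D.Γ u (v - u) :=
    funext fun v => fderiv_normalMap hu v
  have h1 : HasFDerivAt (fun v : E => v - u) (ContinuousLinearMap.id ℝ E) u :=
    (hasFDerivAt_id u).sub_const u
  have h2 : HasFDerivAt (fun v => ContinuousLinearMap.id ℝ E - D.Γ u (v - u)) _ u :=
    ((D.Γ u).hasFDerivAt.comp u h1).const_sub (ContinuousLinearMap.id ℝ E)
  rw [h0, h2.fderiv]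
  simp

/-- In the new coordinates, the first derivatives of the metric vanish at the base point. -/
lemma Related.fderiv_A_eq_zero {D' : LocalRanders E} (h : D'.Related D (D.normalMap u) u) :
    fderiv ℝ D'.A u = 0 := by
  have hu : u ∈ D.U := by simpa [normalMap_self] using h.mem'
  ext w y z
  rw [h.fderiv_A, fderiv2_normalMap hu, fderiv2_normalMap hu, fderiv_normalMap hu,
    normalMap_self]
  simp
  rw [D.symm u hu y, A_Γ hu, A_Γ hu, fderiv_A_symm hu w z y, fderiv_A_symm hu y w z,
    fderiv_A_symm hu z w y, fderiv_A_symm hu y z w]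
  ring

end LocalRanders

/-! ### Coordinate expressions of a Randers metric on a manifold -/

section Charts

variable {n : ℕ} {M : Type*} [TopologicalSpace M] [ChartedSpace (Coord n) M]
  [IsManifold 𝓘(ℝ, Coord n) ∞ M]

/-- The coordinate frame of a chart, as a linear map from `ℝⁿ` to the tangent space. -/
def frameAt (e : OpenPartialHomeomorph M (Coord n)) (u : Coord n) : Coord n →L[ℝ] Coord n :=
  mfderiv 𝓘(ℝ, Coord n) 𝓘(ℝ, Coord n) e.symm u

/-- The metric at a point, as a bilinear form on `ℝⁿ`. -/
def metricAt (R : RandersMetric n M) (x : M) : Coord n →L[ℝ] Coord n →L[ℝ] ℝ := R.a.inner x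

/-- The one-form at a point, as a linear form on `ℝⁿ`. -/
def formAt (R : RandersMetric n M) (x : M) : Coord n →L[ℝ] ℝ := R.b x

variable {e e' : OpenPartialHomeomorph M (Coord n)} {u : Coord n}

lemma mdifferentiableAt_symm (he : e ∈ IsManifold.maximalAtlas 𝓘(ℝ, Coord n) ∞ M)
    (hu : u ∈ e.target) : MDifferentiableAt 𝓘(ℝ, Coord n) 𝓘(ℝ, Coord n) e.symm u :=
  (contMDiffAt_symm_of_mem_maximalAtlas he hu).mdifferentiableAt (by simp)

lemma mdifferentiableAt_chart (he : e ∈ IsManifold.maximalAtlas 𝓘(ℝ, Coord n) ∞ M) {x : M}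
    (hx : x ∈ e.source) : MDifferentiableAt 𝓘(ℝ, Coord n) 𝓘(ℝ, Coord n) e x :=
  (contMDiffAt_of_mem_maximalAtlas he hx).mdifferentiableAt (by simp)

/-- Change of coordinates is smooth. -/
lemma contDiffAt_transition (he : e ∈ IsManifold.maximalAtlas 𝓘(ℝ, Coord n) ∞ M)
    (he' : e' ∈ IsManifold.maximalAtlas 𝓘(ℝ, Coord n) ∞ M) (hu : u ∈ e.target)
    (hu' : e.symm u ∈ e'.source) : ContDiffAt ℝ ∞ (e' ∘ e.symm) u := by
  rw [← contMDiffAt_iff_contDiffAt]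
  exact (contMDiffAt_of_mem_maximalAtlas he' hu').comp u
    (contMDiffAt_symm_of_mem_maximalAtlas he hu)

lemma isOpen_overlap (e e' : OpenPartialHomeomorph M (Coord n)) :
    IsOpen {v | v ∈ e.target ∧ e.symm v ∈ e'.source} :=
  e.symm.isOpen_inter_preimage e'.open_source

lemma frameAt_transition (he : e ∈ IsManifold.maximalAtlas 𝓘(ℝ, Coord n) ∞ M)
    (he' : e' ∈ IsManifold.maximalAtlas 𝓘(ℝ, Coord n) ∞ M) (hu : u ∈ e.target)
    (hu' : e.symm u ∈ e'.source) (y : Coord n) :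
    frameAt e u y = frameAt e' (e' (e.symm u)) (fderiv ℝ (e' ∘ e.symm) u y) := by
  have h1 : e.symm =ᶠ[𝓝 u] e'.symm ∘ (e' ∘ e.symm) := by
    filter_upwards [(isOpen_overlap e e').mem_nhds ⟨hu, hu'⟩] with v hv
    exact (e'.left_inv hv.2).symm
  have h2 := mfderiv_comp u (I := 𝓘(ℝ, Coord n)) (I' := 𝓘(ℝ, Coord n)) (I'' := 𝓘(ℝ, Coord n))
    (g := e'.symm) (f := e' ∘ e.symm)
    (mdifferentiableAt_symm he' (e'.map_source hu'))
    ((contDiffAt_transition he he' hu hu').differentiableAt (by simp)).mdifferentiableAt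
  rw [← h1.mfderiv_eq, mfderiv_eq_fderiv] at h2
  exact DFunLike.congr_fun h2 y

lemma frameAt_injective (he : e ∈ IsManifold.maximalAtlas 𝓘(ℝ, Coord n) ∞ M)
    (hu : u ∈ e.target) : Function.Injective (frameAt e u) := by
  have h1 : e ∘ e.symm =ᶠ[𝓝 u] id := by
    filter_upwards [e.open_target.mem_nhds hu] with v hv using e.right_inv hv
  have h2 := mfderiv_comp u (I := 𝓘(ℝ, Coord n)) (I' := 𝓘(ℝ, Coord n)) (I'' := 𝓘(ℝ, Coord n))
    (mdifferentiableAt_chart he (e.map_target hu)) (mdifferentiableAt_symm he hu)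
  rw [h1.mfderiv_eq, mfderiv_id] at h2
  intro y z hyz
  have h3 := fun y => DFunLike.congr_fun h2 y
  have h4 : ∀ y : Coord n, y
      = mfderiv 𝓘(ℝ, Coord n) 𝓘(ℝ, Coord n) e (e.symm u) (frameAt e u y) := h3
  rw [h4 y, h4 z, hyz]

lemma localField_transition (he : e ∈ IsManifold.maximalAtlas 𝓘(ℝ, Coord n) ∞ M)
    (he' : e' ∈ IsManifold.maximalAtlas 𝓘(ℝ, Coord n) ∞ M) (hu : u ∈ e.target)
    (hu' : e.symm u ∈ e'.source) (V : ∀ x : M, TangentSpace 𝓘(ℝ, Coord n) x) :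
    localField V e' ((e' ∘ e.symm) u) = fderiv ℝ (e' ∘ e.symm) u (localField V e u) := by
  have hx := e.map_target hu
  have h1 : e' =ᶠ[𝓝 (e.symm u)] (e' ∘ e.symm) ∘ e := by
    filter_upwards [e.open_source.mem_nhds hx] with x hx
    simp [e.left_inv hx]
  have h2 := mfderiv_comp (e.symm u) (I := 𝓘(ℝ, Coord n)) (I' := 𝓘(ℝ, Coord n))
    (I'' := 𝓘(ℝ, Coord n)) (g := e' ∘ e.symm) (f := e)
    (by rw [e.right_inv hu]; exact ((contDiffAt_transition he he' hu hu').differentiableAt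
          (by simp)).mdifferentiableAt)
    (mdifferentiableAt_chart he hx)
  rw [← h1.mfderiv_eq, e.right_inv hu, mfderiv_eq_fderiv] at h2
  have h3 := DFunLike.congr_fun h2 (V (e.symm u))
  simp only [localField, Function.comp_apply]
  rw [e'.left_inv hu']
  exact h3

/-- The coordinate frame vector fields are smooth. -/
lemma contMDiffOn_frame (he : e ∈ IsManifold.maximalAtlas 𝓘(ℝ, Coord n) ∞ M) (y : Coord n) :
    ContMDiffOn 𝓘(ℝ, Coord n) 𝓘(ℝ, Coord n).tangent ∞
      (fun u => (⟨e.symm u, frameAt e u y⟩ : TangentBundle 𝓘(ℝ, Coord n) M)) e.target := by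
  have h1 := (contMDiffOn_symm_of_mem_maximalAtlas he).contMDiffOn_tangentMapWithin (m := ∞)
    (by simp) e.open_target.uniqueMDiffOn
  have h2 : ContMDiff 𝓘(ℝ, Coord n) 𝓘(ℝ, Coord n).tangent ∞
      (fun u : Coord n => (⟨u, y⟩ : TangentBundle 𝓘(ℝ, Coord n) (Coord n))) :=
    contMDiff_vectorSpace_iff_contDiff.2 contDiff_const
  have h3 := h1.comp (h2.contMDiffOn (s := e.target)) (fun u hu => hu)
  refine h3.congr fun u hu => ?_
  simp only [Function.comp_apply, tangentMapWithin]
  rw [mfderivWithin_of_isOpen e.open_target hu]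
  rfl

/-- The components of a vector field are as smooth as the field. -/
lemma contDiffOn_localField (he : e ∈ IsManifold.maximalAtlas 𝓘(ℝ, Coord n) ∞ M)
    {V : ∀ x : M, TangentSpace 𝓘(ℝ, Coord n) x}
    (hV : ContMDiff 𝓘(ℝ, Coord n) 𝓘(ℝ, Coord n).tangent 2
      (fun x => (⟨x, V x⟩ : TangentBundle 𝓘(ℝ, Coord n) M))) :
    ContDiffOn ℝ 2 (localField V e) e.target := by
  have h1 := (contMDiffOn_of_mem_maximalAtlas he).contMDiffOn_tangentMapWithin (m := 2)
    (WithTop.coe_le_coe.2 le_top) e.open_source.uniqueMDiffOn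
  have h2 : ContMDiffOn 𝓘(ℝ, Coord n) 𝓘(ℝ, Coord n).tangent 2
      (fun u => (⟨e.symm u, V (e.symm u)⟩ : TangentBundle 𝓘(ℝ, Coord n) M)) e.target :=
    hV.comp_contMDiffOn ((contMDiffOn_symm_of_mem_maximalAtlas he).of_le
      (WithTop.coe_le_coe.2 le_top))
  have h3 := h1.comp h2 (fun u hu => e.map_target hu)
  have h4 := (contMDiff_snd_tangentBundle_modelSpace (Coord n) 𝓘(ℝ, Coord n)).comp_contMDiffOn h3
  refine (contMDiffOn_iff_contDiffOn.1 h4).congr fun u hu => ?_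
  have h5 := mfderivWithin_of_isOpen (I := 𝓘(ℝ, Coord n)) (I' := 𝓘(ℝ, Coord n)) (f := e)
    e.open_source (e.map_target hu)
  exact (DFunLike.congr_fun h5 (V (e.symm u))).symm

end Charts

namespace RandersMetric

variable {n : ℕ} {M : Type*} [TopologicalSpace M] [ChartedSpace (Coord n) M]
  [IsManifold 𝓘(ℝ, Coord n) ∞ M] (R : RandersMetric n M)
  {e e' : OpenPartialHomeomorph M (Coord n)} {u : Coord n}

lemma metricAt_pos (x : M) {y : Coord n} (hy : y ≠ 0) : 0 < metricAt R x y y := R.a.pos x y hy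

lemma metricAt_symm (x : M) (y z : Coord n) : metricAt R x y z = metricAt R x z y :=
  R.a.symm x y z

lemma formAt_sq_lt (x : M) {y : Coord n} (hy : y ≠ 0) : formAt R x y ^ 2 < metricAt R x y y := by
  have hpos := R.metricAt_pos x hy
  obtain ⟨r, hr, h⟩ := R.norm_b_lt x
  have h1 : |formAt R x y| ≤ r * Real.sqrt (metricAt R x y y) := h y
  have h2 := Real.sqrt_pos.2 hpos
  have h3 : |formAt R x y| < Real.sqrt (metricAt R x y y) := by nlinarith
  calc formAt R x y ^ 2 = |formAt R x y| ^ 2 := (sq_abs _).symm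
    _ < Real.sqrt (metricAt R x y y) ^ 2 := by gcongr
    _ = metricAt R x y y := Real.sq_sqrt hpos.le

lemma contDiffOn_metric (he : e ∈ IsManifold.maximalAtlas 𝓘(ℝ, Coord n) ∞ M) (y z : Coord n) :
    ContDiffOn ℝ ∞ (fun u => metricAt R (e.symm u) (frameAt e u y) (frameAt e u z)) e.target := by
  have h1 : ContMDiffOn 𝓘(ℝ, Coord n) (𝓘(ℝ, Coord n).prod 𝓘(ℝ, Coord n →L[ℝ] Coord n →L[ℝ] ℝ)) ∞
      (fun u => Bundle.TotalSpace.mk' (Coord n →L[ℝ] Coord n →L[ℝ] ℝ)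
        (E := fun x : M => TangentSpace 𝓘(ℝ, Coord n) x →L[ℝ] TangentSpace 𝓘(ℝ, Coord n) x →L[ℝ]
          Bundle.Trivial M ℝ x) (e.symm u) (R.a.inner (e.symm u))) e.target :=
    R.a.contMDiff.comp_contMDiffOn (contMDiffOn_symm_of_mem_maximalAtlas he)
  have h2 := h1.clm_bundle_apply₂ (F₃ := ℝ) (E₃ := Bundle.Trivial M ℝ)
    (contMDiffOn_frame he y) (contMDiffOn_frame he z)
  rw [← contMDiffOn_iff_contDiffOn]
  intro u hu
  exact (Bundle.contMDiffWithinAt_totalSpace.1 (h2 u hu)).2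

lemma contDiffOn_form (he : e ∈ IsManifold.maximalAtlas 𝓘(ℝ, Coord n) ∞ M) (y : Coord n) :
    ContDiffOn ℝ ∞ (fun u => formAt R (e.symm u) (frameAt e u y)) e.target := by
  have h1 : ContMDiffOn 𝓘(ℝ, Coord n) (𝓘(ℝ, Coord n).prod 𝓘(ℝ, Coord n →L[ℝ] ℝ)) ∞
      (fun u => Bundle.TotalSpace.mk' (Coord n →L[ℝ] ℝ)
        (E := fun x : M => TangentSpace 𝓘(ℝ, Coord n) x →L[ℝ] Bundle.Trivial M ℝ x)
        (e.symm u) (R.b (e.symm u))) e.target :=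
    R.smooth_b.comp_contMDiffOn (contMDiffOn_symm_of_mem_maximalAtlas he)
  have h2 := h1.clm_bundle_apply (F₂ := ℝ) (E₂ := Bundle.Trivial M ℝ) (contMDiffOn_frame he y)
  rw [← contMDiffOn_iff_contDiffOn]
  intro u hu
  exact (Bundle.contMDiffWithinAt_totalSpace.1 (h2 u hu)).2

/-- The coordinate expression of a Randers metric in a chart. -/
def toLocal (e : OpenPartialHomeomorph M (Coord n))
    (he : e ∈ IsManifold.maximalAtlas 𝓘(ℝ, Coord n) ∞ M) : LocalRanders (Coord n) where
  U := e.target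
  A u := (metricAt R (e.symm u)).bilinearComp (frameAt e u) (frameAt e u)
  b u := formAt R (e.symm u) ∘L frameAt e u
  isOpen := e.open_target
  smooth_A := contDiffOn_clm_apply.2 fun y => contDiffOn_clm_apply.2 fun z =>
    R.contDiffOn_metric he y z
  smooth_b := contDiffOn_clm_apply.2 fun y => R.contDiffOn_form he y
  symm u _ y z := R.metricAt_symm (e.symm u) (frameAt e u y) (frameAt e u z)
  pos u hu _ hy := R.metricAt_pos (e.symm u)
    ((map_ne_zero_iff (frameAt e u) (frameAt_injective he hu)).2 hy)
  sq_lt u hu _ hy := R.formAt_sq_lt (e.symm u)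
    ((map_ne_zero_iff (frameAt e u) (frameAt_injective he hu)).2 hy)

lemma localFun_F (he : e ∈ IsManifold.maximalAtlas 𝓘(ℝ, Coord n) ∞ M) :
    localFun R.F e = (R.toLocal e he).F := rfl

lemma localFun_alpha (he : e ∈ IsManifold.maximalAtlas 𝓘(ℝ, Coord n) ∞ M) :
    localFun R.alpha e = (R.toLocal e he).α := rfl

lemma localFun_beta (he : e ∈ IsManifold.maximalAtlas 𝓘(ℝ, Coord n) ∞ M) :
    localFun R.beta e = fun u y => (R.toLocal e he).b u y := rfl

/-- The coordinate expressions in two charts are related by the change of coordinates. -/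
lemma toLocal_related (he : e ∈ IsManifold.maximalAtlas 𝓘(ℝ, Coord n) ∞ M)
    (he' : e' ∈ IsManifold.maximalAtlas 𝓘(ℝ, Coord n) ∞ M) (hu : u ∈ e.target)
    (hu' : e.symm u ∈ e'.source) :
    (R.toLocal e he).Related (R.toLocal e' he') (e' ∘ e.symm) u where
  mem := hu
  mem' := e'.map_source hu'
  smooth_eventually := by
    filter_upwards [(isOpen_overlap e e').mem_nhds ⟨hu, hu'⟩] with v hv
    exact contDiffAt_transition he he' hv.1 hv.2
  A_eq := by
    filter_upwards [(isOpen_overlap e e').mem_nhds ⟨hu, hu'⟩] with v hv y z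
    change metricAt R (e.symm v) (frameAt e v y) (frameAt e v z)
      = metricAt R (e'.symm (e' (e.symm v))) (frameAt e' (e' (e.symm v)) _)
        (frameAt e' (e' (e.symm v)) _)
    rw [← frameAt_transition he he' hv.1 hv.2, ← frameAt_transition he he' hv.1 hv.2,
      e'.left_inv hv.2]
  b_eq := by
    filter_upwards [(isOpen_overlap e e').mem_nhds ⟨hu, hu'⟩] with v hv y
    change formAt R (e.symm v) (frameAt e v y)
      = formAt R (e'.symm (e' (e.symm v))) (frameAt e' (e' (e.symm v)) _)
    rw [← frameAt_transition he he' hv.1 hv.2, e'.left_inv hv.2]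

/-- Normal coordinates, up to second order: around each point there is a chart in which the first
derivatives of the metric vanish at the point. -/
theorem exists_normal_chart (he : e ∈ IsManifold.maximalAtlas 𝓘(ℝ, Coord n) ∞ M)
    (hu : u ∈ e.target) : ∃ (e' : OpenPartialHomeomorph M (Coord n))
      (he' : e' ∈ IsManifold.maximalAtlas 𝓘(ℝ, Coord n) ∞ M),
      e.symm u ∈ e'.source ∧ fderiv ℝ (R.toLocal e' he').A (e' (e.symm u)) = 0 := by
  set D := R.toLocal e he
  have huD : u ∈ D.U := hu
  have hc := D.contDiff_normalMap (u := u)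
  have hd : HasFDerivAt (D.normalMap u) ((ContinuousLinearEquiv.refl ℝ (Coord n) :
      Coord n ≃L[ℝ] Coord n) : Coord n →L[ℝ] Coord n) u := by
    have := (hc.differentiable (by simp) u).hasFDerivAt
    rw [LocalRanders.fderiv_normalMap huD] at this
    simpa using this
  set Ψ₀ := hc.contDiffAt.toOpenPartialHomeomorph (D.normalMap u) hd (by simp)
  -- restrict to the set where the derivative is invertible
  set W : Set (Coord n) := {v | fderiv ℝ (D.normalMap u) v ∈
    Set.range ((↑) : (Coord n ≃L[ℝ] Coord n) → Coord n →L[ℝ] Coord n)}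
  have hW : IsOpen W := ContinuousLinearEquiv.isOpen.preimage (hc.continuous_fderiv (by simp))
  have huW : u ∈ W := ⟨ContinuousLinearEquiv.refl ℝ (Coord n), hd.fderiv.symm⟩
  set Ψ := Ψ₀.restrOpen W hW
  have hΨu : u ∈ Ψ.source := by
    simpa [Ψ] using ⟨hc.contDiffAt.mem_toOpenPartialHomeomorph_source hd (by simp), huW⟩
  have hΨ : (Ψ : Coord n → Coord n) = D.normalMap u := rfl
  have hsymm : ContDiffOn ℝ ∞ Ψ.symm Ψ.target := by
    intro v hv
    have h1 : Ψ.symm v ∈ Ψ.source := Ψ.map_target hv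
    have h2 : Ψ.symm v ∈ W := by
      have := h1
      simp only [Ψ, OpenPartialHomeomorph.restrOpen_source] at this
      exact this.2
    obtain ⟨L, hL⟩ := h2
    refine (Ψ.contDiffAt_symm (f₀' := L) hv ?_ ?_).contDiffWithinAt
    · rw [hL, hΨ]; exact (hc.differentiable (by simp) _).hasFDerivAt
    · rw [hΨ]; exact hc.contDiffAt
  have hΨuu : Ψ u = u := by rw [hΨ, LocalRanders.normalMap_self]
  have hut : u ∈ Ψ.target := by
    have := Ψ.map_source hΨu
    rwa [hΨuu] at this
  have hΨsu : Ψ.symm u = u := by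
    have := Ψ.left_inv hΨu
    rwa [hΨuu] at this
  set e' := e.trans Ψ.symm
  have he' : e' ∈ IsManifold.maximalAtlas 𝓘(ℝ, Coord n) ∞ M := by
    apply OpenPartialHomeomorph.mem_maximalAtlas_of_contMDiffOn
    · have h1 : ∀ x ∈ e'.source, x ∈ e.source ∧ e x ∈ Ψ.target := fun x hx => by
        simpa [e'] using hx
      exact (contMDiffOn_iff_contDiffOn.2 hsymm).comp
        ((contMDiffOn_of_mem_maximalAtlas he).mono fun x hx => (h1 x hx).1)
        fun x hx => (h1 x hx).2
    · have h1 : ∀ v ∈ e'.target, v ∈ Ψ.source ∧ Ψ v ∈ e.target := fun v hv => by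
        simpa [e'] using hv
      exact (contMDiffOn_symm_of_mem_maximalAtlas he).comp
        (contMDiffOn_iff_contDiffOn.2 (hc.contDiffOn (s := e'.target))) fun v hv => (h1 v hv).2
  have hx : e.symm u ∈ e'.source := by simp [e', hu, e.right_inv hu, hut]
  have hxu : e' (e.symm u) = u := by simp [e', e.right_inv hu, hΨsu]
  refine ⟨e', he', hx, ?_⟩
  have ht : u ∈ e'.target := hxu ▸ e'.map_source hx
  have hrel := R.toLocal_related he' he ht (by
    have := e'.left_inv hx
    rw [hxu] at this
    rw [this]; exact e.map_target hu)
  rw [hxu]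
  refine LocalRanders.Related.fderiv_A_eq_zero (hrel.congr ?_)
  filter_upwards [e'.open_target.mem_nhds ht] with v hv
  have : v ∈ Ψ.source ∧ Ψ v ∈ e.target := by simpa [e'] using hv
  change e (e.symm (Ψ v)) = _
  rw [e.right_inv this.2, hΨ]

end RandersMetric

/-! ### From the charts to the manifold -/

section Functions

variable {n : ℕ} {M : Type*} [TopologicalSpace M] [ChartedSpace (Coord n) M]
  [IsManifold 𝓘(ℝ, Coord n) ∞ M]

/-- The vanishing of the differential of a function on `M` does not depend on the chart. -/
lemma fderiv_eq_zero_of_chart {e e' : OpenPartialHomeomorph M (Coord n)}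
    (he : e ∈ IsManifold.maximalAtlas 𝓘(ℝ, Coord n) ∞ M)
    (he' : e' ∈ IsManifold.maximalAtlas 𝓘(ℝ, Coord n) ∞ M) {x : M} (hx : x ∈ e.source)
    (hx' : x ∈ e'.source) {f : M → ℝ} (hf : DifferentiableAt ℝ (f ∘ e'.symm) (e' x))
    (h : fderiv ℝ (f ∘ e'.symm) (e' x) = 0) : fderiv ℝ (f ∘ e.symm) (e x) = 0 := by
  have hu := e.map_source hx
  have hu' : e.symm (e x) ∈ e'.source := by rwa [e.left_inv hx]
  have hd := (contDiffAt_transition he he' hu hu').differentiableAt (by simp)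
  have h1 : f ∘ e.symm =ᶠ[𝓝 (e x)] (f ∘ e'.symm) ∘ (e' ∘ e.symm) := by
    filter_upwards [(isOpen_overlap e e').mem_nhds ⟨hu, hu'⟩] with v hv
    simp [e'.left_inv hv.2]
  have h2 : (e' ∘ e.symm) (e x) = e' x := by simp [e.left_inv hx]
  rw [Filter.EventuallyEq.fderiv_eq (𝕜 := ℝ) h1, fderiv_comp _ (by rwa [h2]) hd, h2, h]
  simp

/-- A function whose differential vanishes on a connected manifold is constant. -/
lemma exists_eq_const_of_fderiv_eq_zero [ConnectedSpace M] {f : M → ℝ}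
    (hd : ∀ e ∈ IsManifold.maximalAtlas 𝓘(ℝ, Coord n) ∞ M, ∀ u ∈ e.target,
      DifferentiableAt ℝ (f ∘ e.symm) u)
    (hf : ∀ e ∈ IsManifold.maximalAtlas 𝓘(ℝ, Coord n) ∞ M, ∀ u ∈ e.target,
      fderiv ℝ (f ∘ e.symm) u = 0) : ∃ c, ∀ x, f x = c := by
  have hloc : IsLocallyConstant f := by
    rw [IsLocallyConstant.iff_eventually_eq]
    intro x
    set e := chartAt (Coord n) x
    have he : e ∈ IsManifold.maximalAtlas 𝓘(ℝ, Coord n) ∞ M := IsManifold.chart_mem_maximalAtlas x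
    have hx : x ∈ e.source := mem_chart_source _ x
    obtain ⟨δ, hδ, hball⟩ := Metric.isOpen_iff.1 e.open_target (e x) (e.map_source hx)
    have hev : ∀ᶠ v in 𝓝 (e x), f (e.symm v) = f x := by
      filter_upwards [Metric.ball_mem_nhds (e x) hδ] with v hv
      have h1 := Metric.isOpen_ball.is_const_of_fderiv_eq_zero (𝕜 := ℝ) (f := f ∘ e.symm)
        (convex_ball (e x) δ).isPreconnected
        (fun w hw => (hd e he w (hball hw)).differentiableWithinAt)
        (fun w hw => hf e he w (hball hw)) hv (Metric.mem_ball_self hδ)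
      simpa [e.left_inv hx] using h1
    rw [← e.map_nhds_eq hx, eventually_map] at hev
    filter_upwards [hev, e.open_source.mem_nhds hx] with x' h1 h2
    rwa [e.left_inv h2] at h1
  obtain ⟨x₀⟩ := (inferInstance : Nonempty M)
  exact ⟨f x₀, fun x => hloc.apply_eq_of_isPreconnected isPreconnected_univ trivial trivial⟩

end Functions

namespace RandersMetric

variable {n : ℕ} {M : Type*} [TopologicalSpace M] [ChartedSpace (Coord n) M]
  [IsManifold 𝓘(ℝ, Coord n) ∞ M] (R : RandersMetric n M)
  {e e' : OpenPartialHomeomorph M (Coord n)} {u : Coord n}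

lemma toLocal_b_eq_zero_iff (he : e ∈ IsManifold.maximalAtlas 𝓘(ℝ, Coord n) ∞ M)
    (hu : u ∈ e.target) : (R.toLocal e he).b u = 0 ↔ formAt R (e.symm u) = 0 := by
  have hs : Function.Surjective (frameAt e u) :=
    (LinearMap.injective_iff_surjective (f := (frameAt e u : Coord n →ₗ[ℝ] Coord n))).1
      (frameAt_injective he hu)
  constructor
  · intro h
    ext y
    obtain ⟨z, rfl⟩ := hs y
    exact DFunLike.congr_fun h z
  · intro h
    ext y
    exact DFunLike.congr_fun h (frameAt e u y)

/-- The set where the one-form vanishes. -/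
def zeroSet : Set M := {x | formAt R x = 0}

lemma exists_normal_chart_at (x : M) : ∃ (e' : OpenPartialHomeomorph M (Coord n))
    (he' : e' ∈ IsManifold.maximalAtlas 𝓘(ℝ, Coord n) ∞ M),
    x ∈ e'.source ∧ fderiv ℝ (R.toLocal e' he').A (e' x) = 0 := by
  have hx := mem_chart_source (Coord n) x
  have := R.exists_normal_chart (IsManifold.chart_mem_maximalAtlas x)
    ((chartAt (Coord n) x).map_source hx)
  rwa [(chartAt (Coord n) x).left_inv hx] at this

lemma toLocal_related_at (he : e ∈ IsManifold.maximalAtlas 𝓘(ℝ, Coord n) ∞ M)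
    (he' : e' ∈ IsManifold.maximalAtlas 𝓘(ℝ, Coord n) ∞ M) {x : M} (hx : x ∈ e.source)
    (hx' : x ∈ e'.source) :
    (R.toLocal e he).Related (R.toLocal e' he') (e' ∘ e.symm) (e x) :=
  R.toLocal_related he he' (e.map_source hx) (by rwa [e.left_inv hx])

lemma transition_apply {x : M} (hx : x ∈ e.source) : (e' ∘ e.symm) (e x) = e' x := by
  simp [e.left_inv hx]

/-- The function `σ` on `M` is the isotropic S-curvature, expressed by the condition on `r` and `s`
in all charts. -/
def IsIso (σ : M → ℝ) : Prop :=
  ∀ (e : OpenPartialHomeomorph M (Coord n)) (he : e ∈ IsManifold.maximalAtlas 𝓘(ℝ, Coord n) ∞ M),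
    ∀ u ∈ e.target, (R.toLocal e he).IsoAt (σ (e.symm u)) u

variable {R}

lemma IsIso.hasIsotropicSBH {σ : M → ℝ} (h : R.IsIso σ) : HasIsotropicSBH R.F σ := by
  intro e he u hu y hy
  rw [R.localFun_F he]
  exact (h e he u hu).sCurvBH hu hy

lemma IsIso.contDiffAt [Nontrivial (Coord n)] {σ : M → ℝ} (h : R.IsIso σ)
    (he : e ∈ IsManifold.maximalAtlas 𝓘(ℝ, Coord n) ∞ M) (hu : u ∈ e.target) :
    ContDiffAt ℝ ∞ (σ ∘ e.symm) u :=
  LocalRanders.contDiffAt_of_isoAt (D := R.toLocal e he) (h e he) hu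

lemma nontrivial_coord (hn : 2 ≤ n) : Nontrivial (Coord n) := by
  have : Nonempty (Fin n) := ⟨⟨0, by omega⟩⟩
  infer_instance

lemma nhds_chart {x : M} (hx : x ∈ e.source) {p : M → Prop} :
    (∀ᶠ v in 𝓝 (e x), p (e.symm v)) ↔ ∀ᶠ x' in 𝓝 x, p x' := by
  rw [← e.map_nhds_eq hx, eventually_map]
  exact eventually_congr (by
    filter_upwards [e.open_source.mem_nhds hx] with x' h; rw [e.left_inv h])

lemma eventually_b_iff (he : e ∈ IsManifold.maximalAtlas 𝓘(ℝ, Coord n) ∞ M) {x : M}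
    (hx : x ∈ e.source) :
    (∀ᶠ v in 𝓝 (e x), (R.toLocal e he).b v = 0) ↔ x ∈ interior R.zeroSet := by
  rw [mem_interior_iff_mem_nhds]
  refine Iff.trans (eventually_congr ?_) (nhds_chart hx (p := fun x => formAt R x = 0))
  filter_upwards [e.open_target.mem_nhds (e.map_source hx)] with v hv
  exact R.toLocal_b_eq_zero_iff he hv

/-- Unique continuation on the manifold: `β` cannot vanish on an open set, unless `F` is
Riemannian. -/
theorem IsIso.interior_zeroSet [ConnectedSpace M] (hn : 2 ≤ n) {σ : M → ℝ} (h : R.IsIso σ)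
    (hR : ¬ IsRiemannian R.F) (h3 : 3 ≤ n ∨ ∀ x, σ x = 0) : interior R.zeroSet = ∅ := by
  have hclosed : IsClosed (interior R.zeroSet) := by
    refine isClosed_of_closure_subset fun x hx => ?_
    set e := chartAt (Coord n) x
    have he : e ∈ IsManifold.maximalAtlas 𝓘(ℝ, Coord n) ∞ M := IsManifold.chart_mem_maximalAtlas x
    have hxe : x ∈ e.source := mem_chart_source _ x
    rw [← eventually_b_iff he hxe]
    refine LocalRanders.eventually_b_eq_zero hn (e.map_source hxe) (h e he)
      (h3.imp id fun h v _ => h _) ?_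
    rw [← e.map_nhds_eq hxe, frequently_map]
    refine ((mem_closure_iff_frequently.1 hx).and_eventually
      (e.open_source.mem_nhds hxe)).mono fun x' hx' => ?_
    exact (eventually_b_iff he hx'.2).2 hx'.1
  rcases isClopen_iff.1 ⟨hclosed, isOpen_interior⟩ with h0 | h0
  · exact h0
  · refine absurd ⟨R.a, fun x y => ?_⟩ hR
    have hx : x ∈ interior R.zeroSet := h0 ▸ Set.mem_univ x
    have h1 : x ∈ R.zeroSet := interior_subset hx
    have h2 : R.b x y = 0 := DFunLike.congr_fun (show formAt R x = 0 from h1) y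
    simp [F, alpha, beta, h2]

/-- A continuous function which vanishes where `β` does not vanishes everywhere. -/
lemma eq_zero_of_interior_zeroSet (hZ : interior R.zeroSet = ∅) {x : M} (hx : x ∈ e.source)
    {f : Coord n → ℝ} (hf : ContinuousAt f (e x))
    (h : ∀ x' ∈ e.source, formAt R x' ≠ 0 → f (e x') = 0) : f (e x) = 0 := by
  by_contra hne
  have h1 := hf.eventually_ne hne
  rw [← e.map_nhds_eq hx, eventually_map] at h1
  have h2 : x ∈ interior R.zeroSet := by
    rw [mem_interior_iff_mem_nhds]
    filter_upwards [h1, e.open_source.mem_nhds hx] with x' h1 h2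
    by_contra h3
    exact h1 (h x' h2 h3)
  rw [hZ] at h2
  exact h2

section Soliton

variable {V : ∀ x : M, TangentSpace 𝓘(ℝ, Coord n) x}

lemma differentiableAt_localField
    (hV : ContMDiff 𝓘(ℝ, Coord n) 𝓘(ℝ, Coord n).tangent 2
      (fun x => (⟨x, V x⟩ : TangentBundle 𝓘(ℝ, Coord n) M)))
    (he : e ∈ IsManifold.maximalAtlas 𝓘(ℝ, Coord n) ∞ M) (hu : u ∈ e.target) :
    DifferentiableAt ℝ (localField V e) u :=
  ((contDiffOn_localField he hV).contDiffAt (e.open_target.mem_nhds hu)).differentiableAt (by simp)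

/-- The Lie derivative of the metric at a point, in two charts. -/
lemma lieA_chart
    (hV : ContMDiff 𝓘(ℝ, Coord n) 𝓘(ℝ, Coord n).tangent 2
      (fun x => (⟨x, V x⟩ : TangentBundle 𝓘(ℝ, Coord n) M)))
    (he : e ∈ IsManifold.maximalAtlas 𝓘(ℝ, Coord n) ∞ M)
    (he' : e' ∈ IsManifold.maximalAtlas 𝓘(ℝ, Coord n) ∞ M) {x : M} (hx : x ∈ e.source)
    (hx' : x ∈ e'.source) {c : ℝ}
    (h : ∀ y, (R.toLocal e' he').lieA (localField V e') (e' x) y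
      = c * (R.toLocal e' he').A (e' x) y y) (y : Coord n) :
    (R.toLocal e he).lieA (localField V e) (e x) y = c * (R.toLocal e he).A (e x) y y := by
  have hrel := R.toLocal_related_at he he' hx hx'
  have ht : (e' ∘ e.symm) (e x) = e' x := transition_apply hx
  have hVV : ∀ᶠ v in 𝓝 (e x), localField V e' ((e' ∘ e.symm) v)
      = fderiv ℝ (e' ∘ e.symm) v (localField V e v) := by
    filter_upwards [(isOpen_overlap e e').mem_nhds
      ⟨e.map_source hx, by rwa [e.left_inv hx]⟩] with v hv
    exact localField_transition he he' hv.1 hv.2 V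
  rw [hrel.lieA_eq (differentiableAt_localField hV he (e.map_source hx))
    (by rw [ht]; exact differentiableAt_localField hV he' (e'.map_source hx')) hVV,
    hrel.A_eq.self_of_nhds, ht, h]

/-- An almost Ricci soliton has isotropic S-curvature. -/
theorem exists_isIso (hn : 2 ≤ n) (hV : IsAlmostRicciSoliton R.F V) : ∃ σ : M → ℝ, R.IsIso σ := by
  obtain ⟨hV, κ, hκ⟩ := hV
  have key : ∀ x : M, ∃ s : ℝ, ∀ (e : OpenPartialHomeomorph M (Coord n))
      (he : e ∈ IsManifold.maximalAtlas 𝓘(ℝ, Coord n) ∞ M), x ∈ e.source →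
      (R.toLocal e he).IsoAt s (e x) := by
    intro x
    obtain ⟨e', he', hx', hN⟩ := R.exists_normal_chart_at x
    have hu' := e'.map_source hx'
    obtain ⟨s, hs⟩ := LocalRanders.SolitonAt.exists_isoAt (D := R.toLocal e' he') hn hu' hN
      (differentiableAt_localField hV he' hu') (fun y hy => hκ e' he' _ hu' y hy)
    refine ⟨s, fun e he hx => (R.toLocal_related_at he he' hx hx').isoAt ?_⟩
    rwa [transition_apply hx]
  choose σ hσ using key
  refine ⟨σ, fun e he u hu => ?_⟩
  have := hσ (e.symm u) e he (e.map_target hu)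
  rwa [e.right_inv hu] at this

/-- The soliton field is conformal for `α` at the points where `β` does not vanish, and in dimension
two at all points. -/
lemma IsIso.conformal_at (hn : 2 ≤ n) {σ : M → ℝ} (h : R.IsIso σ)
    (hV : IsAlmostRicciSoliton R.F V) {x : M} (hx : n = 2 ∨ formAt R x ≠ 0) :
    ∃ c : ℝ, ∀ (e : OpenPartialHomeomorph M (Coord n))
      (he : e ∈ IsManifold.maximalAtlas 𝓘(ℝ, Coord n) ∞ M), x ∈ e.source → ∀ y,
      (R.toLocal e he).lieA (localField V e) (e x) y = c * (R.toLocal e he).A (e x) y y := by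
  obtain ⟨hV, κ, hκ⟩ := hV
  have := nontrivial_coord hn
  obtain ⟨e', he', hx', hN⟩ := R.exists_normal_chart_at x
  have hu' := e'.map_source hx'
  have hσ := (h.contDiffAt he' hu').differentiableAt (by simp)
  have hd := differentiableAt_localField hV he' hu'
  have hs : (R.toLocal e' he').SolitonAt (localField V e') (κ (e'.symm (e' x))) (e' x) :=
    fun y hy => hκ e' he' _ hu' y hy
  have hc : ∃ c : ℝ, ∀ y, (R.toLocal e' he').lieA (localField V e') (e' x) y
      = c * (R.toLocal e' he').A (e' x) y y := by
    by_cases hX : (R.toLocal e' he').X (e' x) = 0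
    · have h2 : n = 2 := by
        refine hx.resolve_right (not_not.2 ?_)
        have h1 : (R.toLocal e' he').b (e' x) = 0 := by
          ext z
          rw [← LocalRanders.A_X (D := R.toLocal e' he') hu' z, hX]
          simp
        rwa [R.toLocal_b_eq_zero_iff he' hu', e'.left_inv hx'] at h1
      subst h2
      exact hs.conformal_two hu' hN hσ (h e' he') hd hX
    · exact hs.conformal_of_ne hu' hN hσ (h e' he') hd hX
  obtain ⟨c, hc⟩ := hc
  exact ⟨c, fun e he hx => lieA_chart hV he he' hx hx' hc⟩

lemma contDiffAt_lieA
    (hV : ContMDiff 𝓘(ℝ, Coord n) 𝓘(ℝ, Coord n).tangent 2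
      (fun x => (⟨x, V x⟩ : TangentBundle 𝓘(ℝ, Coord n) M)))
    (he : e ∈ IsManifold.maximalAtlas 𝓘(ℝ, Coord n) ∞ M) (hu : u ∈ e.target) (y : Coord n) :
    ContDiffAt ℝ 1 (fun v => (R.toLocal e he).lieA (localField V e) v y) u := by
  have hVu := (contDiffOn_localField he hV).contDiffAt (e.open_target.mem_nhds hu)
  have hA : ContDiffAt ℝ 1 (R.toLocal e he).A u :=
    (LocalRanders.contDiffAt_A (D := R.toLocal e he) hu).of_le (WithTop.coe_le_coe.2 le_top)
  have hDA : ContDiffAt ℝ 1 (fderiv ℝ (R.toLocal e he).A) u :=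
    (LocalRanders.contDiffAt_fderiv_A (D := R.toLocal e he) hu).of_le
      (WithTop.coe_le_coe.2 le_top)
  have hDV : ContDiffAt ℝ 1 (fderiv ℝ (localField V e)) u :=
    hVu.fderiv_right (m := 1) (by norm_num)
  have hy : ContDiffAt ℝ 1 (fun _ : Coord n => y) u := contDiffAt_const
  exact (((hDA.clm_apply (hVu.of_le (by norm_num))).clm_apply hy).clm_apply hy).add
    (contDiffAt_const.mul ((hA.clm_apply (hDV.clm_apply hy)).clm_apply hy))

/-- The field of an almost Ricci soliton is conformal for `α`. -/
theorem IsIso.exists_conformal [ConnectedSpace M] (hn : 2 ≤ n) {σ : M → ℝ} (h : R.IsIso σ)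
    (hR : ¬ IsRiemannian R.F) (hV : IsAlmostRicciSoliton R.F V) :
    ∃ c : M → ℝ, ∀ x (e : OpenPartialHomeomorph M (Coord n))
      (he : e ∈ IsManifold.maximalAtlas 𝓘(ℝ, Coord n) ∞ M), x ∈ e.source → ∀ y,
      (R.toLocal e he).lieA (localField V e) (e x) y = c x * (R.toLocal e he).A (e x) y y := by
  have := nontrivial_coord hn
  suffices H : ∀ x, ∃ c : ℝ, ∀ (e : OpenPartialHomeomorph M (Coord n))
      (he : e ∈ IsManifold.maximalAtlas 𝓘(ℝ, Coord n) ∞ M), x ∈ e.source → ∀ y,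
      (R.toLocal e he).lieA (localField V e) (e x) y = c * (R.toLocal e he).A (e x) y y by
    choose c hc using H
    exact ⟨c, hc⟩
  intro x
  rcases hn.eq_or_lt with h2 | h3
  · exact h.conformal_at hn hV (Or.inl h2.symm)
  have hZ := h.interior_zeroSet hn hR (Or.inl h3)
  set e' := chartAt (Coord n) x
  have he' : e' ∈ IsManifold.maximalAtlas 𝓘(ℝ, Coord n) ∞ M := IsManifold.chart_mem_maximalAtlas x
  have hx' : x ∈ e'.source := mem_chart_source _ x
  have hu' := e'.map_source hx'
  obtain ⟨z, hz⟩ := exists_ne (0 : Coord n)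
  set D := R.toLocal e' he'
  have hcont : ∀ w, ContinuousAt (fun v => D.A v w w) (e' x) := fun w =>
    (LocalRanders.hasFDerivAt_A_base (D := D) hu' w w).continuousAt
  have key : ∀ y, D.lieA (localField V e') (e' x) y * D.A (e' x) z z
      - D.lieA (localField V e') (e' x) z * D.A (e' x) y y = 0 := by
    intro y
    refine eq_zero_of_interior_zeroSet hZ hx'
      (f := fun v => D.lieA (localField V e') v y * D.A v z z
      - D.lieA (localField V e') v z * D.A v y y) ?_ ?_
    · exact ((contDiffAt_lieA hV.1 he' hu' y).continuousAt.mul (hcont z)).sub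
        ((contDiffAt_lieA hV.1 he' hu' z).continuousAt.mul (hcont y))
    · intro x' hx'' hne
      obtain ⟨c, hc⟩ := h.conformal_at hn hV (Or.inr hne)
      have hc := hc e' he' hx''
      simp only [D, hc]
      ring
  refine ⟨D.lieA (localField V e') (e' x) z / D.A (e' x) z z, fun e he hx =>
    lieA_chart hV.1 he he' hx hx' fun y => ?_⟩
  have hpos := (D.pos _ hu' z hz).ne'
  have := key y
  change D.lieA (localField V e') (e' x) y = _ * D.A (e' x) y y
  field_simp
  linarith

/-- The rigidity part: if the soliton field scales `β` with the conformal factor of `α`, then the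
S-curvature and the conformal factor are constant. -/
theorem IsIso.homothetic [ConnectedSpace M] (hn : 2 ≤ n) {σ : M → ℝ} (hσ : R.IsIso σ)
    (hR : ¬ IsRiemannian R.F) (hV : IsAlmostRicciSoliton R.F V) {c : M → ℝ}
    (hcα : IsConformalField R.alpha V c) (hcβ : LieEq R.beta V c) :
    (∃ σ₀ : ℝ, HasIsotropicSBH R.F (fun _ => σ₀)) ∧ ∃ c₀ : ℝ, IsHomotheticField R.F V c₀ := by
  have hnt := nontrivial_coord hn
  -- the two conditions in terms of the coefficients
  have hA : ∀ (e : OpenPartialHomeomorph M (Coord n))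
      (he : e ∈ IsManifold.maximalAtlas 𝓘(ℝ, Coord n) ∞ M), ∀ u ∈ e.target, ∀ y,
      (R.toLocal e he).lieA (localField V e) u y
        = 4 * c (e.symm u) * (R.toLocal e he).A u y y := by
    intro e he u hu y
    by_cases hy : y = 0
    · simp [hy, LocalRanders.lieA]
    have h1 := hcα e he u hu y hy
    have hpos := LocalRanders.α_pos (D := R.toLocal e he) hu hy
    have hsq := LocalRanders.α_sq (D := R.toLocal e he) hu y
    rw [R.localFun_alpha he, LocalRanders.lieLift_α (D := R.toLocal e he) hu hy
      (differentiableAt_localField hV.1 he hu), div_eq_iff (by positivity)] at h1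
    rw [h1, ← hsq]
    ring
  have hB : ∀ (e : OpenPartialHomeomorph M (Coord n))
      (he : e ∈ IsManifold.maximalAtlas 𝓘(ℝ, Coord n) ∞ M), ∀ u ∈ e.target, ∀ y,
      (R.toLocal e he).lieB (localField V e) u y
        = 2 * c (e.symm u) * (R.toLocal e he).b u y := by
    intro e he u hu y
    by_cases hy : y = 0
    · simp [hy]
    have h1 := hcβ e he u hu y hy
    rwa [R.localFun_beta he, LocalRanders.lieLift_β (D := R.toLocal e he) hu
      (differentiableAt_localField hV.1 he hu)] at h1
  -- `σ` is constant
  have hσd : ∀ e ∈ IsManifold.maximalAtlas 𝓘(ℝ, Coord n) ∞ M, ∀ u ∈ e.target,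
      DifferentiableAt ℝ (σ ∘ e.symm) u := fun e he u hu =>
    (hσ.contDiffAt he hu).differentiableAt (by simp)
  obtain ⟨σ₀, hσ₀⟩ := exists_eq_const_of_fderiv_eq_zero hσd (by
    intro e he u hu
    obtain ⟨e', he', hx', hN⟩ := R.exists_normal_chart_at (e.symm u)
    have hu' := e'.map_source hx'
    obtain ⟨κ, hκ⟩ := hV.2
    have hs : (R.toLocal e' he').SolitonAt (localField V e') (κ (e'.symm (e' (e.symm u))))
      (e' (e.symm u)) := fun y hy => hκ e' he' _ hu' y hy
    have h1 := hs.fderiv_sigma_eq_zero hn hu' hN (hσd e' he' _ hu') (hσ e' he')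
      (differentiableAt_localField hV.1 he' hu') (hA e' he' _ hu') (hB e' he' _ hu')
    have h2 := fderiv_eq_zero_of_chart he he' (e.map_target hu) hx' (hσd e' he' _ hu') h1
    rwa [e.right_inv hu] at h2)
  have hZ : interior R.zeroSet = ∅ := by
    by_cases h3 : 3 ≤ n
    · exact hσ.interior_zeroSet hn hR (Or.inl h3)
    -- in dimension two, constancy forces `σ = 0` if `β` vanishes on an open set
    by_contra hne
    obtain ⟨x, hx⟩ := Set.nonempty_iff_ne_empty.2 hne
    have he := IsManifold.chart_mem_maximalAtlas (I := 𝓘(ℝ, Coord n)) (n := ∞) x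
    have hxe := mem_chart_source (Coord n) x
    have hu := (chartAt (Coord n) x).map_source hxe
    have h1 := (hσ _ he _ hu).eq_zero hu ((eventually_b_iff he hxe).2 hx)
    rw [hσ₀] at h1
    exact hne (hσ.interior_zeroSet hn hR (Or.inr fun x => by rw [hσ₀, h1]))
  have hiso : ∀ (e : OpenPartialHomeomorph M (Coord n))
      (he : e ∈ IsManifold.maximalAtlas 𝓘(ℝ, Coord n) ∞ M), ∀ u ∈ e.target,
      (R.toLocal e he).IsoAt σ₀ u := fun e he u hu => by
    have := hσ e he u hu
    rwa [hσ₀] at this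
  -- `c` is continuously differentiable, and its differential vanishes where `β` does not
  have hcd : ∀ e ∈ IsManifold.maximalAtlas 𝓘(ℝ, Coord n) ∞ M, ∀ u ∈ e.target,
      ContDiffAt ℝ 1 (c ∘ e.symm) u := by
    intro e he u hu
    obtain ⟨z, hz⟩ := exists_ne (0 : Coord n)
    set D := R.toLocal e he
    have hAz : ContDiffAt ℝ 1 (fun v => 4 * D.A v z z) u :=
      contDiffAt_const.mul ((((LocalRanders.contDiffAt_A (D := D) hu).clm_apply
        contDiffAt_const).clm_apply contDiffAt_const).of_le (WithTop.coe_le_coe.2 le_top))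
    refine ((contDiffAt_lieA (R := R) hV.1 he hu z).div hAz
      (mul_ne_zero four_ne_zero (D.pos u hu z hz).ne')).congr_of_eventuallyEq ?_
    filter_upwards [e.open_target.mem_nhds hu] with v hv
    have h1 := hA e he v hv z
    have h2 := (D.pos v hv z hz).ne'
    change c (e.symm v) = (R.toLocal e he).lieA (localField V e) v z / (4 * D.A v z z)
    rw [h1, eq_div_iff (mul_ne_zero four_ne_zero h2)]
    ring
  obtain ⟨c₀, hc₀⟩ := exists_eq_const_of_fderiv_eq_zero
    (fun e he u hu => (hcd e he u hu).differentiableAt (by simp)) (by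
    intro e he u hu
    have hxu := e.map_target hu
    ext y
    rw [← e.right_inv hu]
    refine eq_zero_of_interior_zeroSet hZ hxu (f := fun v => fderiv ℝ (c ∘ e.symm) v y) ?_ ?_
    · rw [e.right_inv hu]
      exact (((hcd e he u hu).fderiv_right (m := 0) (by norm_num)).continuousAt).clm_apply
        continuousAt_const
    · intro x hx hne
      obtain ⟨e', he', hx', hN⟩ := R.exists_normal_chart_at x
      have hu' := e'.map_source hx'
      set D := R.toLocal e' he'
      have hVc := fun v (hv : v ∈ e'.target) =>
        (contDiffOn_localField he' hV.1).contDiffAt (e'.open_target.mem_nhds hv)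
      have hX : D.X (e' x) ≠ 0 := by
        intro hX
        apply hne
        have h1 : D.b (e' x) = 0 := by
          ext z
          rw [← LocalRanders.A_X (D := D) hu' z, hX]
          simp
        rwa [R.toLocal_b_eq_zero_iff he' hu', e'.left_inv hx'] at h1
      have h1 := LocalRanders.fderiv_factor_eq_zero (D := D) (c := c ∘ e'.symm)
        (by simpa using hn) hu' hN (hVc _ hu')
        (fun v hv => ((hVc v hv).fderiv_right (m := 1) (by norm_num)).differentiableAt (by simp))
        ((hcd e' he' _ hu').differentiableAt (by simp)) (hiso e' he') (hA e' he') (hB e' he') hX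
      have h2 := fderiv_eq_zero_of_chart he he' hx hx'
        ((hcd e' he' _ hu').differentiableAt (by simp)) h1
      simp [h2])
  refine ⟨⟨σ₀, ?_⟩, c₀, ?_⟩
  · intro e he u hu y hy
    rw [R.localFun_F he]
    exact (hiso e he u hu).sCurvBH hu hy
  · intro e he u hu y hy
    have hpos := LocalRanders.α_pos (D := R.toLocal e he) hu hy
    have hsq := LocalRanders.α_sq (D := R.toLocal e he) hu y
    rw [R.localFun_F he, LocalRanders.lieLift_F (D := R.toLocal e he) hu hy
      (differentiableAt_localField hV.1 he hu), hA e he u hu, hB e he u hu, ← hsq, hc₀]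
    simp only [LocalRanders.F]
    field_simp
    ring

end Soliton

end RandersMetric

end Randers

end

open Randers Randers.RandersMetric in
theorem corollary1p1 {n : ℕ} (hn : 2 ≤ n) {M : Type*} [TopologicalSpace M]
    [ChartedSpace (Randers.Coord n) M] [IsManifold 𝓘(ℝ, Randers.Coord n) ∞ M]
    [ConnectedSpace M] (R : Randers.RandersMetric n M)
    (hR : ¬ Randers.IsRiemannian R.F)
    (V : ∀ x : M, TangentSpace 𝓘(ℝ, Randers.Coord n) x)
    (hV : Randers.IsAlmostRicciSoliton R.F V) :
    (∃ σ : M → ℝ, Randers.HasIsotropicSBH R.F σ) ∧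
    (∃ c : M → ℝ, Randers.IsConformalField R.alpha V c) ∧
    ∀ c : M → ℝ, Randers.IsConformalField R.alpha V c → Randers.LieEq R.beta V c →
      (∃ σ₀ : ℝ, Randers.HasIsotropicSBH R.F (fun _ => σ₀)) ∧
      ∃ c₀ : ℝ, Randers.IsHomotheticField R.F V c₀ := by
  obtain ⟨σ, hσ⟩ := exists_isIso hn hV
  refine ⟨⟨σ, hσ.hasIsotropicSBH⟩, ?_, fun c hcα hcβ => hσ.homothetic hn hR hV hcα hcβ⟩
  obtain ⟨c, hc⟩ := hσ.exists_conformal hn hR hV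
  refine ⟨fun x => c x / 4, fun e he u hu y hy => ?_⟩
  have h1 := hc (e.symm u) e he (e.map_target hu) y
  rw [e.right_inv hu] at h1
  have hpos := LocalRanders.α_pos (D := R.toLocal e he) hu hy
  have hsq := LocalRanders.α_sq (D := R.toLocal e he) hu y
  rw [R.localFun_alpha he, LocalRanders.lieLift_α (D := R.toLocal e he) hu hy
    (differentiableAt_localField hV.1 he hu), h1, ← hsq]
  field_simp
  ring
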